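/- Let $H_1,H_2:\mathbb{R}^n\times\mathbb{R}^n\to\mathbb{R}$, $(\xi,p)\mapsto H_i(\xi,p)$, be continuous, $\mathbb{Z}^n$-periodic in $\xi$, convex in $p$, and coercive in $p$ uniformly in $\xi$, i.e. $\lim_{r\to\infty}\inf\{H_i(\xi,p) : \xi\in\mathbb{R}^n,\ |p|\ge r\}=\infty$. Let $L_i(\xi,q)=\sup_{p\in\mathbb{R}^n}(p\cdot q-H_i(\xi,p))\in\mathbb{R}\cup\{+\infty\}$. Let $c_1,c_2,\varepsilon>0$, and for $i=1,2$ let $\mathbb{P}_i$ (with expectation $\mathbb{E}_i$) be the law, on the space of càdlàg paths $[0,\infty)\to\{1,2\}$, of a continuous-time Markov chain $\nu^\varepsilon$ with $\nu^\varepsilon(0)=i$ and $$\mathbb{P}\big(\nu^\varepsilon(s+h)=j\mid\nu^\varepsilon(s)=k\big)=\frac{c_k}{\varepsilon}h+o(h)\quad (h\to0^+),\qquad j\ne k,$$ with $o(h)$ uniform in $s$. A random curve $\eta$ is called non-anticipating if, for each $s$, $\eta(s)$ is measurable with respect to $\sigma(\nu^\varepsilon(r):r\le s)$. Below, $\{i,j\}=\{1,2\}$.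 **(a) Cauchy problem (Verification Theorem).** Let $T>0$, let $f_1,f_2\in C^1(\mathbb{R}^n)$ have bounded gradients, and for $x\in\mathbb{R}^n$, $t\in[0,T]$ set $$u_i^\varepsilon(x,t)=\inf_\eta\ \mathbb{E}_i\Big[\int_0^tL_{\nu^\varepsilon(s)}\Big(\frac{\eta(s)}\varepsilon,-\dot\eta(s)\Big)ds+f_{\nu^\varepsilon(t)}(\eta(t))\Big],$$ the infimum being over all non-anticipating random curves $\eta$ with paths in $\mathrm{AC}([0,t],\mathbb{R}^n)$ and $\eta(0)=x$. If $u_1^\varepsilon,u_2^\varepsilon$ are continuous on $\mathbb{R}^n\times[0,T]$, then they are finite and $(u_1^\varepsilon,u_2^\varepsilon)$ is a viscosity solution of $$(\mathrm{C}_\varepsilon)\qquad (u_i^\varepsilon)_t+H_i\Big(\frac x\varepsilon,Du_i^\varepsilon\Big)+\frac{c_i}\varepsilon(u_i^\varepsilon-u_j^\varepsilon)=0\ \text{ in }\mathbb{R}^n\times(0,T),\qquad u_i^\varepsilon(\cdot,0)=f_i\ \text{ on }\mathbb{R}^n .$$ **(b) Dirichlet problem.** Let $\Omega\subset\mathbb{R}^n$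 be a bounded domain, $g_1,g_2\in C(\partial\Omega)$, and for $x\in\overline\Omega$ set $$u_i^\varepsilon(x)=\inf_{\eta,\tau}\ \mathbb{E}_i\Big[\int_0^\tau e^{-s}L_{\nu^\varepsilon(s)}\Big(\frac{\eta(s)}\varepsilon,-\dot\eta(s)\Big)ds+e^{-\tau}g_{\nu^\varepsilon(\tau)}(\eta(\tau))\Big],\qquad e^{-\infty}:=0,$$ the infimum being over all non-anticipating random, locally absolutely continuous curves $\eta:[0,\infty)\to\overline\Omega$ with $\eta(0)=x$ and all stopping times $\tau\in[0,\infty]$ of $\nu^\varepsilon$ with $\eta(\tau)\in\partial\Omega$ where $\tau<\infty$. If $u_1^\varepsilon,u_2^\varepsilon$ are continuous on $\overline\Omega$, then they are finite and $(u_1^\varepsilon,u_2^\varepsilon)$ is a viscosity solution of $$(\mathrm{D}_\varepsilon)\qquad u_i^\varepsilon+H_i\Big(\frac x\varepsilon,Du_i^\varepsilon\Big)+\frac{c_i}\varepsilon(u_i^\varepsilon-u_j^\varepsilon)=0\ \text{ in }\Omega,\qquad u_i^\varepsilon=g_i\ \text{ on }\partial\Omega,$$ where the boundary condition is understood in the viscosity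 sense: at contact points $x\in\partial\Omega$ (relative to $\overline\Omega$) a subsolution satisfies the differential inequality ($\le0$) or $u_i^\varepsilon\le g_i$, and a supersolution satisfies the differential inequality ($\ge0$) or $u_i^\varepsilon\ge g_i$. -/

import Mathlib

open MeasureTheory Set Filter Topology Asymptotics
open scoped NNReal ENNReal

noncomputable section

namespace SwitchingControl

/-- `ℝⁿ` with the Euclidean norm. -/
abbrev Space (n : ℕ) : Type := EuclideanSpace ℝ (Fin n)

/-! ### Hamiltonians and Lagrangians -/

/-- The standing assumptions on a Hamiltonian `H(ξ, p)`: joint continuity, coercivity in `p`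
uniformly in `ξ`, `ℤⁿ`-periodicity in `ξ`, and convexity in `p`. -/
structure IsConvexHamiltonian {n : ℕ} (H : Space n → Space n → ℝ) : Prop where
  continuous : Continuous (fun z : Space n × Space n => H z.1 z.2)
  coercive : ∀ M : ℝ, ∃ r : ℝ, ∀ ξ p : Space n, r ≤ ‖p‖ → M ≤ H ξ p
  periodic : ∀ (ξ p : Space n) (z : Fin n → ℤ),
    H (ξ + WithLp.toLp 2 (fun k => (z k : ℝ))) p = H ξ p
  convex : ∀ ξ : Space n, ConvexOn ℝ univ (H ξ)

/-- The Fenchel–Legendre transform `L(ξ, q) = sup_p (p · q - H(ξ, p))`, with values in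
the extended reals. -/
def lagrangian {n : ℕ} (H : Space n → Space n → ℝ) (ξ q : Space n) : EReal :=
  ⨆ p : Space n, ((inner ℝ p q - H ξ p : ℝ) : EReal)

/-! ### Integration of extended-real functions -/

/-- `∫ g⁺ dμ - ∫ g⁻ dμ`, the integral of an extended-real function whose negative part has
finite integral (which is the case for all the functions integrated below). -/
def extIntegral {α : Type*} [MeasurableSpace α] (μ : Measure α) (g : α → EReal) : EReal :=
  ((∫⁻ a, (g a).toENNReal ∂μ : ℝ≥0∞) : EReal) - ((∫⁻ a, (-g a).toENNReal ∂μ : ℝ≥0∞) : EReal)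

/-! ### The two-state continuous-time Markov chain, realized on its path space -/

/-- The càdlàg paths `[0, ∞) → {1, 2}`; the two states are the elements of `Fin 2`. The
σ-algebra is the one generated by the coordinates `ω ↦ ω(s)`, and the process is
`ν(s)(ω) = ω(s)`. -/
abbrev SwitchPath : Type :=
  {ω : ℝ≥0 → Fin 2 // (∀ s, ContinuousWithinAt ω (Ici s) s) ∧
    ∀ s, 0 < s → ∃ l, Tendsto ω (𝓝[<] s) (𝓝 l)}

theorem stronglyMeasurable_coord (s : ℝ≥0) :
    StronglyMeasurable (fun ω : SwitchPath => ω.1 s) :=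
  ((measurable_pi_apply s).comp measurable_subtype_coe).stronglyMeasurable

/-- The history `σ(ν(r) : r ≤ s)` of the process. -/
def history : Filtration ℝ≥0 (inferInstance : MeasurableSpace SwitchPath) :=
  Filtration.natural (fun s ω => ω.1 s) stronglyMeasurable_coord

/-- `μ` is the law of a continuous-time Markov chain `ν` on the two states with `ν(0) = i` and
`ℙ(ν(s + h) = j ∣ ν(s) = k) = rate k * h + o(h)` as `h → 0⁺` for `j ≠ k`, with one `o(h)` for
all times `s` (the conditional probability is considered where it is defined). -/
structure IsSwitchingLaw (rate : Fin 2 → ℝ) (i : Fin 2) (μ : Measure SwitchPath) : Prop where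
  isProbabilityMeasure : IsProbabilityMeasure μ
  start : ∀ᵐ ω ∂μ, ω.1 0 = i
  markov : ∀ (s r : ℝ≥0), s ≤ r → ∀ j : Fin 2,
    μ[{ω : SwitchPath | ω.1 r = j}.indicator (fun _ => (1 : ℝ)) | history s] =ᵐ[μ]
      μ[{ω : SwitchPath | ω.1 r = j}.indicator (fun _ => (1 : ℝ)) |
        MeasurableSpace.comap (fun ω : SwitchPath => ω.1 s) inferInstance]
  jumpRate : ∃ o : ℝ → ℝ, o =o[𝓝[>] 0] (fun h : ℝ => h) ∧
    ∀ (s h : ℝ≥0) (k j : Fin 2), j ≠ k → μ {ω | ω.1 s = k} ≠ 0 →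
      |(ProbabilityTheory.cond μ {ω | ω.1 s = k}).real {ω | ω.1 (s + h) = j} - rate k * h| ≤ o h

/-! ### The value functions of the finite-horizon problem -/

/-- An admissible trajectory on `[0, t]` starting at `x`: a random absolutely continuous curve
`s ↦ η ω s` that is non-anticipating, i.e. `η(s)` depends only on the history of the chain up to
time `s`. Values of `η ω` outside `[0, t]` are irrelevant. -/
structure IsTrajectory {n : ℕ} (x : Space n) (t : ℝ) (η : SwitchPath → ℝ → Space n) : Prop where
  start : ∀ ω, η ω 0 = x
  absolutelyContinuous : ∀ ω, AbsolutelyContinuousOnInterval (η ω) 0 t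
  nonanticipating : ∀ s : ℝ≥0, (s : ℝ) ≤ t → Measurable[history s] (fun ω => η ω s)

/-- The running cost `L_{ν(s)}(η(s)/ε, -η'(s))` along the path `ω`. -/
def runningCost {n : ℕ} (H : Fin 2 → Space n → Space n → ℝ) (ε : ℝ)
    (η : SwitchPath → ℝ → Space n) (ω : SwitchPath) (s : ℝ) : EReal :=
  lagrangian (H (ω.1 s.toNNReal)) (ε⁻¹ • η ω s) (-deriv (η ω) s)

/-- The value function
`u_i(x, t) = inf_η 𝔼_i [∫₀ᵗ L_{ν(s)}(η(s)/ε, -η'(s)) ds + f_{ν(t)}(η(t))]`, where `μ` is the law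
of the chain started at `i`. -/
def value {n : ℕ} (H : Fin 2 → Space n → Space n → ℝ) (f : Fin 2 → Space n → ℝ) (ε : ℝ)
    (μ : Measure SwitchPath) (x : Space n) (t : ℝ) : EReal :=
  ⨅ (η : SwitchPath → ℝ → Space n) (_ : IsTrajectory x t η),
    extIntegral μ (fun ω =>
      extIntegral (volume.restrict (Ioc 0 t)) (runningCost H ε η ω)
        + ((f (ω.1 t.toNNReal) (η ω t) : ℝ) : EReal))

/-- `(u_1, u_2)` is a viscosity solution on `ℝⁿ × [0, T]` of the Cauchy problem
`(u_i)_t + H_i(x/ε, Du_i) + (c_i/ε)(u_i - u_j) = 0` in `ℝⁿ × (0, T)`, `u_i(·, 0) = f_i`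
(`{i, j} = {1, 2}`). Test functions are `C¹` near the point of contact. -/
structure IsCauchySolution {n : ℕ} (H : Fin 2 → Space n → Space n → ℝ) (c : Fin 2 → ℝ) (ε T : ℝ)
    (f : Fin 2 → Space n → ℝ) (u : Fin 2 → Space n → ℝ → ℝ) : Prop where
  continuousOn : ∀ i, ContinuousOn (fun z : Space n × ℝ => u i z.1 z.2) (univ ×ˢ Icc 0 T)
  initial : ∀ i x, u i x 0 = f i x
  subsolution : ∀ i j, j ≠ i → ∀ (φ : Space n × ℝ → ℝ) (x : Space n) (t : ℝ), t ∈ Ioo 0 T →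
    ContDiffAt ℝ 1 φ (x, t) → IsLocalMax (fun z => u i z.1 z.2 - φ z) (x, t) →
    deriv (fun s => φ (x, s)) t + H i (ε⁻¹ • x) (gradient (fun y => φ (y, t)) x)
      + c i / ε * (u i x t - u j x t) ≤ 0
  supersolution : ∀ i j, j ≠ i → ∀ (φ : Space n × ℝ → ℝ) (x : Space n) (t : ℝ), t ∈ Ioo 0 T →
    ContDiffAt ℝ 1 φ (x, t) → IsLocalMin (fun z => u i z.1 z.2 - φ z) (x, t) →
    0 ≤ deriv (fun s => φ (x, s)) t + H i (ε⁻¹ • x) (gradient (fun y => φ (y, t)) x)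
      + c i / ε * (u i x t - u j x t)

/-! ### The value functions of the exit-time problem -/

/-- An admissible pair of the exit-time problem in `Ω` starting at `x`: a random, locally
absolutely continuous, non-anticipating curve `η : [0, ∞) → closure Ω`, and a stopping time
`τ ∈ [0, ∞]` of the chain with `η(τ) ∈ ∂Ω` where `τ < ∞`. -/
structure IsExitPair {n : ℕ} (Ω : Set (Space n)) (x : Space n) (η : SwitchPath → ℝ → Space n)
    (τ : SwitchPath → WithTop ℝ≥0) : Prop where
  start : ∀ ω, η ω 0 = x
  absolutelyContinuous : ∀ ω (t : ℝ), 0 ≤ t → AbsolutelyContinuousOnInterval (η ω) 0 t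
  mem_closure : ∀ ω (s : ℝ), 0 ≤ s → η ω s ∈ closure Ω
  nonanticipating : ∀ s : ℝ≥0, Measurable[history s] (fun ω => η ω s)
  stoppingTime : IsStoppingTime history τ
  exit_mem : ∀ ω (r : ℝ≥0), τ ω = r → η ω r ∈ frontier Ω

/-- The exit cost `e^{-τ} g_{ν(τ)}(η(τ))`, which is `0` where `τ = ∞`. -/
def exitCost {n : ℕ} (g : Fin 2 → Space n → ℝ) (η : SwitchPath → ℝ → Space n)
    (τ : SwitchPath → WithTop ℝ≥0) (ω : SwitchPath) : ℝ :=
  match τ ω with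
  | ⊤ => 0
  | (r : ℝ≥0) => Real.exp (-(r : ℝ)) * g (ω.1 r) (η ω r)

/-- The value function
`u_i(x) = inf_{η, τ} 𝔼_i [∫₀^τ e^{-s} L_{ν(s)}(η(s)/ε, -η'(s)) ds + e^{-τ} g_{ν(τ)}(η(τ))]`,
where `μ` is the law of the chain started at `i`. -/
def exitValue {n : ℕ} (H : Fin 2 → Space n → Space n → ℝ) (Ω : Set (Space n))
    (g : Fin 2 → Space n → ℝ) (ε : ℝ) (μ : Measure SwitchPath) (x : Space n) : EReal :=
  ⨅ (η : SwitchPath → ℝ → Space n) (τ : SwitchPath → WithTop ℝ≥0) (_ : IsExitPair Ω x η τ),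
    extIntegral μ (fun ω =>
      extIntegral (volume.restrict {s : ℝ | 0 < s ∧ ((s.toNNReal : ℝ≥0) : WithTop ℝ≥0) ≤ τ ω})
          (fun s => ((Real.exp (-s) : ℝ) : EReal) * runningCost H ε η ω s)
        + ((exitCost g η τ ω : ℝ) : EReal))

/-- `(u_1, u_2)` is a viscosity solution of the Dirichlet problem
`u_i + H_i(x/ε, Du_i) + (c_i/ε)(u_i - u_j) = 0` in `Ω`, `u_i = g_i` on `∂Ω`
(`{i, j} = {1, 2}`), the boundary condition being understood in the viscosity sense. Contact is
relative to `closure Ω`; test functions are `C¹` in a neighbourhood of the point of contact. -/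
structure IsDirichletSolution {n : ℕ} (H : Fin 2 → Space n → Space n → ℝ) (c : Fin 2 → ℝ) (ε : ℝ)
    (Ω : Set (Space n)) (g : Fin 2 → Space n → ℝ) (u : Fin 2 → Space n → ℝ) : Prop where
  continuousOn : ∀ i, ContinuousOn (u i) (closure Ω)
  subsolution : ∀ i j, j ≠ i → ∀ (φ : Space n → ℝ) (x : Space n), x ∈ closure Ω →
    ContDiffAt ℝ 1 φ x → IsLocalMaxOn (fun y => u i y - φ y) (closure Ω) x →
    u i x + H i (ε⁻¹ • x) (gradient φ x) + c i / ε * (u i x - u j x) ≤ 0 ∨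
      (x ∈ frontier Ω ∧ u i x ≤ g i x)
  supersolution : ∀ i j, j ≠ i → ∀ (φ : Space n → ℝ) (x : Space n), x ∈ closure Ω →
    ContDiffAt ℝ 1 φ x → IsLocalMinOn (fun y => u i y - φ y) (closure Ω) x →
    0 ≤ u i x + H i (ε⁻¹ • x) (gradient φ x) + c i / ε * (u i x - u j x) ∨
      (x ∈ frontier Ω ∧ g i x ≤ u i x)

end SwitchingControl

end

noncomputable section

namespace SwitchingControl

/-! ### Càdlàg paths: shifting, concatenation, and what the history sees. -/

section
/-! ### Càdlàg paths with two states -/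

/-! Both problems are instances of one control problem, `valueFun`, with discount rate 0 or 1, state
constraint `K`, exit set `Γ` and horizon `b`. Adding a constant `C₀` to the Lagrangians makes the
running cost nonnegative and changes the value by a known amount. The viscosity inequalities express
what happens in a short time `h`: the chain stays in `i` with probability `1 - q i * h + o(h)`,
switches once with probability `q i * h + o(h)`, and leaves and returns with probability `O(h²)`. To
first order in `h`, staying produces the Hamiltonian and discount terms, one switch produces the
coupling term, and the rest is negligible (`eventually_gain`).

On the probabilistic side, the infinitesimal rates determine the transition probabilities, by
Gronwall's inequality for the forward equation (`IsSwitchingLaw.real_leave`). Hence the future after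
time `h`, given the past, is a fresh chain started at the present state
(`IsSwitchingLaw.lintegral_concat`).

Supersolution (`IsLocalValue.super`): condition an `h²`-optimal control on the history up to `h`. A
non-anticipating curve is the same for all paths that have not yet left `i`; if it went far from `x`
or stopped, coercivity or the exit cost would make it too expensive. Near `x`, integrating `L ≥ p ·
v - H` along the curve gives the required bound. After one switch, the remaining cost is nearly at
least the value, or the exit cost, of the other state at `x`.

Subsolution (`IsLocalValue.sub`): choose `v` nearly attaining `H = L*` and move with velocity `-v`.
If the chain switches before `h`, return slowly to `x`, which is reached by a deterministic time `S`
of order `h`. A nearly optimal continuation is then needed in three situations only, each with known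
state and position, so no measurable selection of controls is required. The detour costs `O(h)` on
an event of probability `O(h)`. Slowness matters because `L` may be infinite at large speeds;
convexity and coercivity give `H` linear growth, so `L` is bounded at small speeds. -/

theorem SwitchPath.eventually_eq_right (ω : SwitchPath) (s : ℝ≥0) :
    ∀ᶠ r in 𝓝[≥] s, ω.1 r = ω.1 s :=
  (ω.2.1 s).eventually ((isOpen_discrete {ω.1 s}).mem_nhds rfl)

theorem SwitchPath.exists_eq_right (ω : SwitchPath) (s : ℝ≥0) :
    ∃ δ > 0, ∀ r, s ≤ r → r < s + δ → ω.1 r = ω.1 s := by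
  obtain ⟨u, hu, h⟩ := (mem_nhdsGE_iff_exists_Ico_subset' (a := s) (u' := s + 1) (by simp)).1
    (ω.eventually_eq_right s)
  have hu' : s < u := hu
  exact ⟨u - s, tsub_pos_of_lt hu', fun r h1 h2 => h ⟨h1, by rwa [add_tsub_cancel_of_le hu'.le] at h2⟩⟩

theorem cadlag_of_eventually {f : ℝ≥0 → Fin 2} (h1 : ∀ s, ∀ᶠ r in 𝓝[≥] s, f r = f s)
    (h2 : ∀ s, 0 < s → ∃ l, ∀ᶠ r in 𝓝[<] s, f r = l) :
    (∀ s, ContinuousWithinAt f (Ici s) s) ∧ ∀ s, 0 < s → ∃ l, Tendsto f (𝓝[<] s) (𝓝 l) := by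
  refine ⟨fun s => ?_, fun s hs => ?_⟩
  · rw [ContinuousWithinAt, nhds_discrete, tendsto_pure]; exact h1 s
  · obtain ⟨l, hl⟩ := h2 s hs
    exact ⟨l, by rw [nhds_discrete, tendsto_pure]; exact hl⟩

theorem SwitchPath.eventually_eq_left (ω : SwitchPath) (s : ℝ≥0) (hs : 0 < s) :
    ∃ l, ∀ᶠ r in 𝓝[<] s, ω.1 r = l := by
  obtain ⟨l, hl⟩ := ω.2.2 s hs
  exact ⟨l, hl.eventually ((isOpen_discrete {l}).mem_nhds rfl)⟩

/-- The path that never leaves the state `i`. -/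
def constPath (i : Fin 2) : SwitchPath :=
  ⟨fun _ => i, cadlag_of_eventually (fun _ => by simp) (fun _ _ => ⟨i, by simp⟩)⟩

theorem tendsto_const_add_nhdsGE (h s : ℝ≥0) : Tendsto (fun r => h + r) (𝓝[≥] s) (𝓝[≥] (h + s)) :=
  tendsto_nhdsWithin_iff.2 ⟨(continuous_const.add continuous_id).continuousAt.tendsto.mono_left nhdsWithin_le_nhds,
    eventually_nhdsWithin_of_forall fun _ hr => add_le_add_right hr h⟩

theorem tendsto_const_add_nhdsLT (h s : ℝ≥0) : Tendsto (fun r => h + r) (𝓝[<] s) (𝓝[<] (h + s)) :=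
  tendsto_nhdsWithin_iff.2 ⟨(continuous_const.add continuous_id).continuousAt.tendsto.mono_left nhdsWithin_le_nhds,
    eventually_nhdsWithin_of_forall fun _ hr => add_lt_add_right hr h⟩

theorem tendsto_sub_const_nhdsGE (h s : ℝ≥0) :
    Tendsto (fun r => r - h) (𝓝[≥] s) (𝓝[≥] (s - h)) :=
  tendsto_nhdsWithin_iff.2 ⟨(continuous_id.sub continuous_const).continuousAt.tendsto.mono_left nhdsWithin_le_nhds,
    eventually_nhdsWithin_of_forall fun _ hr => tsub_le_tsub_right hr h⟩

theorem tendsto_sub_const_nhdsLT {h s : ℝ≥0} (hs : h < s) :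
    Tendsto (fun r => r - h) (𝓝[<] s) (𝓝[<] (s - h)) :=
  tendsto_nhdsWithin_iff.2 ⟨(continuous_id.sub continuous_const).continuousAt.tendsto.mono_left nhdsWithin_le_nhds,
    eventually_nhdsWithin_of_forall fun r (hr : r < s) => by
      show r - h < s - h
      rcases le_total h r with h1 | h1
      · exact tsub_lt_tsub_right_of_le h1 hr
      · rw [tsub_eq_zero_of_le h1]; exact tsub_pos_of_lt hs⟩

/-- The path seen from time `h` on. -/
def shift (h : ℝ≥0) (ω : SwitchPath) : SwitchPath :=
  ⟨fun r => ω.1 (h + r), cadlag_of_eventually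
    (fun s => (tendsto_const_add_nhdsGE h s).eventually (ω.eventually_eq_right _))
    (fun s hs => (ω.eventually_eq_left (h + s) (by positivity)).imp fun _ hl =>
      (tendsto_const_add_nhdsLT h s).eventually hl)⟩

@[simp] theorem shift_apply (h r : ℝ≥0) (ω : SwitchPath) : (shift h ω).1 r = ω.1 (h + r) := rfl

/-- `ω₀` up to time `h`, continued by a path `ω₁` that starts at `ω₀ h`. -/
def glue (h : ℝ≥0) (ω₀ ω₁ : SwitchPath) (h01 : ω₁.1 0 = ω₀.1 h) : SwitchPath :=
  ⟨fun r => if r ≤ h then ω₀.1 r else ω₁.1 (r - h), cadlag_of_eventually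
    (fun s => by
      rcases lt_or_ge s h with hs | hs
      · filter_upwards [ω₀.eventually_eq_right s, mem_nhdsWithin_of_mem_nhds (Iio_mem_nhds hs)]
          with r hr hr'
        rw [if_pos (le_of_lt hr'), if_pos hs.le, hr]
      · have key : ∀ r, s ≤ r →
            (if r ≤ h then ω₀.1 r else ω₁.1 (r - h)) = ω₁.1 (r - h) := by
          intro r hr
          split_ifs with h1
          · obtain rfl : r = h := le_antisymm h1 (hs.trans hr)
            rw [tsub_self, h01]
          · rfl
        filter_upwards [(tendsto_sub_const_nhdsGE h s).eventually (ω₁.eventually_eq_right _),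
          self_mem_nhdsWithin] with r hr hr'
        rw [key r hr', key s le_rfl, hr])
    (fun s hs => by
      rcases le_or_gt s h with hsh | hsh
      · obtain ⟨l, hl⟩ := ω₀.eventually_eq_left s hs
        refine ⟨l, ?_⟩
        filter_upwards [hl, self_mem_nhdsWithin] with r hr (hr' : r < s)
        rw [if_pos (hr'.le.trans hsh), hr]
      · obtain ⟨l, hl⟩ := ω₁.eventually_eq_left (s - h) (tsub_pos_of_lt hsh)
        refine ⟨l, ?_⟩
        filter_upwards [(tendsto_sub_const_nhdsLT hsh).eventually hl,
          mem_nhdsWithin_of_mem_nhds (Ioi_mem_nhds hsh)] with r hr hr'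
        rw [if_neg (not_le.2 hr'), hr])⟩

/-- `ω₀` up to time `h`, continued by `ω₁` if that path starts at `ω₀ h`, and by a constant
otherwise. -/
def concat (h : ℝ≥0) (ω₀ ω₁ : SwitchPath) : SwitchPath :=
  if h01 : ω₁.1 0 = ω₀.1 h then glue h ω₀ ω₁ h01 else glue h ω₀ (constPath (ω₀.1 h)) rfl

theorem concat_apply (h : ℝ≥0) (ω₀ ω₁ : SwitchPath) (r : ℝ≥0) :
    (concat h ω₀ ω₁).1 r =
      if r ≤ h then ω₀.1 r else if ω₁.1 0 = ω₀.1 h then ω₁.1 (r - h) else ω₀.1 h := by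
  unfold concat
  split_ifs with h1 h2 h2 <;> simp [glue, h2, constPath]

theorem concat_of_le {h : ℝ≥0} (ω₀ ω₁ : SwitchPath) {r : ℝ≥0} (hr : r ≤ h) :
    (concat h ω₀ ω₁).1 r = ω₀.1 r := by rw [concat_apply, if_pos hr]

theorem concat_add {h : ℝ≥0} {ω₀ ω₁ : SwitchPath} (h01 : ω₁.1 0 = ω₀.1 h) (r : ℝ≥0) :
    (concat h ω₀ ω₁).1 (h + r) = ω₁.1 r := by
  rw [concat_apply, if_pos h01, add_tsub_cancel_left]
  split_ifs with h1
  · obtain rfl : r = 0 := by simpa using h1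
    rw [h01, add_zero]
  · rfl

theorem shift_concat {h : ℝ≥0} {ω₀ ω₁ : SwitchPath} (h01 : ω₁.1 0 = ω₀.1 h) :
    shift h (concat h ω₀ ω₁) = ω₁ :=
  Subtype.ext (funext fun r => concat_add h01 r)

/-! ### Histories -/

theorem history_eq_comap (s : ℝ≥0) :
    history s = MeasurableSpace.comap (fun (ω : SwitchPath) (r : Iic s) => ω.1 r) inferInstance :=
  Filtration.natural_eq_comap (fun s (ω : SwitchPath) => ω.1 s) stronglyMeasurable_coord s

theorem history_le (s : ℝ≥0) : history s ≤ (inferInstance : MeasurableSpace SwitchPath) :=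
  history.le s

theorem measurable_coord (r : ℝ≥0) : Measurable (fun ω : SwitchPath => ω.1 r) :=
  (stronglyMeasurable_coord r).measurable

theorem measurable_coord_history {r s : ℝ≥0} (h : r ≤ s) :
    Measurable[history s] (fun ω : SwitchPath => ω.1 r) := by
  rw [history_eq_comap]
  exact (measurable_pi_apply (X := fun _ : Iic s => Fin 2) ⟨r, h⟩).comp (comap_measurable _)

theorem measurable_history {α : Type*} {m : MeasurableSpace α} {Φ : α → SwitchPath} {s : ℝ≥0}
    (h : ∀ r ≤ s, Measurable (fun a => (Φ a).1 r)) : Measurable[m, history s] Φ := by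
  rw [history_eq_comap]
  exact measurable_comap_iff.2 (measurable_pi_iff.2 fun r => h r r.2)

theorem measurable_switchPath {α : Type*} {m : MeasurableSpace α} {Φ : α → SwitchPath}
    (h : ∀ r, Measurable (fun a => (Φ a).1 r)) : Measurable Φ :=
  (measurable_pi_iff.2 h).subtype_mk

theorem measurableSet_coord_eq_history {r s : ℝ≥0} (h : r ≤ s) (k : Fin 2) :
    MeasurableSet[history s] {ω : SwitchPath | ω.1 r = k} :=
  measurable_coord_history h (measurableSet_singleton k)

theorem measurableSet_coord_eq (r : ℝ≥0) (k : Fin 2) :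
    MeasurableSet {ω : SwitchPath | ω.1 r = k} :=
  measurable_coord r (measurableSet_singleton k)

/-- An event of the history is a preimage under restriction to `[0, s]`, so this holds for every
pair of paths, not only almost surely. It turns non-anticipation into a deterministic statement. -/
theorem mem_iff_of_agree {s : ℝ≥0} {A : Set SwitchPath} (hA : MeasurableSet[history s] A)
    {ω ω' : SwitchPath} (h : ∀ r ≤ s, ω.1 r = ω'.1 r) : ω ∈ A ↔ ω' ∈ A := by
  rw [history_eq_comap] at hA
  obtain ⟨B, -, rfl⟩ := hA
  have : (fun r : Iic s => ω.1 r) = fun r : Iic s => ω'.1 r := funext fun r => h r r.2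
  simp only [mem_preimage, this]

theorem eq_of_agree {E : Type*} [MeasurableSpace E] [MeasurableSingletonClass E] {s : ℝ≥0}
    {f : SwitchPath → E} (hf : Measurable[history s] f) {ω ω' : SwitchPath}
    (h : ∀ r ≤ s, ω.1 r = ω'.1 r) : f ω = f ω' :=
  ((mem_iff_of_agree (hf (measurableSet_singleton (f ω'))) h).2 rfl : f ω = f ω')

theorem measurable_shift_history (h s : ℝ≥0) :
    Measurable[history (h + s), history s] (shift h) :=
  measurable_history fun _ hr => measurable_coord_history (add_le_add_right hr h)

theorem measurable_shift (h : ℝ≥0) : Measurable (shift h) :=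
  measurable_switchPath fun r => measurable_coord (h + r)

/-- With the past frozen, a coordinate of the concatenation is either constant or read off the new
path after subtracting `h`. This makes the remainder of a non-anticipating control non-anticipating.
-/
theorem measurable_concat_right_history (h : ℝ≥0) (ω₀ : SwitchPath) (s : ℝ≥0) :
    Measurable[history s, history (h + s)] (concat h ω₀) := by
  refine measurable_history fun r hr => ?_
  simp only [concat_apply]
  split_ifs with h1
  · exact measurable_const
  · exact Measurable.ite (measurableSet_coord_eq_history zero_le _)
      (measurable_coord_history (tsub_le_iff_left.2 hr)) measurable_const

theorem measurable_concat (h : ℝ≥0) :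
    Measurable (fun z : SwitchPath × SwitchPath => concat h z.1 z.2) := by
  refine measurable_switchPath fun r => ?_
  simp only [concat_apply]
  have h0 : Measurable (fun z : SwitchPath × SwitchPath => z.2.1 0) :=
    (measurable_coord 0).comp measurable_snd
  have h1 : Measurable (fun z : SwitchPath × SwitchPath => z.1.1 h) :=
    (measurable_coord h).comp measurable_fst
  split_ifs
  · exact (measurable_coord r).comp measurable_fst
  · exact Measurable.ite (measurableSet_eq_fun h0 h1) ((measurable_coord (r - h)).comp measurable_snd) h1

theorem measurable_concat_right (h : ℝ≥0) (ω₀ : SwitchPath) : Measurable (concat h ω₀) :=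
  (measurable_concat h).comp measurable_prodMk_left

/-- The path as a function of time and chance is jointly measurable. -/
theorem measurable_coord_uncurry :
    Measurable (fun z : SwitchPath × ℝ≥0 => z.1.1 z.2) := by
  -- Time is rounded to a grid point strictly to its right, so right continuity makes the
  -- approximations eventually constant.
  have key : ∀ n : ℕ, Measurable (fun z : SwitchPath × ℝ≥0 =>
      z.1.1 ((⌊z.2 * (n + 1)⌋₊ + 1 : ℕ) / (n + 1))) := by
    intro n
    have h1 : Measurable (fun z : SwitchPath × ℕ => z.1.1 ((z.2 + 1 : ℕ) / ((n : ℝ≥0) + 1))) :=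
      measurable_from_prod_countable_left fun m =>
        measurable_coord ((m + 1 : ℕ) / ((n : ℝ≥0) + 1))
    have h2 : Measurable (fun z : SwitchPath × ℝ≥0 => ⌊z.2 * ((n : ℝ≥0) + 1)⌋₊) :=
      Nat.measurable_floor.comp (measurable_snd.mul_const _)
    exact h1.comp (measurable_fst.prodMk h2)
  refine measurable_of_tendsto_metrizable key (tendsto_pi_nhds.2 fun z => ?_)
  obtain ⟨δ, hδ, h⟩ := z.1.exists_eq_right z.2
  have hev : ∀ᶠ n : ℕ in atTop, 1 / ((n : ℝ≥0) + 1) < δ :=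
    (tendsto_one_div_add_atTop_nhds_zero_nat (𝕜 := ℝ≥0)).eventually (gt_mem_nhds hδ)
  refine tendsto_const_nhds.congr' ?_
  filter_upwards [hev] with n hn
  have hp : (0 : ℝ≥0) < n + 1 := by positivity
  refine (h _ ?_ ?_).symm
  · rw [le_div_iff₀ hp]
    push_cast
    exact (Nat.lt_floor_add_one _).le
  · refine lt_of_le_of_lt ?_ (add_lt_add_right hn z.2)
    rw [div_le_iff₀ hp, add_mul, one_div, inv_mul_cancel₀ hp.ne']
    push_cast
    gcongr
    exact Nat.floor_le zero_le

end

/-! ### From infinitesimal rates to transition probabilities. -/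

section
/-! ### Transition probabilities -/

theorem fin_two_eq {a b c : Fin 2} (hb : b ≠ a) (hc : c ≠ a) : c = b := by
  revert a b c; decide

theorem coord_ne_iff {i j : Fin 2} (hji : j ≠ i) (ω : SwitchPath) (r : ℝ≥0) :
    ω.1 r ≠ i ↔ ω.1 r = j :=
  ⟨fun h => fin_two_eq hji h, fun h => h ▸ hji⟩

variable {q : Fin 2 → ℝ} {i : Fin 2} {μ : Measure SwitchPath}

/-- The σ-algebra generated by the state at time `s`. -/
abbrev coordSpace (s : ℝ≥0) : MeasurableSpace SwitchPath :=
  MeasurableSpace.comap (fun ω : SwitchPath => ω.1 s) inferInstance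

/-- The Markov property for events, multiplied out because the state `k` may have probability zero
at time `s`. -/
theorem IsSwitchingLaw.real_inter_mul (hμ : IsSwitchingLaw q i μ) {s r : ℝ≥0} (hsr : s ≤ r)
    {k : Fin 2} (j : Fin 2) {A : Set SwitchPath} (hA : MeasurableSet[history s] A)
    (hAk : ∀ ω ∈ A, ω.1 s = k) :
    μ.real (A ∩ {ω | ω.1 r = j}) * μ.real {ω | ω.1 s = k} =
      μ.real A * μ.real ({ω | ω.1 s = k} ∩ {ω | ω.1 r = j}) := by
  have := hμ.isProbabilityMeasure
  set f : SwitchPath → ℝ := {ω : SwitchPath | ω.1 r = j}.indicator (fun _ => (1 : ℝ)) with hf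
  have hmcle : coordSpace s ≤ (inferInstance : MeasurableSpace SwitchPath) :=
    (measurable_coord s).comap_le
  have hfi : Integrable f μ := (integrable_const (1 : ℝ)).indicator (measurableSet_coord_eq r j)
  set g : SwitchPath → ℝ := μ[f | coordSpace s] with hg
  -- A function measurable with respect to the state at time `s` is constant where that state is
  -- `k`; `constPath k` serves as a representative.
  have hgc : ∀ ω, ω.1 s = k → g ω = g (constPath k) := by
    intro ω hω
    have hgm : Measurable[coordSpace s] g := stronglyMeasurable_condExp.measurable
    obtain ⟨B, -, hB⟩ := hgm (measurableSet_singleton (g (constPath k)))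
    have h1 : constPath k ∈ g ⁻¹' {g (constPath k)} := rfl
    rw [← hB] at h1
    have h2 : ω ∈ g ⁻¹' {g (constPath k)} := by
      rw [← hB]
      simpa [hω, constPath] using h1
    exact h2
  have hA' : MeasurableSet A := history_le s A hA
  have hk : MeasurableSet {ω : SwitchPath | ω.1 s = k} := measurableSet_coord_eq s k
  have hset : ∀ B : Set SwitchPath, MeasurableSet B →
      ∫ ω in B, f ω ∂μ = μ.real (B ∩ {ω | ω.1 r = j}) := by
    intro B hB
    rw [hf, setIntegral_indicator (measurableSet_coord_eq r j)]
    simp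
  have hconst : ∀ B : Set SwitchPath, MeasurableSet B → (∀ ω ∈ B, ω.1 s = k) →
      ∫ ω in B, g ω ∂μ = μ.real B * g (constPath k) := by
    intro B hB hBk
    rw [setIntegral_congr_fun hB (fun ω hω => hgc ω (hBk ω hω))]
    simp
  have e1 : μ.real (A ∩ {ω | ω.1 r = j}) = μ.real A * g (constPath k) := by
    rw [← hset A hA', ← hconst A hA' hAk, ← setIntegral_condExp (history_le s) hfi hA]
    exact setIntegral_congr_ae hA' ((hμ.markov s r hsr j).mono fun ω h _ => h)
  have e2 : μ.real ({ω | ω.1 s = k} ∩ {ω | ω.1 r = j}) =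
      μ.real {ω | ω.1 s = k} * g (constPath k) := by
    rw [← hset _ hk, ← hconst _ hk fun _ h => h]
    exact (setIntegral_condExp hmcle hfi ⟨{k}, measurableSet_singleton k, rfl⟩).symm
  rw [e1, e2]; ring

/-- The Markov property lets the jump rate be conditioned on any past event inside `{ν(s) = k}`. If
that state is null, so is `A`, and both sides vanish. -/
theorem IsSwitchingLaw.exists_rate (hμ : IsSwitchingLaw q i μ) :
    ∃ o : ℝ → ℝ, o =o[𝓝[>] 0] (fun h : ℝ => h) ∧
      ∀ (s h : ℝ≥0) (k j : Fin 2), j ≠ k → ∀ A : Set SwitchPath, MeasurableSet[history s] A →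
        (∀ ω ∈ A, ω.1 s = k) →
        |μ.real (A ∩ {ω | ω.1 (s + h) = j}) - μ.real A * (q k * h)| ≤ μ.real A * o h := by
  have := hμ.isProbabilityMeasure
  obtain ⟨o, ho, hr⟩ := hμ.jumpRate
  refine ⟨o, ho, fun s h k j hjk A hA hAk => ?_⟩
  have key := hμ.real_inter_mul (le_self_add : s ≤ s + h) j hA hAk
  by_cases h0 : μ {ω | ω.1 s = k} = 0
  · have hA0 : μ A = 0 := measure_mono_null hAk h0
    have hA1 : μ (A ∩ {ω | ω.1 (s + h) = j}) = 0 := measure_mono_null inter_subset_left hA0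
    simp [measureReal_def, hA0, hA1]
  · have hpos : 0 < μ.real {ω | ω.1 s = k} :=
      ENNReal.toReal_pos h0 (measure_ne_top _ _)
    have hc := hr s h k j hjk h0
    have hcond : (ProbabilityTheory.cond μ {ω | ω.1 s = k}).real {ω | ω.1 (s + h) = j} =
        (μ.real {ω | ω.1 s = k})⁻¹ * μ.real ({ω | ω.1 s = k} ∩ {ω | ω.1 (s + h) = j}) := by
      rw [measureReal_def, ProbabilityTheory.cond_apply (measurableSet_coord_eq s k)]
      simp [measureReal_def]
    have e : μ.real (A ∩ {ω | ω.1 (s + h) = j}) = μ.real A *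
        (ProbabilityTheory.cond μ {ω | ω.1 s = k}).real {ω | ω.1 (s + h) = j} := by
      rw [hcond]
      field_simp
      linarith
    rw [e, ← mul_sub, abs_mul, abs_of_nonneg measureReal_nonneg]
    exact mul_le_mul_of_nonneg_left hc measureReal_nonneg

/-- The probability that the chain with rates `q`, in the state `k`, is in the other state after
time `d`. -/
def leaveProb (q : Fin 2 → ℝ) (k : Fin 2) (d : ℝ) : ℝ :=
  q k / (q 0 + q 1) * (1 - Real.exp (-((q 0 + q 1) * d)))

theorem leaveProb_zero (q : Fin 2 → ℝ) (k : Fin 2) : leaveProb q k 0 = 0 := by simp [leaveProb]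

theorem add_eq_add_of_ne (q : Fin 2 → ℝ) {j k : Fin 2} (hjk : j ≠ k) :
    q 0 + q 1 = q k + q j := by
  fin_cases j <;> fin_cases k <;> first | exact absurd rfl hjk | simp [add_comm]

/-- This is Kolmogorov's forward equation for the two-state chain. -/
theorem hasDerivAt_leaveProb (hq : ∀ k, 0 < q k) {j k : Fin 2} (hjk : j ≠ k) (d : ℝ) :
    HasDerivAt (leaveProb q k) (q k * (1 - leaveProb q k d) - q j * leaveProb q k d) d := by
  have hs := add_eq_add_of_ne q hjk
  have hpos : 0 < q 0 + q 1 := add_pos (hq 0) (hq 1)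
  have h1 : HasDerivAt (fun d : ℝ => Real.exp (-((q 0 + q 1) * d)))
      (Real.exp (-((q 0 + q 1) * d)) * (-((q 0 + q 1) * 1))) d :=
    (((hasDerivAt_id d).const_mul (q 0 + q 1)).neg).exp
  have h2 := ((hasDerivAt_const d (1 : ℝ)).sub h1).const_mul (q k / (q 0 + q 1))
  refine h2.congr_deriv ?_
  have e : q k * (1 - leaveProb q k d) - q j * leaveProb q k d =
      q k - (q 0 + q 1) * leaveProb q k d := by rw [hs]; ring
  rw [e, leaveProb]
  field_simp
  ring

theorem leaveProb_nonneg (hq : ∀ k, 0 < q k) (k : Fin 2) {d : ℝ} (hd : 0 ≤ d) :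
    0 ≤ leaveProb q k d := by
  have hpos : 0 < q 0 + q 1 := add_pos (hq 0) (hq 1)
  refine mul_nonneg (div_nonneg (hq k).le hpos.le) ?_
  rw [sub_nonneg]
  exact Real.exp_le_one_iff.2 (by nlinarith)

theorem leaveProb_le (hq : ∀ k, 0 < q k) (k : Fin 2) (d : ℝ) : leaveProb q k d ≤ q k * d := by
  have hpos : 0 < q 0 + q 1 := add_pos (hq 0) (hq 1)
  have h1 := Real.add_one_le_exp (-((q 0 + q 1) * d))
  calc leaveProb q k d ≤ q k / (q 0 + q 1) * ((q 0 + q 1) * d) := by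
        refine mul_le_mul_of_nonneg_left ?_ (div_nonneg (hq k).le hpos.le); linarith
    _ = q k * d := by field_simp

/-- A function on `[0, ∞)` whose increments are `h * F + o(h)`, uniformly, with `F` bounded, is
continuous and has the right derivative `F`. -/
theorem right_deriv_of_increment {G F o : ℝ → ℝ} (ho : o =o[𝓝[>] 0] (fun h : ℝ => h)) {M : ℝ}
    (hF : ∀ d, 0 ≤ d → |F d| ≤ M)
    (hG : ∀ d h, 0 ≤ d → 0 ≤ h → |G (d + h) - G d - h * F d| ≤ o h) :
    ContinuousOn G (Ici 0) ∧ ∀ d, 0 ≤ d → HasDerivWithinAt G (F d) (Ici d) d := by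
  have hoε : ∀ ε > 0, ∃ δ > 0, ∀ h, 0 < h → h < δ → o h ≤ ε * h := by
    intro ε hε
    have := ho.def hε
    rw [eventually_nhdsWithin_iff, Metric.eventually_nhds_iff] at this
    obtain ⟨δ, hδ, H⟩ := this
    refine ⟨δ, hδ, fun h h0 h1 => ?_⟩
    have := H (y := h) (by rwa [Real.dist_eq, sub_zero, abs_of_pos h0]) h0
    rw [Real.norm_eq_abs, Real.norm_eq_abs, abs_of_pos h0] at this
    exact (le_abs_self _).trans this
  constructor
  · obtain ⟨δ, hδ, H⟩ := hoε 1 one_pos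
    have hM : 0 ≤ M := (abs_nonneg _).trans (hF 0 le_rfl)
    have lip : ∀ a b, 0 ≤ a → a ≤ b → b - a < δ → |G b - G a| ≤ (M + 1) * (b - a) := by
      intro a b ha hab hb
      rcases hab.eq_or_lt with rfl | hab
      · simp
      have h1 := hG a (b - a) ha (sub_nonneg.2 hab.le)
      have h2 := H (b - a) (sub_pos.2 hab) hb
      have h3 : |(b - a) * F a| ≤ (b - a) * M := by
        rw [abs_mul, abs_of_pos (sub_pos.2 hab)]
        exact mul_le_mul_of_nonneg_left (hF a ha) (sub_pos.2 hab).le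
      rw [add_sub_cancel] at h1
      calc |G b - G a| = |(G b - G a - (b - a) * F a) + (b - a) * F a| := by ring_nf
        _ ≤ _ := abs_add_le _ _
        _ ≤ (M + 1) * (b - a) := by nlinarith
    rw [Metric.continuousOn_iff]
    intro b hb ε hε
    refine ⟨min δ (ε / (M + 1)), by positivity, fun a ha hab => ?_⟩
    have hab1 := lt_of_lt_of_le hab (min_le_left _ _)
    have hab2 := lt_of_lt_of_le hab (min_le_right _ _)
    rw [lt_div_iff₀ (by positivity)] at hab2
    rw [Real.dist_eq] at *
    refine lt_of_le_of_lt ?_ hab2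
    rcases le_total a b with h | h
    · rw [abs_sub_comm a b, abs_of_nonneg (sub_nonneg.2 h)] at *
      rw [abs_sub_comm]
      exact (lip a b ha h hab1).trans_eq (mul_comm _ _)
    · rw [abs_of_nonneg (sub_nonneg.2 h)] at *
      exact (lip b a hb h hab1).trans_eq (mul_comm _ _)
  · intro d hd
    rw [hasDerivWithinAt_iff_isLittleO, isLittleO_iff]
    intro ε hε
    obtain ⟨δ, hδ, H⟩ := hoε ε hε
    rw [eventually_nhdsWithin_iff, Metric.eventually_nhds_iff]
    refine ⟨δ, hδ, fun y hy hdy => ?_⟩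
    have hdy' : d ≤ y := hdy
    rcases hdy'.eq_or_lt with rfl | hlt
    · simp
    have h1 := hG d (y - d) hd (sub_nonneg.2 hdy')
    rw [Real.dist_eq, abs_of_pos (sub_pos.2 hlt)] at hy
    have h2 := H (y - d) (sub_pos.2 hlt) hy
    rw [add_sub_cancel] at h1
    rw [Real.norm_eq_abs, Real.norm_eq_abs, abs_of_pos (sub_pos.2 hlt), smul_eq_mul]
    exact h1.trans h2

/-- As functions of the elapsed time, both sides vanish at 0 and satisfy the same linear forward
equation, the left one with a right derivative only. Gronwall's inequality identifies them. -/
theorem IsSwitchingLaw.real_leave (hμ : IsSwitchingLaw q i μ) (hq : ∀ k, 0 < q k) (s d : ℝ≥0)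
    {k j : Fin 2} (hjk : j ≠ k) {A : Set SwitchPath} (hA : MeasurableSet[history s] A)
    (hAk : ∀ ω ∈ A, ω.1 s = k) :
    μ.real (A ∩ {ω | ω.1 (s + d) = j}) = μ.real A * leaveProb q k d := by
  have := hμ.isProbabilityMeasure
  obtain ⟨o, ho, hr⟩ := hμ.exists_rate
  set m := μ.real A with hm
  set G : ℝ → ℝ := fun x => μ.real (A ∩ {ω | ω.1 (s + x.toNNReal) = j}) with hGdef
  have hm0 : 0 ≤ m := measureReal_nonneg
  have hm1 : m ≤ 1 := measureReal_le_one
  have hG0 : ∀ x, 0 ≤ G x := fun x => measureReal_nonneg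
  have hGm : ∀ x, G x ≤ m := fun x => measureReal_mono inter_subset_left
  have hqk := hq k
  have hqj := hq j
  -- The event is split by the state at time `s + x`; each half contributes the increment with its
  -- own rate, and the two errors add up to `m * o h`.
  have inc : ∀ x h : ℝ, 0 ≤ x → 0 ≤ h →
      |G (x + h) - G x - h * (q k * (m - G x) - q j * G x)| ≤ m * o h := by
    intro x h hx hh
    lift x to ℝ≥0 using hx
    lift h to ℝ≥0 using hh
    set B : Fin 2 → Set SwitchPath := fun a => A ∩ {ω | ω.1 (s + x) = a} with hB
    have hAx : MeasurableSet[history (s + x)] A := history.mono le_self_add A hA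
    have hBm : ∀ a, MeasurableSet[history (s + x)] (B a) := fun a =>
      hAx.inter (measurableSet_coord_eq_history le_rfl a)
    have hBk : ∀ a, ∀ ω ∈ B a, ω.1 (s + x) = a := fun a ω h => h.2
    have r1 := hr (s + x) h k j hjk (B k) (hBm k) (hBk k)
    have r2 := hr (s + x) h j k hjk.symm (B j) (hBm j) (hBk j)
    have split : ∀ E : Set SwitchPath, ∀ t : ℝ≥0,
        μ.real (E ∩ {ω | ω.1 t = k}) + μ.real (E ∩ {ω | ω.1 t = j}) = μ.real E := by
      intro E t
      have : E ∩ {ω | ω.1 t = k} = E \ {ω | ω.1 t = j} := by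
        ext ω; constructor
        · rintro ⟨h1, h2⟩; exact ⟨h1, fun h3 => hjk ((h3 : ω.1 t = j).symm.trans h2)⟩
        · rintro ⟨h1, h2⟩; exact ⟨h1, fin_two_eq hjk.symm h2⟩
      rw [this, add_comm]
      exact measureReal_inter_add_sdiff (measurableSet_coord_eq t j)
    have s1 : μ.real (B k) + μ.real (B j) = m := split A (s + x)
    have s2 := split (B j) (s + x + h)
    have s3 : μ.real (B k ∩ {ω | ω.1 (s + x + h) = j}) + μ.real (B j ∩ {ω | ω.1 (s + x + h) = j}) =
        G ((x : ℝ) + h) := by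
      have := split (A ∩ {ω | ω.1 (s + x + h) = j}) (s + x)
      simp only [hGdef, hB]
      rw [← NNReal.coe_add, Real.toNNReal_coe, ← add_assoc, ← this, inter_right_comm A,
        inter_right_comm A {ω | ω.1 (s + x) = j}]
    have s4 : G x = μ.real (B j) := by simp [hGdef, hB]
    rw [← s3, s4]
    have : m * o h = μ.real (B k) * o h + μ.real (B j) * o h := by rw [← s1]; ring
    rw [this]
    rw [abs_le] at r1 r2 ⊢
    have e : m - μ.real (B j) = μ.real (B k) := by linarith
    rw [e]
    constructor <;> nlinarith
  obtain ⟨hcont, hder⟩ := right_deriv_of_increment (G := G)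
    (F := fun x => q k * (m - G x) - q j * G x) (ho.const_mul_left m) (M := q k + q j)
    (fun x _ => by
      have h1 := hG0 x
      have h2 := hGm x
      rw [abs_le]; constructor <;> nlinarith) inc
  -- Zero initial difference and zero inhomogeneity force the difference to vanish.
  have hE := norm_le_gronwallBound_of_norm_deriv_right_le
    (f := fun x => G x - m * leaveProb q k x)
    (f' := fun x => (q k * (m - G x) - q j * G x) -
      m * (q k * (1 - leaveProb q k x) - q j * leaveProb q k x))
    (δ := 0) (K := q k + q j) (ε := 0) (a := 0) (b := d) ?_ ?_ ?_ ?_ d ⟨d.2, le_rfl⟩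
  · rw [gronwallBound_ε0_δ0, norm_le_zero_iff, sub_eq_zero] at hE
    simpa [hGdef] using hE
  · exact (hcont.mono Icc_subset_Ici_self).sub (continuousOn_const.mul
      fun x _ => (hasDerivAt_leaveProb hq hjk x).continuousAt.continuousWithinAt)
  · exact fun x hx => (hder x hx.1).sub
      ((hasDerivAt_leaveProb hq hjk x).hasDerivWithinAt.const_mul m)
  · have : A ∩ {ω | ω.1 s = j} = ∅ := by
      ext ω
      simp only [mem_inter_iff, mem_ofPred_eq, mem_empty_iff_false, iff_false, not_and]
      exact fun h1 h2 => hjk (h2.symm.trans (hAk ω h1))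
    simp [hGdef, leaveProb_zero, this]
  · intro x hx
    rw [add_zero, Real.norm_eq_abs, Real.norm_eq_abs]
    have : (q k * (m - G x) - q j * G x) -
        m * (q k * (1 - leaveProb q k x) - q j * leaveProb q k x) =
        -((q k + q j) * (G x - m * leaveProb q k x)) := by ring
    rw [this, abs_neg, abs_mul, abs_of_pos (add_pos hqk hqj)]

/-- The transition probabilities of the chain with rates `q`. -/
def transProb (q : Fin 2 → ℝ) (d : ℝ) (k j : Fin 2) : ℝ :=
  if j = k then 1 - leaveProb q k d else leaveProb q k d

theorem IsSwitchingLaw.real_trans (hμ : IsSwitchingLaw q i μ) (hq : ∀ k, 0 < q k) (s d : ℝ≥0)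
    {k : Fin 2} (j : Fin 2) {A : Set SwitchPath} (hA : MeasurableSet[history s] A)
    (hAk : ∀ ω ∈ A, ω.1 s = k) :
    μ.real (A ∩ {ω | ω.1 (s + d) = j}) = μ.real A * transProb q d k j := by
  have := hμ.isProbabilityMeasure
  unfold transProb
  split_ifs with h
  · subst h
    obtain ⟨l, hl⟩ : ∃ l : Fin 2, l ≠ j := exists_ne j
    have e := hμ.real_leave hq s d hl hA hAk
    have h1 : A ∩ {ω | ω.1 (s + d) = j} = A \ {ω | ω.1 (s + d) = l} := by
      ext ω
      refine and_congr_right fun _ => ?_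
      rw [mem_ofPred_eq, mem_ofPred_eq, ← coord_ne_iff hl, not_not]
    have h2 := measureReal_inter_add_sdiff (μ := μ) (s := A) (measurableSet_coord_eq (s + d) l)
    rw [h1, mul_sub, mul_one, ← e, ← h2]; ring
  · exact hμ.real_leave hq s d h hA hAk

end

/-! ### Independence of past and future given the present; probabilities of early jumps. -/

section
variable {q : Fin 2 → ℝ} {i : Fin 2} {μ : Measure SwitchPath}

/-! ### The Markov property on the path space -/

/-- The paths with prescribed values after successive waiting times, counted from time `s`. -/
def cylinder : ℝ≥0 → List (ℝ≥0 × Fin 2) → Set SwitchPath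
  | _, [] => univ
  | s, (d, a) :: l => {ω | ω.1 (s + d) = a} ∩ cylinder (s + d) l

/-- The probability of a cylinder for the chain started at a given state. -/
def cylinderProb (q : Fin 2 → ℝ) : Fin 2 → List (ℝ≥0 × Fin 2) → ℝ
  | _, [] => 1
  | k, (d, a) :: l => transProb q d k a * cylinderProb q a l

theorem preimage_shift_cylinder (h : ℝ≥0) (l : List (ℝ≥0 × Fin 2)) (s : ℝ≥0) :
    shift h ⁻¹' cylinder s l = cylinder (h + s) l := by
  induction l generalizing s with
  | nil => rfl
  | cons da l ih =>
    simp only [cylinder, preimage_inter, ih]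
    rw [add_assoc]
    rfl

/-- Each prescribed value is absorbed into the past event, which is why the induction runs over all
`A`, `s` and `k`. -/
theorem IsSwitchingLaw.real_inter_cylinder (hμ : IsSwitchingLaw q i μ) (hq : ∀ k, 0 < q k)
    (l : List (ℝ≥0 × Fin 2)) (s : ℝ≥0) (k : Fin 2) (A : Set SwitchPath)
    (hA : MeasurableSet[history s] A) (hAk : ∀ ω ∈ A, ω.1 s = k) :
    μ.real (A ∩ cylinder s l) = μ.real A * cylinderProb q k l := by
  induction l generalizing s k A with
  | nil => simp [cylinder, cylinderProb]
  | cons da l ih =>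
    obtain ⟨d, a⟩ := da
    simp only [cylinder, cylinderProb]
    rw [← inter_assoc, ih (s + d) a _ ((history.mono le_self_add A hA).inter
      (measurableSet_coord_eq_history le_rfl a)) (fun ω h => h.2), hμ.real_trans hq s d a hA hAk]
    ring

theorem exists_cylinder_eq (a : ℝ≥0 → Fin 2) (L : List ℝ≥0) (s : ℝ≥0)
    (hL : (s :: L).Pairwise (· ≤ ·)) :
    ∃ l, {ω : SwitchPath | ∀ t ∈ L, ω.1 t = a t} = cylinder s l := by
  induction L generalizing s with
  | nil => exact ⟨[], by simp [cylinder]⟩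
  | cons t L ih =>
    obtain ⟨l, hl⟩ := ih t hL.of_cons
    have hst : s ≤ t := (List.pairwise_cons.1 hL).1 t (by simp)
    refine ⟨(t - s, a t) :: l, ?_⟩
    simp only [cylinder, add_tsub_cancel_of_le hst, ← hl]
    ext ω
    simp

/-- Cylinders give the finite-dimensional distributions: sorted times become waiting times, and on
finitely many two-valued coordinates singletons determine a measure. Uniqueness of projective limits
does the rest. -/
theorem ext_of_cylinder {ν₁ ν₂ : Measure SwitchPath} [IsFiniteMeasure ν₁] [IsFiniteMeasure ν₂]
    (h : ∀ l, ν₁ (cylinder 0 l) = ν₂ (cylinder 0 l)) : ν₁ = ν₂ := by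
  have hm : Measurable (fun (ω : SwitchPath) (t : ℝ≥0) => ω.1 t) := measurable_subtype_coe
  have key : ν₁.map (fun (ω : SwitchPath) (t : ℝ≥0) => ω.1 t) =
      ν₂.map (fun (ω : SwitchPath) (t : ℝ≥0) => ω.1 t) := by
    have : ∀ I : Finset ℝ≥0, Measurable (fun (ω : SwitchPath) => I.restrict fun t => ω.1 t) :=
      fun I => measurable_pi_iff.2 fun t => measurable_coord t
    refine IsProjectiveLimit.unique (P := fun I : Finset ℝ≥0 =>
      ν₂.map (fun (ω : SwitchPath) => I.restrict fun t => ω.1 t)) (fun I => ?_)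
      (ProbabilityTheory.isProjectiveLimit_map hm.aemeasurable)
    rw [ProbabilityTheory.isProjectiveLimit_map (P := ν₁)
      (X := fun t (ω : SwitchPath) => ω.1 t) hm.aemeasurable I]
    refine Measure.ext_of_singleton fun a => ?_
    rw [Measure.map_apply (this I) (measurableSet_singleton _),
      Measure.map_apply (this I) (measurableSet_singleton _)]
    obtain ⟨l, hl⟩ := exists_cylinder_eq (fun t => if ht : t ∈ I then a ⟨t, ht⟩ else 0)
      (I.sort (· ≤ ·)) 0 (List.pairwise_cons.2 ⟨fun _ _ => zero_le, I.pairwise_sort (· ≤ ·)⟩)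
    have e : (fun (ω : SwitchPath) => I.restrict fun t => ω.1 t) ⁻¹' {a} = cylinder 0 l := by
      rw [← hl]
      ext ω
      simp only [mem_preimage, mem_singleton_iff, mem_ofPred_eq, Finset.mem_sort]
      constructor
      · rintro rfl t ht
        simp [ht]
      · intro H
        ext ⟨t, ht⟩
        have := H t ht
        simp only [ht, dif_pos] at this
        simp [this]
    rw [e, h]
  ext S hS
  obtain ⟨B, hB, rfl⟩ := hS
  have := congrArg (fun ν => ν B) key
  simpa [Measure.map_apply hm hB] using this

/-- Both sides give a cylinder the mass `cylinderProb` times `μ A`, since the transition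
probabilities depend on the rates alone. This is the Markov property at the fixed time `h`, as an
identity of laws on path space. -/
theorem IsSwitchingLaw.map_shift {k : Fin 2} {ν : Measure SwitchPath} (hμ : IsSwitchingLaw q i μ)
    (hν : IsSwitchingLaw q k ν) (hq : ∀ k, 0 < q k) (h : ℝ≥0) {A : Set SwitchPath}
    (hA : MeasurableSet[history h] A) (hAk : ∀ ω ∈ A, ω.1 h = k) :
    (μ.restrict A).map (shift h) = μ A • ν := by
  have := hμ.isProbabilityMeasure
  have := hν.isProbabilityMeasure
  have : IsFiniteMeasure (μ A • ν) := Measure.smul_finite _ (measure_ne_top _ _)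
  have hcyl : ∀ l s, MeasurableSet (cylinder s l) := by
    intro l
    induction l with
    | nil => exact fun _ => MeasurableSet.univ
    | cons da l ih => exact fun s => (measurableSet_coord_eq _ _).inter (ih _)
  refine ext_of_cylinder fun l => ?_
  rw [Measure.map_apply (measurable_shift h) (hcyl l 0),
    Measure.restrict_apply (measurable_shift h (hcyl l 0)), preimage_shift_cylinder, add_zero,
    inter_comm, Measure.smul_apply, smul_eq_mul]
  have e1 := hμ.real_inter_cylinder hq l h k A hA hAk
  have e2 := hν.real_inter_cylinder hq l 0 k {ω | ω.1 0 = k}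
    (measurableSet_coord_eq_history le_rfl k) (fun _ h => h)
  have h0 : ν.real {ω | ω.1 0 = k} = 1 := by
    rw [measureReal_congr (eventuallyEq_univ.2 hν.start), probReal_univ]
  have h1 : ν.real ({ω | ω.1 0 = k} ∩ cylinder 0 l) = ν.real (cylinder 0 l) := by
    refine measureReal_congr ?_
    filter_upwards [hν.start] with ω hω
    exact propext ⟨fun H => H.2, fun H => ⟨hω, H⟩⟩
  rw [h1, h0, one_mul] at e2
  rw [← e2] at e1
  rw [← ENNReal.toReal_eq_toReal_iff' (measure_ne_top _ _)
    (ENNReal.mul_ne_top (measure_ne_top _ _) (measure_ne_top _ _)), ENNReal.toReal_mul]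
  exact e1

theorem IsSwitchingLaw.measure_inter_shift {k : Fin 2} {ν : Measure SwitchPath}
    (hμ : IsSwitchingLaw q i μ) (hν : IsSwitchingLaw q k ν) (hq : ∀ k, 0 < q k) (h : ℝ≥0)
    {A B : Set SwitchPath} (hA : MeasurableSet[history h] A) (hAk : ∀ ω ∈ A, ω.1 h = k)
    (hB : MeasurableSet B) : μ (A ∩ shift h ⁻¹' B) = μ A * ν B := by
  have := congrArg (fun ρ => ρ B) (hμ.map_shift hν hq h hA hAk)
  simp only [Measure.map_apply (measurable_shift h) hB,
    Measure.restrict_apply (measurable_shift h hB), Measure.smul_apply, smul_eq_mul] at this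
  rw [inter_comm, this]

theorem IsSwitchingLaw.setLIntegral_shift {k : Fin 2} {ν : Measure SwitchPath}
    (hμ : IsSwitchingLaw q i μ) (hν : IsSwitchingLaw q k ν) (hq : ∀ k, 0 < q k) (h : ℝ≥0)
    {A : Set SwitchPath} (hA : MeasurableSet[history h] A) (hAk : ∀ ω ∈ A, ω.1 h = k)
    {F : SwitchPath → ℝ≥0∞} (hF : Measurable F) :
    ∫⁻ ω in A, F (shift h ω) ∂μ = μ A * ∫⁻ ω, F ω ∂ν := by
  rw [← lintegral_map hF (measurable_shift h), hμ.map_shift hν hq h hA hAk, lintegral_smul_measure,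
    smul_eq_mul]

theorem generateFrom_history_shift (h : ℝ≥0) :
    (inferInstance : MeasurableSpace SwitchPath) = MeasurableSpace.generateFrom
      {S | ∃ A B, MeasurableSet[history h] A ∧ MeasurableSet B ∧ S = A ∩ shift h ⁻¹' B} := by
  set C : Set (Set SwitchPath) :=
    {S | ∃ A B, MeasurableSet[history h] A ∧ MeasurableSet B ∧ S = A ∩ shift h ⁻¹' B} with hC
  refine le_antisymm ?_ (MeasurableSpace.generateFrom_le ?_)
  · have : @Measurable SwitchPath SwitchPath (MeasurableSpace.generateFrom C) inferInstance id := by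
      refine @measurable_switchPath _ (MeasurableSpace.generateFrom C) _ fun r => ?_
      refine @measurable_to_countable' _ _ _ _ (MeasurableSpace.generateFrom C) _ fun k => ?_
      apply MeasurableSpace.measurableSet_generateFrom
      rcases le_total r h with hr | hr
      · exact ⟨{ω | ω.1 r = k}, univ, measurableSet_coord_eq_history hr k, MeasurableSet.univ,
          by simp; rfl⟩
      · refine ⟨univ, {ω | ω.1 (r - h) = k}, MeasurableSet.univ, measurableSet_coord_eq _ k, ?_⟩
        rw [univ_inter]
        ext ω
        simp [add_tsub_cancel_of_le hr]
    intro S hS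
    exact this hS
  · rintro S ⟨A, B, hA, hB, rfl⟩
    exact (history_le h A hA).inter (measurable_shift h hB)

/-- Given the state at time `h`, past and future are independent. The sets `A ∩ shift h ⁻¹' B` form
a generating π-system on which this is `IsSwitchingLaw.measure_inter_shift`. -/
theorem IsSwitchingLaw.restrict_eq_map_concat {k : Fin 2} {ν : Measure SwitchPath}
    (hμ : IsSwitchingLaw q i μ) (hν : IsSwitchingLaw q k ν) (hq : ∀ k, 0 < q k) (h : ℝ≥0) :
    μ.restrict {ω | ω.1 h = k} =
      ((μ.restrict {ω | ω.1 h = k}).prod ν).map (fun z => concat h z.1 z.2) := by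
  have := hμ.isProbabilityMeasure
  have := hν.isProbabilityMeasure
  have : IsFiniteMeasure (((μ.restrict {ω | ω.1 h = k}).prod ν).map
    (fun z => concat h z.1 z.2)) := Measure.isFiniteMeasure_map _ _
  have hk : MeasurableSet {ω : SwitchPath | ω.1 h = k} := measurableSet_coord_eq h k
  refine ext_of_generate_finite _ (generateFrom_history_shift h) ?_ ?_ ?_
  · rintro _ ⟨A, B, hA, hB, rfl⟩ _ ⟨A', B', hA', hB', rfl⟩ -
    exact ⟨A ∩ A', B ∩ B', hA.inter hA', hB.inter hB', by
      rw [preimage_inter, inter_inter_inter_comm]⟩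
  · rintro _ ⟨A, B, hA, hB, rfl⟩
    have hAm := history_le h A hA
    have hS := hAm.inter (measurable_shift h hB)
    rw [Measure.restrict_apply hS, Measure.map_apply (measurable_concat h) hS]
    -- Almost surely the two pieces match at time `h`, so the fallback branch of `concat` plays no
    -- role.
    have e : (fun z : SwitchPath × SwitchPath => concat h z.1 z.2) ⁻¹' (A ∩ shift h ⁻¹' B)
        =ᵐ[(μ.restrict {ω | ω.1 h = k}).prod ν] A ×ˢ B := by
      have h1 : ∀ᵐ z ∂(μ.restrict {ω : SwitchPath | ω.1 h = k}).prod ν, z.1.1 h = k :=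
        Measure.quasiMeasurePreserving_fst.ae (ae_restrict_mem hk)
      have h2 : ∀ᵐ z ∂(μ.restrict {ω : SwitchPath | ω.1 h = k}).prod ν, z.2.1 0 = k :=
        Measure.quasiMeasurePreserving_snd.ae hν.start
      filter_upwards [h1, h2] with z hz1 hz2
      have e1 : concat h z.1 z.2 ∈ A ↔ z.1 ∈ A :=
        mem_iff_of_agree hA fun r hr => concat_of_le _ _ hr
      have e2 := shift_concat (hz2.trans hz1.symm)
      refine propext ?_
      show (concat h z.1 z.2 ∈ A ∧ shift h (concat h z.1 z.2) ∈ B) ↔ z.1 ∈ A ∧ z.2 ∈ B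
      rw [e1, e2]
    rw [measure_congr e, Measure.prod_prod, Measure.restrict_apply hAm, inter_right_comm]
    exact hμ.measure_inter_shift hν hq h (hA.inter (measurableSet_coord_eq_history le_rfl k))
      (fun ω hω => hω.2) hB
  · rw [Measure.map_apply (measurable_concat h) MeasurableSet.univ, preimage_univ,
      ← univ_prod_univ, Measure.prod_prod, measure_univ (μ := ν), mul_one]

theorem lintegral_eq_add_states (μ : Measure SwitchPath) (h : ℝ≥0) (F : SwitchPath → ℝ≥0∞) :
    ∫⁻ ω, F ω ∂μ = ∫⁻ ω in {ω | ω.1 h = 0}, F ω ∂μ + ∫⁻ ω in {ω | ω.1 h = 1}, F ω ∂μ := by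
  rw [← lintegral_add_compl F (measurableSet_coord_eq h 0)]
  congr 3
  ext ω
  exact coord_ne_iff (by decide) ω h

/-- Conditioning on the history up to time `h`. -/
theorem IsSwitchingLaw.lintegral_concat {P : Fin 2 → Measure SwitchPath}
    (hP : ∀ k, IsSwitchingLaw q k (P k)) (hμ : IsSwitchingLaw q i μ) (hq : ∀ k, 0 < q k) (h : ℝ≥0)
    {F : SwitchPath → ℝ≥0∞} (hF : Measurable F) :
    ∫⁻ ω, F ω ∂μ = ∫⁻ ω₀, ∫⁻ ω₁, F (concat h ω₀ ω₁) ∂(P (ω₀.1 h)) ∂μ := by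
  have := hμ.isProbabilityMeasure
  have := fun k => (hP k).isProbabilityMeasure
  have key : ∀ k, ∫⁻ ω in {ω | ω.1 h = k}, F ω ∂μ =
      ∫⁻ ω₀ in {ω | ω.1 h = k}, ∫⁻ ω₁, F (concat h ω₀ ω₁) ∂(P (ω₀.1 h)) ∂μ := by
    intro k
    conv_lhs => rw [hμ.restrict_eq_map_concat (hP k) hq h]
    rw [lintegral_map hF (measurable_concat h),
      lintegral_prod (fun z : SwitchPath × SwitchPath => F (concat h z.1 z.2))
        (hF.comp (measurable_concat h)).aemeasurable]
    refine setLIntegral_congr_fun (measurableSet_coord_eq h k) fun ω hω => ?_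
    have hω' : ω.1 h = k := hω
    simp only [hω']
  rw [lintegral_eq_add_states μ h, key 0, key 1, ← lintegral_eq_add_states]

/-! ### The first jumps -/

/-- The paths that do not leave the state `i` up to time `h`. -/
def stay (i : Fin 2) (h : ℝ≥0) : Set SwitchPath := {ω | ∀ r ≤ h, ω.1 r = i}

/-- The paths that are outside the state `i` and then in it, up to time `h`. -/
def comeBack (i : Fin 2) (h : ℝ≥0) : Set SwitchPath :=
  {ω | ∃ a b, a ≤ b ∧ b ≤ h ∧ ω.1 a ≠ i ∧ ω.1 b = i}

/-- Right continuity reduces the condition to a countable dense set of times. The last time `h` is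
listed separately, as nothing to its right belongs to the history. -/
theorem measurableSet_stay (i : Fin 2) (h : ℝ≥0) : MeasurableSet[history h] (stay i h) := by
  obtain ⟨D, hDc, hD⟩ := TopologicalSpace.exists_countable_dense ℝ≥0
  have : stay i h = {ω | ω.1 h = i} ∩ ⋂ r ∈ D ∩ Iic h, {ω | ω.1 r = i} := by
    ext ω
    constructor
    · exact fun H => ⟨H h le_rfl, mem_iInter₂.2 fun r hr => H r hr.2⟩
    · rintro ⟨H1, H2⟩ r hr
      rcases hr.eq_or_lt with rfl | hr
      · exact H1
      obtain ⟨δ, hδ, H⟩ := ω.exists_eq_right r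
      obtain ⟨t, htD, ht1, ht2⟩ := hD.exists_between (lt_min hr (lt_add_of_pos_right r hδ))
      rw [← H t ht1.le (ht2.trans_le (min_le_right _ _))]
      exact mem_iInter₂.1 H2 t ⟨htD, (ht2.trans_le (min_le_left _ _)).le⟩
  rw [this]
  exact (measurableSet_coord_eq_history le_rfl i).inter
    (MeasurableSet.biInter (hDc.mono inter_subset_left) fun r hr =>
      measurableSet_coord_eq_history hr.2 i)

/-- `S` lies in the increasing union of the sets `⋂ n ≥ m, B n`, and continuity from below holds for
arbitrary sets. Hence `S` need not be measurable, which matters for `comeBack`. -/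
theorem measure_le_of_eventually_mem {α : Type*} [MeasurableSpace α] {μ : Measure α} {S : Set α}
    {B : ℕ → Set α} {c : ℝ≥0∞} (h : ∀ a ∈ S, ∀ᶠ n in atTop, a ∈ B n) (hB : ∀ n, μ (B n) ≤ c) :
    μ S ≤ c := by
  have hsub : S ⊆ ⋃ m, ⋂ n ∈ Ici m, B n := by
    intro a ha
    obtain ⟨m, hm⟩ := eventually_atTop.1 (h a ha)
    exact mem_iUnion.2 ⟨m, mem_iInter₂.2 fun n hn => hm n hn⟩
  refine (measure_mono hsub).trans ?_
  rw [Monotone.measure_iUnion]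
  · exact iSup_le fun m => (measure_mono (biInter_subset_of_mem (mem_Ici.2 le_rfl))).trans (hB m)
  · exact fun m m' hmm => biInter_subset_biInter_left (Ici_subset_Ici.2 hmm)

theorem IsSwitchingLaw.measure_step_le (hμ : IsSwitchingLaw q i μ) (hq : ∀ k, 0 < q k) (s d : ℝ≥0)
    {k j : Fin 2} (hjk : j ≠ k) :
    μ ({ω | ω.1 s = k} ∩ {ω | ω.1 (s + d) = j}) ≤ ENNReal.ofReal (q k * d) := by
  have := hμ.isProbabilityMeasure
  have := hμ.real_leave hq s d hjk (measurableSet_coord_eq_history le_rfl k) (fun _ h => h)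
  rw [← ENNReal.ofReal_toReal (measure_ne_top μ _)]
  refine ENNReal.ofReal_le_ofReal ?_
  rw [← measureReal_def, this]
  calc _ ≤ 1 * leaveProb q k d :=
        mul_le_mul_of_nonneg_right measureReal_le_one (leaveProb_nonneg hq k d.2)
    _ ≤ _ := by rw [one_mul]; exact leaveProb_le hq k d

/-- A grid point at or shortly after a given time. -/
theorem exists_grid (h r δ : ℝ≥0) (hr : r ≤ h) (hδ : 0 < δ) :
    ∀ᶠ N : ℕ in atTop, ∃ l : ℕ, l ≤ N + 1 ∧ r ≤ l * (h / (N + 1)) ∧ l * (h / (N + 1)) < r + δ := by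
  have hev : ∀ᶠ n : ℕ in atTop, h * (1 / ((n : ℝ≥0) + 1)) < δ := by
    have := (tendsto_one_div_add_atTop_nhds_zero_nat (𝕜 := ℝ≥0)).const_mul h
    rw [mul_zero] at this
    exact this.eventually (gt_mem_nhds hδ)
  filter_upwards [hev] with N hN
  have hp : (0 : ℝ≥0) < N + 1 := by positivity
  rcases eq_or_ne h 0 with rfl | hh
  · obtain rfl : r = 0 := le_antisymm hr zero_le
    exact ⟨0, by simp, by simp, by simpa using hδ⟩
  have hh' : 0 < h := pos_iff_ne_zero.2 hh
  have hd : 0 < h / (N + 1) := by positivity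
  refine ⟨⌈r / (h / (N + 1))⌉₊, ?_, ?_, ?_⟩
  · rw [Nat.ceil_le, div_le_iff₀ hd]
    push_cast
    rwa [mul_div_cancel₀ _ hp.ne']
  · rw [← div_le_iff₀ hd]; exact Nat.le_ceil _
  · have h1 : (⌈r / (h / (N + 1))⌉₊ : ℝ≥0) < r / (h / (N + 1)) + 1 := Nat.ceil_lt_add_one zero_le
    calc _ < (r / (h / (N + 1)) + 1) * (h / (N + 1)) := by gcongr
      _ = r + h * (1 / (N + 1)) := by rw [add_mul, div_mul_cancel₀ _ hd.ne']; ring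
      _ < r + δ := by gcongr

/-- On a grid, a path that starts at `i` and is elsewhere at some point makes a first step. -/
theorem exists_step {ω : SwitchPath} (h0 : ω.1 0 = i) {l : ℕ} {d : ℝ≥0} (hl : ω.1 (l * d) ≠ i) :
    ∃ m < l, ω.1 (m * d) = i ∧ ω.1 (m * d + d) ≠ i := by
  induction l with
  | zero => simp [h0] at hl
  | succ l ih =>
    by_cases h : ω.1 (l * d) = i
    · exact ⟨l, l.lt_succ_self, h, by convert hl using 3; push_cast; ring⟩
    · obtain ⟨m, hm, H⟩ := ih h
      exact ⟨m, hm.trans l.lt_succ_self, H⟩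

theorem sum_grid_le (c : ℝ) (h : ℝ≥0) (N : ℕ) :
    ∑ _m ∈ Finset.range (N + 1), ENNReal.ofReal (c * ((h / (N + 1) : ℝ≥0) : ℝ)) =
      ENNReal.ofReal (c * h) := by
  rw [Finset.sum_const, Finset.card_range, nsmul_eq_mul, ← ENNReal.ofReal_natCast,
    ← ENNReal.ofReal_mul (by positivity)]
  congr 1
  push_cast
  field_simp

/-- By right continuity a visit outside `i` lasts for a while and is seen by every fine grid. Some
grid step then leads from `i` to `j`, and the union bound over the `N + 1` steps does not depend on
`N`. -/
theorem IsSwitchingLaw.measure_stay_compl (hμ : IsSwitchingLaw q i μ) (hq : ∀ k, 0 < q k)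
    (h : ℝ≥0) : μ (stay i h)ᶜ ≤ ENNReal.ofReal (q i * h) := by
  obtain ⟨j, hji⟩ : ∃ j : Fin 2, j ≠ i := exists_ne i
  have h0 : μ (stay i h)ᶜ = μ ((stay i h)ᶜ ∩ {ω | ω.1 0 = i}) := by
    refine measure_congr ?_
    filter_upwards [hμ.start] with ω hω
    exact propext ⟨fun H => ⟨H, hω⟩, fun H => H.1⟩
  rw [h0]
  refine measure_le_of_eventually_mem (B := fun N => ⋃ m ∈ Finset.range (N + 1),
    ({ω | ω.1 (m * (h / (N + 1))) = i} ∩ {ω | ω.1 (m * (h / (N + 1)) + h / (N + 1)) = j}))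
    ?_ fun N => ?_
  · rintro ω ⟨hω, hω0⟩
    simp only [stay, mem_compl_iff, mem_ofPred_eq, not_forall] at hω
    obtain ⟨r, hr, hri⟩ := hω
    obtain ⟨δ, hδ, H⟩ := ω.exists_eq_right r
    filter_upwards [exists_grid h r δ hr hδ] with N ⟨l, hl, hl1, hl2⟩
    obtain ⟨m, hm, hm1, hm2⟩ := exists_step hω0 (l := l) (d := h / (N + 1))
      (by rw [H _ hl1 hl2]; exact hri)
    refine mem_iUnion₂.2 ⟨m, Finset.mem_range.2 (hm.trans_le hl), hm1, ?_⟩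
    exact (coord_ne_iff hji _ _).1 hm2
  · refine (measure_biUnion_finset_le _ _).trans ((Finset.sum_le_sum fun m _ =>
      hμ.measure_step_le hq _ _ hji).trans ?_)
    exact (sum_grid_le (q i) h N).le

/-- A grid step out of `i` must be followed by a departure from `j` within time `h`. The Markov
property multiplies the two bounds, and the sum over grid steps gives order `h²`. -/
theorem IsSwitchingLaw.measure_comeBack {P : Fin 2 → Measure SwitchPath}
    (hP : ∀ k, IsSwitchingLaw q k (P k)) (hμ : IsSwitchingLaw q i μ) (hq : ∀ k, 0 < q k)
    {j : Fin 2} (hji : j ≠ i) (h : ℝ≥0) :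
    μ (comeBack i h) ≤ ENNReal.ofReal (q i * q j * h ^ 2) := by
  have h0 : μ (comeBack i h) = μ (comeBack i h ∩ {ω | ω.1 0 = i}) := by
    refine measure_congr ?_
    filter_upwards [hμ.start] with ω hω
    exact propext ⟨fun H => ⟨H, hω⟩, fun H => H.1⟩
  rw [h0]
  refine measure_le_of_eventually_mem (B := fun N => ⋃ m ∈ Finset.range (N + 1),
    (({ω | ω.1 (m * (h / (N + 1))) = i} ∩ {ω | ω.1 (m * (h / (N + 1)) + h / (N + 1)) = j}) ∩
      shift (m * (h / (N + 1)) + h / (N + 1)) ⁻¹' (stay j h)ᶜ)) ?_ fun N => ?_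
  · rintro ω ⟨⟨a, b, hab, hbh, ha, hb⟩, hω0⟩
    have hab' : a < b := lt_of_le_of_ne hab fun e => ha (e ▸ hb)
    obtain ⟨δ, hδ, H⟩ := ω.exists_eq_right a
    -- The grid point is placed inside the visit outside `i` and before the return time `b`.
    filter_upwards [exists_grid h a (min δ (b - a)) (hab.trans hbh)
      (lt_min hδ (tsub_pos_of_lt hab'))] with N ⟨l, hl, hl1, hl2⟩
    have hl3 : l * (h / (N + 1)) < a + δ := hl2.trans_le (by gcongr; exact min_le_left _ _)
    have hl4 : l * (h / (N + 1)) < b := hl2.trans_le (by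
      calc a + min δ (b - a) ≤ a + (b - a) := by gcongr; exact min_le_right _ _
        _ = b := add_tsub_cancel_of_le hab)
    obtain ⟨m, hm, hm1, hm2⟩ := exists_step hω0 (l := l) (d := h / (N + 1))
      (by rw [H _ hl1 hl3]; exact ha)
    have hm3 : m * (h / (N + 1)) + h / (N + 1) ≤ b := by
      refine le_trans ?_ hl4.le
      calc m * (h / (N + 1)) + h / (N + 1) = ((m + 1 : ℕ) : ℝ≥0) * (h / (N + 1)) := by
            push_cast; ring
        _ ≤ _ := by gcongr; exact hm
    refine mem_iUnion₂.2 ⟨m, Finset.mem_range.2 (hm.trans_le hl), ⟨hm1,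
      (coord_ne_iff hji _ _).1 hm2⟩, fun hst => ?_⟩
    have := hst (b - (m * (h / (N + 1)) + h / (N + 1))) (tsub_le_self.trans hbh)
    rw [shift_apply, add_tsub_cancel_of_le hm3, hb] at this
    exact hji this.symm
  · refine (measure_biUnion_finset_le _ _).trans ?_
    calc _ ≤ ∑ m ∈ Finset.range (N + 1), ENNReal.ofReal (q i * ((h / (N + 1) : ℝ≥0) : ℝ)) *
          ENNReal.ofReal (q j * h) := by
          refine Finset.sum_le_sum fun m _ => ?_
          rw [hμ.measure_inter_shift (hP j) hq _ (((measurableSet_coord_eq_history le_self_add i)).inter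
            (measurableSet_coord_eq_history le_rfl j)) (fun ω h => h.2)
            (history_le h _ (measurableSet_stay j h)).compl]
          exact mul_le_mul' (hμ.measure_step_le hq _ _ hji) ((hP j).measure_stay_compl hq h)
      _ = _ := by
          rw [← Finset.sum_mul, sum_grid_le, ← ENNReal.ofReal_mul (by
            have := hq i; positivity)]
          congr 1; ring

end

/-! ### Reduction of extended-real integrals to nonnegative ones. -/

section
/-! ### Integrals of extended-real functions that are bounded below -/

theorem ereal_sub_eq_sub {p n x a : ℝ≥0∞} (hn : n ≠ ∞) (ha : a ≠ ∞) (h : x + n = p + a) :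
    (p : EReal) - n = x - a := by
  lift n to ℝ≥0 using hn
  lift a to ℝ≥0 using ha
  induction x with
  | top =>
    have hp : p = ∞ := by
      by_contra hp
      rw [top_add] at h
      exact ENNReal.add_ne_top.2 ⟨hp, ENNReal.coe_ne_top⟩ h.symm
    subst hp
    rw [EReal.coe_ennreal_top, EReal.top_sub (EReal.coe_ennreal_eq_top_iff.not.2 ENNReal.coe_ne_top),
      EReal.top_sub (EReal.coe_ennreal_eq_top_iff.not.2 ENNReal.coe_ne_top)]
  | coe x =>
    have hp : p ≠ ∞ := by
      rintro rfl
      rw [top_add] at h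
      exact ENNReal.add_ne_top.2 ⟨ENNReal.coe_ne_top, ENNReal.coe_ne_top⟩ h
    lift p to ℝ≥0 using hp
    norm_cast at h
    have h' : (x : ℝ) + n = p + a := by exact_mod_cast congrArg NNReal.toReal h
    show ((p : ℝ) : EReal) - ((n : ℝ) : EReal) = ((x : ℝ) : EReal) - ((a : ℝ) : EReal)
    rw [← EReal.coe_sub, ← EReal.coe_sub]
    congr 1
    linarith

theorem toENNReal_add_coe {g : EReal} {k : ℝ} (hk : 0 ≤ k) (h : -(k : EReal) ≤ g) :
    (g + k).toENNReal + (-g).toENNReal = g.toENNReal + ENNReal.ofReal k := by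
  induction g with
  | bot => simp at h
  | top => simp
  | coe g =>
    rw [← EReal.coe_add, ← EReal.coe_neg]
    have h' : -k ≤ g := by exact_mod_cast h
    simp only [EReal.toENNReal_of_ne_top (EReal.coe_ne_top _), EReal.toReal_coe]
    rcases le_total 0 g with hg | hg
    · rw [ENNReal.ofReal_of_nonpos (neg_nonpos.2 hg), add_zero, ENNReal.ofReal_add hg hk]
    · rw [ENNReal.ofReal_of_nonpos hg, zero_add, ← ENNReal.ofReal_add (by linarith) (by linarith)]
      congr 1; ring

/-- Adding an integrable lower bound makes the integrand nonnegative, so all later estimates can be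
done with `∫⁻`, the integral being allowed to be infinite. -/
theorem extIntegral_eq_sub {α : Type*} [MeasurableSpace α] {m : Measure α} {g : α → EReal}
    {k : α → ℝ} (hg : AEMeasurable g m) (hk : Integrable k m) (hk0 : ∀ a, 0 ≤ k a)
    (h : ∀ᵐ a ∂m, -(k a : EReal) ≤ g a) :
    extIntegral m g = ((∫⁻ a, (g a + k a).toENNReal ∂m : ℝ≥0∞) : EReal) -
      ((∫ a, k a ∂m : ℝ) : EReal) := by
  have hkm : ∫⁻ a, ENNReal.ofReal (k a) ∂m = ENNReal.ofReal (∫ a, k a ∂m) :=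
    (ofReal_integral_eq_lintegral_ofReal hk (Eventually.of_forall hk0)).symm
  have e : ((∫ a, k a ∂m : ℝ) : EReal) = ((∫⁻ a, ENNReal.ofReal (k a) ∂m : ℝ≥0∞) : EReal) := by
    rw [hkm, EReal.coe_ennreal_ofReal, max_eq_left (integral_nonneg hk0)]
  rw [extIntegral, e]
  have hneg : ∫⁻ a, (-g a).toENNReal ∂m ≤ ∫⁻ a, ENNReal.ofReal (k a) ∂m := by
    refine lintegral_mono_ae (h.mono fun a ha => ?_)
    rw [show ENNReal.ofReal (k a) = (k a : EReal).toENNReal by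
      rw [EReal.toENNReal_of_ne_top (EReal.coe_ne_top _), EReal.toReal_coe]]
    exact EReal.toENNReal_le_toENNReal (EReal.neg_le_of_neg_le ha)
  have hfin : ∫⁻ a, ENNReal.ofReal (k a) ∂m ≠ ∞ := by rw [hkm]; exact ENNReal.ofReal_ne_top
  refine ereal_sub_eq_sub (ne_top_of_le_ne_top hfin hneg) hfin ?_
  have hnm : AEMeasurable (fun a => (-g a).toENNReal) m :=
    EReal.continuous_toENNReal.measurable.comp_aemeasurable
      (continuous_neg.measurable.comp_aemeasurable hg)
  rw [← lintegral_add_right' _ hnm,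
    ← lintegral_add_right' _ (hk.aemeasurable.ennreal_ofReal)]
  exact lintegral_congr_ae (h.mono fun a ha => toENNReal_add_coe (hk0 a) ha)

theorem extIntegral_mono {α : Type*} [MeasurableSpace α] {m : Measure α} {f g : α → EReal}
    (h : ∀ᵐ a ∂m, f a ≤ g a) : extIntegral m f ≤ extIntegral m g :=
  EReal.sub_le_sub
    (EReal.coe_ennreal_le_coe_ennreal_iff.2
      (lintegral_mono_ae (h.mono fun _ ha => EReal.toENNReal_le_toENNReal ha)))
    (EReal.coe_ennreal_le_coe_ennreal_iff.2
      (lintegral_mono_ae (h.mono fun _ ha => EReal.toENNReal_le_toENNReal (EReal.neg_le_neg_iff.2 ha))))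

theorem extIntegral_congr {α : Type*} [MeasurableSpace α] {m : Measure α} {f g : α → EReal}
    (h : ∀ᵐ a ∂m, f a = g a) : extIntegral m f = extIntegral m g :=
  le_antisymm (extIntegral_mono (h.mono fun _ ha => ha.le))
    (extIntegral_mono (h.mono fun _ ha => ha.ge))

section Probability

variable {α : Type*} [MeasurableSpace α] {m : Measure α} [IsProbabilityMeasure m]

theorem extIntegral_eq_sub_const {g : α → EReal} {k : ℝ} (hg : AEMeasurable g m) (hk0 : 0 ≤ k)
    (h : ∀ᵐ a ∂m, -(k : EReal) ≤ g a) :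
    extIntegral m g = ((∫⁻ a, (g a + k).toENNReal ∂m : ℝ≥0∞) : EReal) - (k : EReal) := by
  have := extIntegral_eq_sub (k := fun _ => k) hg (integrable_const k) (fun _ => hk0) h
  simpa using this

theorem extIntegral_const (r : ℝ) : extIntegral m (fun _ => (r : EReal)) = r := by
  simp only [extIntegral, lintegral_const, measure_univ, mul_one]
  rw [EReal.coe_toENNReal_eq_max, ← EReal.coe_neg, EReal.coe_toENNReal_eq_max]
  have h0 : (0 : EReal) = ((0 : ℝ) : EReal) := rfl
  rw [h0, ← EReal.coe_strictMono.monotone.map_max, ← EReal.coe_strictMono.monotone.map_max,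
    ← EReal.coe_sub]
  congr 1
  rcases le_total 0 r with h | h
  · rw [max_eq_right h, max_eq_left (by linarith)]; ring
  · rw [max_eq_left h, max_eq_right (by linarith)]; ring

theorem coe_le_extIntegral {g : α → EReal} {r : ℝ} (h : ∀ᵐ a ∂m, (r : EReal) ≤ g a) :
    (r : EReal) ≤ extIntegral m g :=
  (extIntegral_const (m := m) r).symm.le.trans (extIntegral_mono h)

theorem extIntegral_le_coe {g : α → EReal} {r : ℝ} (h : ∀ᵐ a ∂m, g a ≤ (r : EReal)) :
    extIntegral m g ≤ (r : EReal) :=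
  (extIntegral_mono h).trans (extIntegral_const (m := m) r).le

end Probability

end

/-! ### The common control problem and the measurability of its cost. -/

section
variable {n : ℕ}

/-! ### Absolutely continuous curves -/

theorem AbsolutelyContinuousOnInterval.lipschitz_comp {X Y : Type*} [PseudoMetricSpace X]
    [PseudoMetricSpace Y] {f : ℝ → X} {a b : ℝ} {φ : X → Y} {K : ℝ≥0} (hφ : LipschitzWith K φ)
    (hf : AbsolutelyContinuousOnInterval f a b) :
    AbsolutelyContinuousOnInterval (fun s => φ (f s)) a b := by
  refine squeeze_zero (fun E => Finset.sum_nonneg fun i _ => dist_nonneg) (fun E => ?_)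
    (by simpa using Tendsto.const_mul (K : ℝ) hf)
  rw [Finset.mul_sum]
  exact Finset.sum_le_sum fun i _ => hφ.dist_le_mul _ _

theorem lipschitzWith_inner (p : Space n) : LipschitzWith ‖p‖₊ (fun y : Space n => inner ℝ p y) :=
  LipschitzWith.of_dist_le_mul fun y z => by
    rw [Real.dist_eq, ← inner_sub_right, dist_eq_norm]
    exact abs_real_inner_le_norm p (y - z)

theorem lipschitzWith_coord (k : Fin n) : LipschitzWith 1 (fun y : Space n => y k) :=
  LipschitzWith.of_dist_le_mul fun y z => by
    rw [NNReal.coe_one, one_mul, dist_eq_norm, dist_eq_norm]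
    exact PiLp.norm_apply_le (y - z) k

theorem AbsolutelyContinuousOnInterval.ae_differentiableAt_space {η : ℝ → Space n} {a b : ℝ}
    (hη : AbsolutelyContinuousOnInterval η a b) :
    ∀ᵐ s, s ∈ uIcc a b → DifferentiableAt ℝ η s := by
  have : ∀ᵐ s : ℝ, ∀ k, s ∈ uIcc a b → DifferentiableAt ℝ (fun r => η r k) s :=
    ae_all_iff.2 fun k =>
      (AbsolutelyContinuousOnInterval.lipschitz_comp (lipschitzWith_coord k) hη).ae_differentiableAt
  filter_upwards [this] with s hs hsI
  exact differentiableAt_euclidean.2 fun k => hs k hsI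

theorem ofReal_integral_le_lintegral {α : Type*} [MeasurableSpace α] {m : Measure α} {f : α → ℝ}
    (hf : Integrable f m) : ENNReal.ofReal (∫ x, f x ∂m) ≤ ∫⁻ x, ENNReal.ofReal (f x) ∂m := by
  rw [integral_eq_lintegral_pos_part_sub_lintegral_neg_part hf]
  refine (ENNReal.ofReal_le_ofReal (sub_le_self _ ENNReal.toReal_nonneg)).trans
    ENNReal.ofReal_toReal_le

/-! ### Running costs -/

/-- A nonnegative running cost that is dual to a Hamiltonian `H`. -/
structure IsRunningCost (L : Fin 2 → Space n → Space n → ℝ≥0∞)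
    (H : Fin 2 → Space n → Space n → ℝ) : Prop where
  measurable : ∀ k, Measurable (fun z : Space n × Space n => L k z.1 z.2)
  ge : ∀ k y v p, ENNReal.ofReal (inner ℝ p v - H k y p) ≤ L k y v
  -- The cost may be infinite at high speed; only small velocities are guaranteed a finite bound.
  slow : ∃ δ > 0, ∃ C : ℝ≥0, ∀ k y v, ‖v‖ ≤ δ → L k y v ≤ C
  -- The velocity is fixed while the position varies near `y`; this stands in for continuity of `L`
  -- in the position.
  fenchel : ∀ k y p, ∀ δ > 0, ∃ v, 0 ≤ inner ℝ p v - H k y p + δ ∧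
    ∀ᶠ z in 𝓝 y, L k z v ≤ ENNReal.ofReal (inner ℝ p v - H k y p + δ)
  continuous : ∀ k, Continuous (fun z : Space n × Space n => H k z.1 z.2)
  bounded : ∀ R : ℝ, ∃ C : ℝ, ∀ k y p, ‖p‖ ≤ R → H k y p ≤ C

/-- The integrand of the discounted running cost. -/
def runDensity (L : Fin 2 → Space n → Space n → ℝ≥0∞) (lam : ℝ) (η : SwitchPath → ℝ → Space n)
    (ω : SwitchPath) (s : ℝ) : ℝ≥0∞ :=
  ENNReal.ofReal (Real.exp (-(lam * s))) * L (ω.1 s.toNNReal) (η ω s) (-deriv (η ω) s)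

/-- The discounted running cost over a set of times. -/
def run (L : Fin 2 → Space n → Space n → ℝ≥0∞) (lam : ℝ) (η : SwitchPath → ℝ → Space n)
    (ω : SwitchPath) (A : Set ℝ) : ℝ≥0∞ :=
  ∫⁻ s in A, runDensity L lam η ω s

/-- The times in `(0, τ]`. -/
def upTo (τ : WithTop ℝ≥0) : Set ℝ := {s | 0 < s ∧ ((s.toNNReal : ℝ≥0) : WithTop ℝ≥0) ≤ τ}

theorem upTo_coe (r : ℝ≥0) : upTo (r : WithTop ℝ≥0) = Ioc 0 (r : ℝ) := by
  ext s
  refine and_congr_right fun hs => ?_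
  rw [WithTop.coe_le_coe, Real.toNNReal_le_iff_le_coe]

theorem upTo_top : upTo ⊤ = Ioi 0 := by
  ext s
  exact ⟨fun h => h.1, fun h => ⟨h, le_top⟩⟩

/-- The discounted terminal cost at the stopping time. -/
def terminal (lam : ℝ) (g : Fin 2 → Space n → ℝ) (η : SwitchPath → ℝ → Space n) (ω : SwitchPath) :
    WithTop ℝ≥0 → ℝ
  | ⊤ => 0
  | (r : ℝ≥0) => Real.exp (-(lam * r)) * g (ω.1 r) (η ω r)

/-- The cost of a trajectory stopped at `τ`. -/
def pathCost (L : Fin 2 → Space n → Space n → ℝ≥0∞) (lam : ℝ) (g : Fin 2 → Space n → ℝ)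
    (η : SwitchPath → ℝ → Space n) (τ : SwitchPath → WithTop ℝ≥0) (ω : SwitchPath) : EReal :=
  ((run L lam η ω (upTo (τ ω)) : ℝ≥0∞) : EReal) + ((terminal lam g η ω (τ ω) : ℝ) : EReal)

/-- An admissible trajectory in `K`, defined for all times, with a stopping time that does not
exceed the horizon `b`; before the horizon it may stop only in `Γ`. -/
structure IsControl (K Γ : Set (Space n)) (b : WithTop ℝ≥0) (x : Space n)
    (η : SwitchPath → ℝ → Space n) (τ : SwitchPath → WithTop ℝ≥0) : Prop where
  start : ∀ ω, η ω 0 = x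
  absolutelyContinuous : ∀ ω (t : ℝ), 0 ≤ t → AbsolutelyContinuousOnInterval (η ω) 0 t
  mem : ∀ ω (s : ℝ), 0 ≤ s → η ω s ∈ K
  nonanticipating : ∀ s : ℝ≥0, Measurable[history s] (fun ω => η ω s)
  stoppingTime : IsStoppingTime history τ
  le_horizon : ∀ ω, τ ω ≤ b
  exit : ∀ ω (r : ℝ≥0), τ ω = r → (r : WithTop ℝ≥0) = b ∨ η ω r ∈ Γ

/-- The value function of the control problem with horizon `b`. -/
def valueFun (L : Fin 2 → Space n → Space n → ℝ≥0∞) (lam : ℝ) (g : Fin 2 → Space n → ℝ)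
    (K Γ : Set (Space n)) (μ : Measure SwitchPath) (b : WithTop ℝ≥0) (x : Space n) : EReal :=
  ⨅ (η : SwitchPath → ℝ → Space n) (τ : SwitchPath → WithTop ℝ≥0) (_ : IsControl K Γ b x η τ),
    extIntegral μ (pathCost L lam g η τ)

section RunningCost

variable {L : Fin 2 → Space n → Space n → ℝ≥0∞} {H : Fin 2 → Space n → Space n → ℝ}
  {lam : ℝ} {g : Fin 2 → Space n → ℝ} {K Γ : Set (Space n)} {b : WithTop ℝ≥0} {x : Space n}
  {η : SwitchPath → ℝ → Space n} {τ : SwitchPath → WithTop ℝ≥0}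

/-- The running cost of a curve bounds its displacement in the direction `-p`. -/
theorem IsRunningCost.run_ge (hL : IsRunningCost L H) (hlam : 0 ≤ lam) (ω : SwitchPath) {θ : ℝ}
    (hθ : 0 ≤ θ) (hη : AbsolutelyContinuousOnInterval (η ω) 0 θ) (p : Space n) {m : ℝ}
    (hm : ∀ s ∈ Ioc 0 θ, H (ω.1 s.toNNReal) (η ω s) p ≤ m) :
    ENNReal.ofReal (Real.exp (-(lam * θ)) * (-inner ℝ p (η ω θ - η ω 0) - m * θ)) ≤
      run L lam η ω (Ioc 0 θ) := by
  -- The bound is the integral of the Fenchel inequality `p · v - H ≤ L` with `v = -η'`, for which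
  -- `p · v` is the derivative of `f`.
  set f : ℝ → ℝ := fun s => inner ℝ (-p) (η ω s) with hf
  have hfac : AbsolutelyContinuousOnInterval f 0 θ :=
    AbsolutelyContinuousOnInterval.lipschitz_comp (lipschitzWith_inner (-p)) hη
  have hint := hfac.intervalIntegrable_deriv
  rw [intervalIntegrable_iff_integrableOn_Ioc_of_le hθ] at hint
  have hint2 : IntegrableOn (fun s => deriv f s - m) (Ioc 0 θ) :=
    hint.sub (integrableOn_const (by simp))
  have e1 : ∫ s in Ioc 0 θ, (deriv f s - m) = -inner ℝ p (η ω θ - η ω 0) - m * θ := by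
    rw [integral_sub hint (integrableOn_const (by simp)), ← intervalIntegral.integral_of_le hθ,
      hfac.integral_deriv_eq_sub]
    simp [hf, inner_sub_right, hθ]
    ring
  rw [ENNReal.ofReal_mul (Real.exp_pos _).le, run, ← e1]
  refine (mul_le_mul_right (ofReal_integral_le_lintegral hint2) _).trans ?_
  rw [← lintegral_const_mul' _ _ ENNReal.ofReal_ne_top]
  refine setLIntegral_mono_ae' measurableSet_Ioc ?_
  filter_upwards [AbsolutelyContinuousOnInterval.ae_differentiableAt_space hη] with s hs hsI
  have hd : DifferentiableAt ℝ (η ω) s := hs (by rw [uIcc_of_le hθ]; exact ⟨hsI.1.le, hsI.2⟩)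
  have e2 : deriv f s = inner ℝ p (-deriv (η ω) s) := by
    have := (hasDerivAt_const s (-p)).inner ℝ hd.hasDerivAt
    rw [this.deriv]
    simp
  -- On `(0, θ]` the discount factor is at least its final value.
  refine mul_le_mul' (ENNReal.ofReal_le_ofReal (Real.exp_le_exp.2 ?_)) ?_
  · have := mul_le_mul_of_nonneg_left hsI.2 hlam; linarith
  · refine le_trans (ENNReal.ofReal_le_ofReal ?_) (hL.ge (ω.1 s.toNNReal) (η ω s) _ p)
    rw [e2]
    have := hm s hsI
    linarith

/-! ### Measurability of the cost -/

/-- A function that is continuous in time and measurable in chance is jointly measurable. Times are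
truncated at 0 because nothing is assumed about a curve before time 0. -/
theorem IsControl.measurable_uncurry (hη : IsControl K Γ b x η τ) :
    Measurable (fun z : SwitchPath × ℝ => η z.1 (max z.2 0)) := by
  have hcont : ∀ ω, Continuous fun s : ℝ => η ω (max s 0) := by
    intro ω
    rw [continuous_iff_continuousAt]
    intro s
    have h1 : ContinuousOn (η ω) (Icc 0 (max s 0 + 1)) := by
      have := (hη.absolutelyContinuous ω (max s 0 + 1) (by positivity)).continuousOn
      rwa [uIcc_of_le (by positivity)] at this
    have h2 : ContinuousOn (fun r : ℝ => η ω (max r 0)) (Iio (max s 0 + 1)) := by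
      refine h1.comp (by fun_prop) fun r hr => ⟨le_max_right _ _, max_le (le_of_lt hr) ?_⟩
      positivity
    exact h2.continuousAt (Iio_mem_nhds (by have := le_max_left s 0; linarith))
  have hmeas : ∀ s : ℝ, Measurable fun ω => η ω (max s 0) := by
    intro s
    have := hη.nonanticipating (max s 0).toNNReal
    rw [Real.coe_toNNReal _ (le_max_right _ _)] at this
    exact this.mono (history_le _) le_rfl
  have := measurable_uncurry_of_continuous_of_measurable hcont hmeas
  exact this.comp measurable_swap

/-- A jointly measurable version of the velocity. -/
def velocity (η : SwitchPath → ℝ → Space n) (z : SwitchPath × ℝ) : Space n :=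
  WithLp.toLp 2 fun k => limsup (fun N : ℕ => ((N : ℝ) + 1) *
    (η z.1 (max (z.2 + ((N : ℝ) + 1)⁻¹) 0) k - η z.1 (max z.2 0) k)) atTop

theorem IsControl.measurable_velocity (hη : IsControl K Γ b x η τ) :
    Measurable (velocity η) := by
  refine (WithLp.measurable_toLp 2 _).comp (measurable_pi_iff.2 fun k => Measurable.limsup fun N => ?_)
  have hk : Measurable (fun y : Space n => y k) := (lipschitzWith_coord k).continuous.measurable
  have h1 : Measurable (fun z : SwitchPath × ℝ => η z.1 (max (z.2 + ((N : ℝ) + 1)⁻¹) 0)) :=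
    hη.measurable_uncurry.comp (measurable_fst.prodMk (measurable_snd.add_const _))
  exact ((hk.comp h1).sub (hk.comp hη.measurable_uncurry)).const_mul _

theorem velocity_eq_deriv {ω : SwitchPath} {s : ℝ} (hs : 0 < s) (hd : DifferentiableAt ℝ (η ω) s) :
    velocity η (ω, s) = deriv (η ω) s := by
  ext k
  have h1 := hd.hasDerivAt.tendsto_slope_zero
  have h2 : Tendsto (fun N : ℕ => ((N : ℝ) + 1)⁻¹) atTop (𝓝[≠] 0) := by
    refine tendsto_nhdsWithin_iff.2 ⟨?_, Eventually.of_forall fun N => ?_⟩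
    · simpa using tendsto_one_div_add_atTop_nhds_zero_nat (𝕜 := ℝ)
    · have : (0 : ℝ) < ((N : ℝ) + 1)⁻¹ := by positivity
      exact this.ne'
  have h3 := ((lipschitzWith_coord k).continuous.tendsto _).comp (h1.comp h2)
  refine Tendsto.limsup_eq (h3.congr fun N => ?_)
  have e : max (s + ((N : ℝ) + 1)⁻¹) 0 = s + ((N : ℝ) + 1)⁻¹ := max_eq_left (by positivity)
  simp [e, max_eq_left hs.le]

theorem IsControl.ae_differentiableAt (hη : IsControl K Γ b x η τ) (ω : SwitchPath) :
    ∀ᵐ s : ℝ, 0 < s → DifferentiableAt ℝ (η ω) s := by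
  have : ∀ᵐ s : ℝ, ∀ N : ℕ, s ∈ uIcc (0 : ℝ) N → DifferentiableAt ℝ (η ω) s :=
    ae_all_iff.2 fun N => AbsolutelyContinuousOnInterval.ae_differentiableAt_space
      (hη.absolutelyContinuous ω N N.cast_nonneg)
  filter_upwards [this] with s hs h0
  obtain ⟨N, hN⟩ := exists_nat_ge s
  exact hs N (by rw [uIcc_of_le N.cast_nonneg]; exact ⟨h0.le, hN⟩)

theorem measurable_of_state {α β : Type*} [MeasurableSpace α] [MeasurableSpace β]
    {F : Fin 2 → Space n → Space n → β}
    (hF : ∀ k, Measurable (fun z : Space n × Space n => F k z.1 z.2)) {a : α → Fin 2}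
    {y v : α → Space n} (ha : Measurable a) (hy : Measurable y) (hv : Measurable v) :
    Measurable (fun z => F (a z) (y z) (v z)) :=
  (measurable_from_prod_countable_right (f := fun z : Fin 2 × (Space n × Space n) =>
    F z.1 z.2.1 z.2.2) hF).comp (ha.prodMk (hy.prodMk hv))

/-- For each path the derivative agrees at almost every time with the jointly measurable `velocity`,
so the cost is a partial integral of a measurable function on the product. -/
theorem IsControl.measurable_run (hL : IsRunningCost L H) (hη : IsControl K Γ b x η τ) :
    Measurable (fun ω => run L lam η ω (upTo (τ ω))) := by
  set D : Set (SwitchPath × ℝ) := {z | 0 < z.2 ∧ ((z.2.toNNReal : ℝ≥0) : WithTop ℝ≥0) ≤ τ z.1}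
  have hτ : Measurable τ := hη.stoppingTime.measurable'
  have hD : MeasurableSet D :=
    (measurableSet_lt measurable_const measurable_snd).inter
      (measurableSet_le (WithTop.measurable_coe.comp (measurable_real_toNNReal.comp measurable_snd))
        (hτ.comp measurable_fst))
  set F : SwitchPath × ℝ → ℝ≥0∞ := D.indicator fun z =>
    ENNReal.ofReal (Real.exp (-(lam * z.2))) *
      L (z.1.1 z.2.toNNReal) (η z.1 (max z.2 0)) (-velocity η z) with hFdef
  have hF : Measurable F := by
    refine Measurable.indicator (Measurable.mul (by fun_prop) ?_) hD
    refine measurable_of_state hL.measurable ?_ hη.measurable_uncurry hη.measurable_velocity.neg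
    exact measurable_coord_uncurry.comp
      (measurable_fst.prodMk (measurable_real_toNNReal.comp measurable_snd))
  convert hF.lintegral_prod_right' (ν := volume) using 2 with ω
  have hDω : MeasurableSet (upTo (τ ω)) := measurable_prodMk_left (x := ω) hD
  rw [run, ← lintegral_indicator hDω]
  refine lintegral_congr_ae ?_
  filter_upwards [hη.ae_differentiableAt ω] with s hs
  by_cases hsD : s ∈ upTo (τ ω)
  · have hsD' : (ω, s) ∈ D := hsD
    rw [indicator_of_mem hsD, hFdef, indicator_of_mem hsD', runDensity,
      velocity_eq_deriv hsD.1 (hs hsD.1), max_eq_left hsD.1.le]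
  · have hsD' : (ω, s) ∉ D := hsD
    rw [indicator_of_notMem hsD, hFdef, indicator_of_notMem hsD']

theorem IsControl.measurable_terminal (hg : ∀ k, Measurable (g k)) (hη : IsControl K Γ b x η τ) :
    Measurable (fun ω => terminal lam g η ω (τ ω)) := by
  have hτ : Measurable τ := hη.stoppingTime.measurable'
  have hr : Measurable (fun ω => (τ ω).untopD 0) := hτ.untopD 0
  have hr' : Measurable (fun ω => (((τ ω).untopD 0 : ℝ≥0) : ℝ)) := measurable_coe_nnreal_real.comp hr
  have h1 : Measurable (fun ω : SwitchPath => ω.1 ((τ ω).untopD 0)) :=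
    measurable_coord_uncurry.comp (measurable_id.prodMk hr)
  have h2 : Measurable (fun ω : SwitchPath => η ω (max (((τ ω).untopD 0 : ℝ≥0) : ℝ) 0)) :=
    hη.measurable_uncurry.comp (measurable_id.prodMk hr')
  have h3 : Measurable (fun ω : SwitchPath =>
      g (ω.1 ((τ ω).untopD 0)) (η ω (max (((τ ω).untopD 0 : ℝ≥0) : ℝ) 0))) :=
    (measurable_from_prod_countable_right (f := fun z : Fin 2 × Space n => g z.1 z.2) hg).comp
      (h1.prodMk h2)
  have h4 : Measurable (fun ω => if τ ω = ⊤ then (0 : ℝ) else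
      Real.exp (-(lam * (((τ ω).untopD 0 : ℝ≥0) : ℝ))) *
        g (ω.1 ((τ ω).untopD 0)) (η ω (max (((τ ω).untopD 0 : ℝ≥0) : ℝ) 0))) :=
    Measurable.ite (hτ (measurableSet_singleton ⊤)) measurable_const
      ((Real.measurable_exp.comp (hr'.const_mul lam).neg).mul h3)
  convert h4 using 2 with ω
  cases h : τ ω with
  | top => simp [terminal]
  | coe r =>
    rw [if_neg WithTop.coe_ne_top]
    simp [terminal]
    rfl

theorem IsControl.measurable_pathCost (hL : IsRunningCost L H) (hg : ∀ k, Measurable (g k))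
    (hη : IsControl K Γ b x η τ) : Measurable (pathCost L lam g η τ) :=
  (measurable_coe_ennreal_ereal.comp (hη.measurable_run hL)).add
    (measurable_coe_real_ereal.comp (hη.measurable_terminal hg))

end RunningCost

end

/-! ### Conditioning a control on the past; splitting and restarting curves. -/

section
variable {n : ℕ}

/-! ### Conditioning the cost on the history -/

theorem ereal_mul_add_coe {e : ℝ} (he : 0 ≤ e) (R : ℝ≥0∞) (G : EReal) (a : ℝ)
    (h : -(a : EReal) ≤ G) :
    ((R : EReal) + e * G + ((e * a : ℝ) : EReal)).toENNReal =
      R + ENNReal.ofReal e * (G + a).toENNReal := by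
  have e1 : (e : EReal) * G + ((e * a : ℝ) : EReal) = e * (G + a) := by
    rw [EReal.left_distrib_of_nonneg_of_ne_top (EReal.coe_nonneg.2 he) (EReal.coe_ne_top e)]
    push_cast; rfl
  have h0 : 0 ≤ G + a := by
    have := add_le_add_left h (a : EReal)
    rwa [← EReal.coe_neg, ← EReal.coe_add, neg_add_cancel, EReal.coe_zero] at this
  rw [add_assoc, e1, EReal.toENNReal_add (EReal.coe_ennreal_nonneg R)
    (mul_nonneg (EReal.coe_nonneg.2 he) h0), EReal.toENNReal_coe,
    EReal.toENNReal_mul (EReal.coe_nonneg.2 he), EReal.toENNReal_of_ne_top (EReal.coe_ne_top e),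
    EReal.toReal_coe]

theorem ereal_affine_eq {e : ℝ} (he : 0 ≤ e) (R X : ℝ≥0∞) (a : ℝ) :
    ((R + ENNReal.ofReal e * X : ℝ≥0∞) : EReal) - ((e * a : ℝ) : EReal) =
      (R : EReal) + e * ((X : EReal) - a) := by
  rw [EReal.coe_ennreal_add, EReal.coe_ennreal_mul, EReal.coe_ennreal_ofReal, max_eq_left he,
    sub_eq_add_neg, sub_eq_add_neg, EReal.left_distrib_of_nonneg_of_ne_top (EReal.coe_nonneg.2 he)
    (EReal.coe_ne_top e), ← EReal.coe_neg, ← EReal.coe_neg, ← EReal.coe_mul, add_assoc]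
  congr 3; ring

theorem neg_mul_le_affine {e : ℝ} (he : 0 ≤ e) (R : ℝ≥0∞) {G : EReal} {a : ℝ}
    (h : -(a : EReal) ≤ G) : -((e * a : ℝ) : EReal) ≤ (R : EReal) + e * G := by
  have h1 : (e : EReal) * (-(a : EReal)) ≤ e * G :=
    mul_le_mul_of_nonneg_left h (EReal.coe_nonneg.2 he)
  have h2 : -((e * a : ℝ) : EReal) = (e : EReal) * (-(a : EReal)) := by
    rw [← EReal.coe_neg, ← EReal.coe_neg, ← EReal.coe_mul]; congr 1; ring
  rw [h2]
  refine h1.trans ?_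
  calc (e : EReal) * G = 0 + e * G := (zero_add _).symm
    _ ≤ _ := add_le_add_left (EReal.coe_ennreal_nonneg R) _

theorem extIntegral_affine {α : Type*} [MeasurableSpace α] {m : Measure α} [IsProbabilityMeasure m]
    {G : α → EReal} (hG : Measurable G) {a : ℝ} (ha : 0 ≤ a) (h : ∀ z, -(a : EReal) ≤ G z)
    {e : ℝ} (he : 0 ≤ e) (R : ℝ≥0∞) :
    extIntegral m (fun z => (R : EReal) + e * G z) = (R : EReal) + e * extIntegral m G := by
  have hm : Measurable (fun z => (R : EReal) + e * G z) :=
    measurable_const.add (measurable_const.mul hG)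
  rw [extIntegral_eq_sub_const hG.aemeasurable ha (Eventually.of_forall h),
    extIntegral_eq_sub_const hm.aemeasurable (mul_nonneg he ha)
      (Eventually.of_forall fun z => neg_mul_le_affine he R (h z)), ← ereal_affine_eq he]
  congr 2
  simp_rw [ereal_mul_add_coe he R _ a (h _)]
  rw [lintegral_add_left measurable_const, lintegral_const, measure_univ, mul_one,
    lintegral_const_mul' _ _ ENNReal.ofReal_ne_top]

/-- Lower bounds for the conditional costs integrate to one for the total cost. Adding `A` reduces
this to Tonelli-type identities, so the cost may be infinite while `m` stays real and integrable. -/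
theorem le_extIntegral_of_concat {q : Fin 2 → ℝ} {i : Fin 2} {μ : Measure SwitchPath}
    {P : Fin 2 → Measure SwitchPath} (hP : ∀ k, IsSwitchingLaw q k (P k))
    (hμ : IsSwitchingLaw q i μ) (hq : ∀ k, 0 < q k) (h : ℝ≥0) {F : SwitchPath → EReal}
    (hF : Measurable F) {A : ℝ} (hA : 0 ≤ A) (hFA : ∀ ω, -(A : EReal) ≤ F ω) {m : SwitchPath → ℝ}
    (hm : Integrable m μ)
    (hle : ∀ᵐ ω₀ ∂μ, (m ω₀ : EReal) ≤ extIntegral (P (ω₀.1 h)) (fun ω₁ => F (concat h ω₀ ω₁))) :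
    ((∫ ω, m ω ∂μ : ℝ) : EReal) ≤ extIntegral μ F := by
  have := hμ.isProbabilityMeasure
  have := fun k => (hP k).isProbabilityMeasure
  have hFm : Measurable fun ω => (F ω + A).toENNReal :=
    EReal.continuous_toENNReal.measurable.comp (hF.add measurable_const)
  rw [extIntegral_eq_sub_const hF.aemeasurable hA (Eventually.of_forall hFA),
    IsSwitchingLaw.lintegral_concat hP hμ hq h hFm]
  have key : ENNReal.ofReal (∫ ω, m ω + A ∂μ) ≤
      ∫⁻ ω₀, ∫⁻ ω₁, (F (concat h ω₀ ω₁) + A).toENNReal ∂(P (ω₀.1 h)) ∂μ := by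
    refine (ofReal_integral_le_lintegral (hm.add (integrable_const A))).trans ?_
    refine lintegral_mono_ae (hle.mono fun ω hω => ?_)
    rw [extIntegral_eq_sub_const (g := fun ω₁ => F (concat h ω ω₁))
      (hF.comp (measurable_concat_right h ω)).aemeasurable hA
      (Eventually.of_forall fun _ => hFA _)] at hω
    rw [← EReal.coe_ennreal_le_coe_ennreal_iff, EReal.coe_ennreal_ofReal, EReal.coe_strictMono.monotone.map_max, max_le_iff]
    refine ⟨?_, EReal.coe_ennreal_nonneg _⟩
    rw [Pi.add_apply, EReal.coe_add]
    exact EReal.add_le_of_le_sub hω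
  have key2 := EReal.coe_ennreal_le_coe_ennreal_iff.2 key
  rw [integral_add hm (integrable_const A), EReal.coe_ennreal_ofReal] at key2
  have key3 : ((∫ ω, m ω ∂μ + A : ℝ) : EReal) ≤ _ := (by
    refine le_trans ?_ key2
    exact_mod_cast le_max_of_le_left (by simp))
  rw [EReal.coe_add] at key3
  exact (EReal.le_sub_iff_add_le (.inl (EReal.coe_ne_bot _)) (.inl (EReal.coe_ne_top _))).2 key3

/-! ### Splitting and restarting trajectories -/

/-- Monotonicity keeps disjoint intervals disjoint, and the Lipschitz constant 1 does not increase
their total length. -/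
theorem AbsolutelyContinuousOnInterval.comp_monotone {X : Type*} [PseudoMetricSpace X] {f : ℝ → X}
    {φ : ℝ → ℝ} {a b a' b' : ℝ} (hf : AbsolutelyContinuousOnInterval f a' b') (hφ : Monotone φ)
    (hφ1 : LipschitzWith 1 φ) (hm : MapsTo φ (uIcc a b) (uIcc a' b')) :
    AbsolutelyContinuousOnInterval (fun s => f (φ s)) a b := by
  rw [absolutelyContinuousOnInterval_iff] at hf ⊢
  intro ε hε
  obtain ⟨δ, hδ, H⟩ := hf ε hε
  refine ⟨δ, hδ, fun E hE hsum => ?_⟩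
  refine H (E.1, fun k => (φ (E.2 k).1, φ (E.2 k).2)) ⟨fun k hk => ?_, fun k hk l hl hkl => ?_⟩ ?_
  · exact ⟨hm (hE.1 k hk).1, hm (hE.1 k hk).2⟩
  · have := hE.2 hk hl hkl
    simp only [Function.onFun, uIoc, Ioc_disjoint_Ioc] at this ⊢
    rw [← hφ.map_min, ← hφ.map_min, ← hφ.map_max, ← hφ.map_max, ← hφ.map_min, ← hφ.map_max]
    exact hφ this
  · refine lt_of_le_of_lt (Finset.sum_le_sum fun k _ => ?_) hsum
    simpa using hφ1.dist_le_mul (E.2 k).1 (E.2 k).2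

theorem AbsolutelyContinuousOnInterval.comp_const_add {X : Type*} [PseudoMetricSpace X] {f : ℝ → X}
    {c t : ℝ} (hc : 0 ≤ c) (ht : 0 ≤ t) (hf : AbsolutelyContinuousOnInterval f 0 (c + t)) :
    AbsolutelyContinuousOnInterval (fun s => f (c + s)) 0 t := by
  refine AbsolutelyContinuousOnInterval.comp_monotone hf (fun u v h => by linarith)
    (LipschitzWith.of_dist_le_mul fun u v => by simp) fun s hs => ?_
  rw [uIcc_of_le ht] at hs
  rw [uIcc_of_le (by positivity)]
  exact ⟨by linarith [hs.1], by linarith [hs.2]⟩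

/-- On `[0, t]` the glued curve equals `f` stopped at `c`, plus `g` started at `c`, minus the
constant `f c`; each summand is absolutely continuous. -/
theorem AbsolutelyContinuousOnInterval.glue {f g : ℝ → Space n} {c t : ℝ} (hc : 0 ≤ c)
    (ht : 0 ≤ t) (hf : AbsolutelyContinuousOnInterval f 0 c)
    (hg : AbsolutelyContinuousOnInterval g 0 t) (hfg : g 0 = f c) :
    AbsolutelyContinuousOnInterval (fun s => if s ≤ c then f s else g (s - c)) 0 t := by
  have h1 : AbsolutelyContinuousOnInterval (fun s => f (max 0 (min s c))) 0 t := by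
    refine AbsolutelyContinuousOnInterval.comp_monotone hf
      (fun u v h => max_le_max le_rfl (min_le_min h le_rfl))
      ((LipschitzWith.id.min_const c).const_max 0) fun s hs => ?_
    rw [uIcc_of_le hc]
    exact ⟨le_max_left _ _, max_le hc (min_le_right _ _)⟩
  have h2 : AbsolutelyContinuousOnInterval (fun s => g (max 0 (s - c))) 0 t := by
    refine AbsolutelyContinuousOnInterval.comp_monotone hg
      (fun u v h => max_le_max le_rfl (sub_le_sub_right h c))
      (LipschitzWith.const_max (LipschitzWith.of_dist_le_mul fun u v => by simp) 0) fun s hs => ?_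
    rw [uIcc_of_le ht] at hs ⊢
    exact ⟨le_max_left _ _, max_le ht (by linarith [hs.2])⟩
  have h3 : AbsolutelyContinuousOnInterval (fun _ : ℝ => f c) 0 t :=
    (LipschitzWith.const (f c)).lipschitzOnWith.absolutelyContinuousOnInterval
  have h4 := (h1.add h2).sub h3
  refine Tendsto.congr' ?_ h4
  filter_upwards [mem_inf_of_right (mem_principal_self _)] with E hE
  refine Finset.sum_congr rfl fun k hk => ?_
  have key : ∀ s ∈ uIcc 0 t, ((fun s : ℝ => f (max 0 (min s c))) + (fun s : ℝ => g (max 0 (s - c))) -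
      (fun _ : ℝ => f c)) s = if s ≤ c then f s else g (s - c) := by
    intro s hs
    rw [uIcc_of_le ht] at hs
    simp only [Pi.add_apply, Pi.sub_apply]
    split_ifs with h
    · rw [min_eq_left h, max_eq_right hs.1, max_eq_left (by linarith), hfg, add_sub_cancel_right]
    · rw [min_eq_right (by linarith), max_eq_right hc, max_eq_right (by linarith),
        add_sub_cancel_left]
  rw [key _ (hE.1 k hk).1, key _ (hE.1 k hk).2]

theorem coe_le_withTop_sub {h s : ℝ≥0} {T : WithTop ℝ≥0} (hT : (h : WithTop ℝ≥0) ≤ T) :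
    (s : WithTop ℝ≥0) ≤ T - h ↔ ((h + s : ℝ≥0) : WithTop ℝ≥0) ≤ T := by
  cases T with
  | top => exact ⟨fun _ => le_top, fun _ => le_top⟩
  | coe r =>
    rw [← WithTop.coe_sub, WithTop.coe_le_coe, WithTop.coe_le_coe,
      le_tsub_iff_left (WithTop.coe_le_coe.1 hT)]

section Split

variable {L : Fin 2 → Space n → Space n → ℝ≥0∞} {lam : ℝ} {g : Fin 2 → Space n → ℝ}

theorem run_split {ω ω' : SwitchPath} {η η' : SwitchPath → ℝ → Space n} {h : ℝ≥0}
    {T : WithTop ℝ≥0} (hT : (h : WithTop ℝ≥0) ≤ T) (hω : ∀ r, ω'.1 r = ω.1 (h + r))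
    (hη : ∀ s : ℝ, 0 ≤ s → η' ω' s = η ω (h + s)) :
    run L lam η ω (upTo T) = run L lam η ω (Ioc 0 h) +
      ENNReal.ofReal (Real.exp (-(lam * h))) * run L lam η' ω' (upTo (T - h)) := by
  have hmeas : ∀ S : WithTop ℝ≥0, MeasurableSet (upTo S) := by
    intro S
    cases S with
    | top => rw [upTo_top]; exact measurableSet_Ioi
    | coe r => rw [upTo_coe]; exact measurableSet_Ioc
  have hsplit : upTo T = Ioc 0 (h : ℝ) ∪ (upTo T \ Ioc 0 (h : ℝ)) := by
    rw [union_sdiff_cancel]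
    rw [← upTo_coe]
    exact fun s hs => ⟨hs.1, hs.2.trans hT⟩
  have hmem : ∀ s : ℝ, (h : ℝ) + s ∈ upTo T \ Ioc 0 (h : ℝ) ↔ s ∈ upTo (T - h) := by
    intro s
    by_cases hs : 0 < s
    · have hhs : ((h : ℝ) + s).toNNReal = h + s.toNNReal := by
        rw [Real.toNNReal_add h.coe_nonneg hs.le, Real.toNNReal_coe]
      have h1 : 0 < (h : ℝ) + s := by positivity
      simp only [upTo, Set.mem_sdiff, mem_ofPred_eq, mem_Ioc, hhs, h1, hs, true_and]
      rw [coe_le_withTop_sub hT]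
      constructor
      · exact fun H => H.1
      · exact fun H => ⟨H, by linarith⟩
    · constructor
      · rintro ⟨h1, h2⟩
        exact absurd ⟨h1.1, by linarith⟩ h2
      · exact fun h1 => absurd h1.1 hs
  rw [hsplit, run, lintegral_union ((hmeas T).diff measurableSet_Ioc) disjoint_sdiff_right]
  congr 1
  rw [run, ← lintegral_indicator ((hmeas T).diff measurableSet_Ioc),
    ← lintegral_add_left_eq_self _ (h : ℝ), ← lintegral_const_mul' _ _ ENNReal.ofReal_ne_top,
    ← lintegral_indicator (hmeas _)]
  refine lintegral_congr fun s => ?_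
  by_cases hs : s ∈ upTo (T - h)
  · rw [indicator_of_mem hs, indicator_of_mem ((hmem s).2 hs), runDensity, runDensity, ← mul_assoc,
      ← ENNReal.ofReal_mul (Real.exp_pos _).le, ← Real.exp_add]
    have hs0 : 0 < s := hs.1
    have hd : deriv (η' ω') s = deriv (η ω) (h + s) := by
      rw [← deriv_comp_const_add]
      refine Filter.EventuallyEq.deriv_eq ?_
      filter_upwards [Ioi_mem_nhds hs0] with r hr
      exact hη r (le_of_lt hr)
    rw [hd, hη s hs0.le, hω, Real.toNNReal_add h.coe_nonneg hs0.le, Real.toNNReal_coe]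
    congr 3
    ring
  · rw [indicator_of_notMem hs, indicator_of_notMem (fun h' => hs ((hmem s).1 h'))]

theorem terminal_split {ω ω' : SwitchPath} {η η' : SwitchPath → ℝ → Space n} {h : ℝ≥0}
    {T : WithTop ℝ≥0} (hT : (h : WithTop ℝ≥0) ≤ T) (hω : ∀ r, ω'.1 r = ω.1 (h + r))
    (hη : ∀ s : ℝ, 0 ≤ s → η' ω' s = η ω (h + s)) :
    terminal lam g η ω T = Real.exp (-(lam * h)) * terminal lam g η' ω' (T - h) := by
  cases T with
  | top => exact (mul_zero _).symm
  | coe r =>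
    have hr : h ≤ r := WithTop.coe_le_coe.1 hT
    rw [← WithTop.coe_sub]
    simp only [terminal]
    rw [hω, hη _ (r - h).coe_nonneg, add_tsub_cancel_of_le hr, NNReal.coe_sub hr, add_sub_cancel,
      ← mul_assoc, ← Real.exp_add]
    congr 2; ring

theorem pathCost_split {ω ω' : SwitchPath} {η η' : SwitchPath → ℝ → Space n}
    {τ τ' : SwitchPath → WithTop ℝ≥0} {h : ℝ≥0} (hT : (h : WithTop ℝ≥0) ≤ τ ω)
    (hτ : τ' ω' = τ ω - h) (hω : ∀ r, ω'.1 r = ω.1 (h + r))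
    (hη : ∀ s : ℝ, 0 ≤ s → η' ω' s = η ω (h + s)) :
    pathCost L lam g η τ ω = ((run L lam η ω (Ioc 0 h) : ℝ≥0∞) : EReal) +
      (Real.exp (-(lam * h)) : ℝ) * pathCost L lam g η' τ' ω' := by
  rw [pathCost, pathCost, run_split hT hω hη, terminal_split hT hω hη, hτ, EReal.coe_ennreal_add,
    EReal.coe_ennreal_mul, EReal.coe_ennreal_ofReal, max_eq_left (Real.exp_pos _).le,
    EReal.left_distrib_of_nonneg_of_ne_top (EReal.coe_nonneg.2 (Real.exp_pos _).le)
    (EReal.coe_ne_top _), add_assoc, EReal.coe_mul]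

theorem run_congr {ω ω' : SwitchPath} {η η' : SwitchPath → ℝ → Space n} {h : ℝ≥0}
    (hω : ∀ r ≤ h, ω.1 r = ω'.1 r) (hη : ∀ s : ℝ, 0 ≤ s → s ≤ h → η ω s = η' ω' s) :
    run L lam η ω (Ioc 0 h) = run L lam η' ω' (Ioc 0 h) := by
  refine setLIntegral_congr_fun_ae measurableSet_Ioc ?_
  -- The derivative at the end time `h` depends on the curve after `h`, where nothing is known; this
  -- single time is discarded.
  have : ∀ᵐ s : ℝ, s ≠ h := by simp [ae_iff, measure_singleton]
  filter_upwards [this] with s hs hsI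
  have hsh : s < h := lt_of_le_of_ne hsI.2 hs
  have hd : deriv (η ω) s = deriv (η' ω') s := by
    refine Filter.EventuallyEq.deriv_eq ?_
    filter_upwards [Ioo_mem_nhds hsI.1 hsh] with r hr
    exact hη r hr.1.le hr.2.le
  rw [runDensity, runDensity, hd, hη s hsI.1.le hsI.2, hω _ (Real.toNNReal_le_iff_le_coe.2 hsI.2)]

end Split

section Control

variable {L : Fin 2 → Space n → Space n → ℝ≥0∞} {lam : ℝ} {g : Fin 2 → Space n → ℝ}
  {K Γ : Set (Space n)} {b : WithTop ℝ≥0} {x : Space n}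
  {η : SwitchPath → ℝ → Space n} {τ : SwitchPath → WithTop ℝ≥0}

theorem IsControl.eq_of_agree (hη : IsControl K Γ b x η τ) {ω ω' : SwitchPath} {h : ℝ≥0}
    (hω : ∀ r ≤ h, ω.1 r = ω'.1 r) {s : ℝ} (hs : 0 ≤ s) (hsh : s ≤ h) : η ω s = η ω' s := by
  lift s to ℝ≥0 using hs
  exact SwitchingControl.eq_of_agree (hη.nonanticipating s) fun r hr =>
    hω r (hr.trans (by exact_mod_cast hsh))

theorem IsControl.time_le_iff (hη : IsControl K Γ b x η τ) {ω ω' : SwitchPath} {h : ℝ≥0}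
    (hω : ∀ r ≤ h, ω.1 r = ω'.1 r) {r : ℝ≥0} (hr : r ≤ h) : τ ω ≤ r ↔ τ ω' ≤ r :=
  mem_iff_of_agree (hη.stoppingTime r) fun t ht => hω t (ht.trans hr)

/-- If `τ ω = r`, the event `{τ ≤ r}` belongs to the history at `r` and is shared by both paths;
exchanging their roles gives equality. -/
theorem IsControl.time_eq_of_agree (hη : IsControl K Γ b x η τ) {ω ω' : SwitchPath} {h : ℝ≥0}
    (hω : ∀ r ≤ h, ω.1 r = ω'.1 r) (hτ : τ ω ≤ h) : τ ω' = τ ω := by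
  obtain ⟨r, hr⟩ := WithTop.ne_top_iff_exists.1 (ne_top_of_le_ne_top WithTop.coe_ne_top hτ)
  rw [← hr] at hτ
  have hrh : r ≤ h := WithTop.coe_le_coe.1 hτ
  have h1 : τ ω' ≤ r := (hη.time_le_iff hω hrh).1 hr.ge
  obtain ⟨r', hr'⟩ := WithTop.ne_top_iff_exists.1 (ne_top_of_le_ne_top WithTop.coe_ne_top h1)
  rw [← hr'] at h1
  have h2 : r' ≤ r := WithTop.coe_le_coe.1 h1
  have h3 : τ ω ≤ r' := (hη.time_le_iff hω (h2.trans hrh)).2 hr'.ge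
  rw [← hr] at h3
  rw [← hr, ← hr', le_antisymm h2 (WithTop.coe_le_coe.1 h3)]

theorem IsControl.pathCost_eq_of_agree (hη : IsControl K Γ b x η τ) {ω ω' : SwitchPath} {h : ℝ≥0}
    (hω : ∀ r ≤ h, ω.1 r = ω'.1 r) (hτ : τ ω ≤ h) :
    pathCost L lam g η τ ω' = pathCost L lam g η τ ω := by
  have e := hη.time_eq_of_agree hω hτ
  obtain ⟨r, hr⟩ := WithTop.ne_top_iff_exists.1 (ne_top_of_le_ne_top WithTop.coe_ne_top hτ)
  have hrh : r ≤ h := by rw [← hr] at hτ; exact WithTop.coe_le_coe.1 hτ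
  have hω' : ∀ t ≤ r, ω.1 t = ω'.1 t := fun t ht => hω t (ht.trans hrh)
  rw [pathCost, pathCost, e, ← hr, upTo_coe,
    run_congr hω' fun s h0 h1 => hη.eq_of_agree hω' h0 h1]
  simp only [terminal]
  rw [hω' r le_rfl, hη.eq_of_agree hω' r.coe_nonneg le_rfl]

/-- The control from time `h` on, given the history up to time `h`. -/
theorem IsControl.conditioned (hη : IsControl K Γ b x η τ) {h : ℝ≥0} {ω₀ : SwitchPath}
    (hτ : (h : WithTop ℝ≥0) < τ ω₀) :
    IsControl K Γ (b - h) (η ω₀ h) (fun ω₁ s => η (concat h ω₀ ω₁) (h + s))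
      (fun ω₁ => τ (concat h ω₀ ω₁) - h) := by
  have hag : ∀ ω₁, ∀ r ≤ h, ω₀.1 r = (concat h ω₀ ω₁).1 r := fun ω₁ r hr =>
    (concat_of_le _ _ hr).symm
  have hτ' : ∀ ω₁, (h : WithTop ℝ≥0) ≤ τ (concat h ω₀ ω₁) := fun ω₁ =>
    le_of_lt (not_le.1 fun hc => not_le.2 hτ ((hη.time_le_iff (hag ω₁) le_rfl).2 hc))
  refine ⟨fun ω₁ => ?_, fun ω₁ t ht => ?_, fun ω₁ s hs => ?_, fun s => ?_, fun r => ?_, fun ω₁ => ?_,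
    fun ω₁ r hr => ?_⟩
  · rw [add_zero]
    exact (hη.eq_of_agree (hag ω₁) h.coe_nonneg le_rfl).symm
  · exact AbsolutelyContinuousOnInterval.comp_const_add h.coe_nonneg ht
      (hη.absolutelyContinuous _ _ (by positivity))
  · exact hη.mem _ _ (by positivity)
  · have := (hη.nonanticipating (h + s)).comp (measurable_concat_right_history h ω₀ s)
    simpa [Function.comp_def] using this
  · have := measurable_concat_right_history h ω₀ r (hη.stoppingTime (h + r))
    convert this using 1
    ext ω₁
    simp only [mem_ofPred_eq, mem_preimage]
    rw [tsub_le_iff_left, WithTop.coe_add]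
  · exact tsub_le_tsub_right (hη.le_horizon _) _
  · have e : τ (concat h ω₀ ω₁) = ((h + r : ℝ≥0) : WithTop ℝ≥0) := by
      rw [WithTop.coe_add, ← hr, add_tsub_cancel_of_le (hτ' ω₁)]
    rcases hη.exit _ _ e with h1 | h1
    · left
      rw [← h1, ← WithTop.coe_sub, add_tsub_cancel_left]
    · right
      simpa using h1

theorem IsControl.pathCost_concat (hη : IsControl K Γ b x η τ) {h : ℝ≥0} {ω₀ ω₁ : SwitchPath}
    (hτ : (h : WithTop ℝ≥0) < τ ω₀) (h01 : ω₁.1 0 = ω₀.1 h) :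
    pathCost L lam g η τ (concat h ω₀ ω₁) = ((run L lam η ω₀ (Ioc 0 h) : ℝ≥0∞) : EReal) +
      (Real.exp (-(lam * h)) : ℝ) * pathCost L lam g (fun ω₁ s => η (concat h ω₀ ω₁) (h + s))
        (fun ω₁ => τ (concat h ω₀ ω₁) - h) ω₁ := by
  have hag : ∀ r ≤ h, ω₀.1 r = (concat h ω₀ ω₁).1 r := fun r hr => (concat_of_le _ _ hr).symm
  have hτ' : (h : WithTop ℝ≥0) ≤ τ (concat h ω₀ ω₁) :=
    le_of_lt (not_le.1 fun hc => not_le.2 hτ ((hη.time_le_iff hag le_rfl).2 hc))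
  rw [pathCost_split (η' := fun ω₁ s => η (concat h ω₀ ω₁) (h + s))
    (τ' := fun ω₁ => τ (concat h ω₀ ω₁) - h) (ω' := ω₁) hτ' rfl
    (fun r => (concat_add h01 r).symm) (fun _ _ => rfl),
    run_congr hag fun s h0 h1 => hη.eq_of_agree hag h0 h1]

end Control

end

/-! ### Coercivity, the local data of a value function, and the cost given the history. -/

section
variable {n : ℕ}

/-! ### The supersolution inequality -/

theorem coe_le_coe_of_ofReal_le {c : ℝ} {X : ℝ≥0∞} (h : ENNReal.ofReal c ≤ X) :
    (c : EReal) ≤ (X : EReal) :=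
  le_trans (by rw [EReal.coe_ennreal_ofReal]; exact_mod_cast le_max_left c 0)
    (EReal.coe_ennreal_le_coe_ennreal_iff.2 h)

theorem run_mono {L : Fin 2 → Space n → Space n → ℝ≥0∞} {lam : ℝ}
    {η : SwitchPath → ℝ → Space n} {ω : SwitchPath} {A B : Set ℝ} (h : A ⊆ B) :
    run L lam η ω A ≤ run L lam η ω B :=
  lintegral_mono_set h

theorem exists_unit_direction (z : Space n) : ∃ e : Space n, ‖e‖ ≤ 1 ∧ inner ℝ e z = ‖z‖ := by
  by_cases hz : z = 0
  · exact ⟨0, by simp, by simp [hz]⟩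
  · have hz' : ‖z‖ ≠ 0 := norm_ne_zero_iff.2 hz
    refine ⟨‖z‖⁻¹ • z, ?_, ?_⟩
    · rw [norm_smul, norm_inv, norm_norm, inv_mul_cancel₀ hz']
    · rw [real_inner_smul_left, real_inner_self_eq_norm_sq]
      field_simp

/-- Coercivity: displacement is expensive. -/
theorem IsRunningCost.exists_run_ge {L : Fin 2 → Space n → Space n → ℝ≥0∞}
    {H : Fin 2 → Space n → Space n → ℝ} {lam : ℝ} (hL : IsRunningCost L H) (hlam : 0 ≤ lam)
    {R : ℝ} (hR : 0 ≤ R) :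
    ∃ C, 0 ≤ C ∧ ∀ (η : SwitchPath → ℝ → Space n) (ω : SwitchPath) (θ : ℝ), 0 ≤ θ →
      AbsolutelyContinuousOnInterval (η ω) 0 θ →
      ENNReal.ofReal (Real.exp (-(lam * θ)) * (R * ‖η ω θ - η ω 0‖ - C * θ)) ≤
        run L lam η ω (Ioc 0 θ) := by
  obtain ⟨C, hC⟩ := hL.bounded R
  refine ⟨max C 0, le_max_right _ _, fun η ω θ hθ hη => ?_⟩
  obtain ⟨e, he1, he2⟩ := exists_unit_direction (η ω θ - η ω 0)
  -- The covector has length at most `R` and is opposite to the displacement, so `-p · Δ` becomes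
  -- `R` times the length of `Δ`.
  have := hL.run_ge hlam ω hθ hη (-(R • e)) (m := max C 0) fun s _ => by
    refine (hC _ _ _ ?_).trans (le_max_left _ _)
    rw [norm_neg, norm_smul, Real.norm_of_nonneg hR]
    nlinarith
  rwa [inner_neg_left, real_inner_smul_left, he2, neg_neg] at this

/-- The values `w k y s` of the control problems with horizon `b - s`, near the point `x` and for
short times, with the bounds that the local analysis needs. -/
structure IsLocalValue (L : Fin 2 → Space n → Space n → ℝ≥0∞) (lam : ℝ)
    (g : Fin 2 → Space n → ℝ) (K Γ : Set (Space n)) (P : Fin 2 → Measure SwitchPath)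
    (b : WithTop ℝ≥0) (x : Space n) (s₀ : ℝ≥0) (w : Fin 2 → Space n → ℝ≥0 → ℝ) (A l : ℝ) :
    Prop where
  pos : 0 < s₀
  lt : (s₀ : WithTop ℝ≥0) < b
  mem : x ∈ K
  isClosed : IsClosed Γ
  value : ∀ k, ∀ y ∈ K, ∀ s ≤ s₀, valueFun L lam g K Γ (P k) (b - s) y = (w k y s : EReal)
  nonneg : 0 ≤ A ∧ 0 ≤ l
  lower : ∀ (y : Space n) (s : ℝ≥0) (η : SwitchPath → ℝ → Space n) (τ : SwitchPath → WithTop ℝ≥0),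
    s ≤ s₀ → IsControl K Γ (b - s) y η τ →
      ∀ ω, -((A + l * ‖y - x‖ : ℝ) : EReal) ≤ pathCost L lam g η τ ω
  continuousWithinAt : ∀ k,
    ContinuousWithinAt (fun z : Space n × ℝ≥0 => w k z.1 z.2) (K ×ˢ Iic s₀) (x, 0)
  exit_continuousWithinAt : ∀ k, x ∈ Γ → ContinuousWithinAt (g k) Γ x
  le_exit : ∀ k, x ∈ Γ → w k x 0 ≤ g k x

section Local

variable {L : Fin 2 → Space n → Space n → ℝ≥0∞} {H : Fin 2 → Space n → Space n → ℝ} {lam : ℝ}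
  {g : Fin 2 → Space n → ℝ} {K Γ : Set (Space n)} {P : Fin 2 → Measure SwitchPath}
  {b : WithTop ℝ≥0} {x : Space n} {s₀ : ℝ≥0} {w : Fin 2 → Space n → ℝ≥0 → ℝ} {A l : ℝ}
  {η : SwitchPath → ℝ → Space n} {τ : SwitchPath → WithTop ℝ≥0} {q : Fin 2 → ℝ}

theorem isControl_const {b : WithTop ℝ≥0} {y : Space n} {c : WithTop ℝ≥0} (hy : y ∈ K)
    (hcb : c ≤ b) (hc : c = b ∨ y ∈ Γ) :
    IsControl K Γ b y (fun _ _ => y) (fun _ => c) where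
  start _ := rfl
  absolutelyContinuous _ t _ :=
    (LipschitzWith.const y).lipschitzOnWith.absolutelyContinuousOnInterval
  mem _ _ _ := hy
  nonanticipating _ := measurable_const
  stoppingTime r := by simp
  le_horizon _ := hcb
  exit _ r hr := hc.imp (fun h => hr.symm.trans h) id

theorem IsLocalValue.le_w (hV : IsLocalValue L lam g K Γ P b x s₀ w A l)
    (hP : ∀ k, IsSwitchingLaw q k (P k)) (k : Fin 2) {y : Space n} (hy : y ∈ K) {s : ℝ≥0}
    (hs : s ≤ s₀) : -(A + l * ‖y - x‖) ≤ w k y s := by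
  have := (hP k).isProbabilityMeasure
  rw [← EReal.coe_le_coe_iff, ← hV.value k y hy s hs]
  refine le_iInf fun η => le_iInf fun τ => le_iInf fun hη => ?_
  refine coe_le_extIntegral (Eventually.of_forall fun ω => ?_)
  rw [EReal.coe_neg]
  exact hV.lower y s η τ hs hη ω

theorem IsLocalValue.le_g (hV : IsLocalValue L lam g K Γ P b x s₀ w A l) (k : Fin 2) {y : Space n}
    (hy : y ∈ K) (hyΓ : y ∈ Γ) : -(A + l * ‖y - x‖) ≤ g k y := by
  have h := hV.lower y 0 _ _ zero_le
    (isControl_const (c := ((0 : ℝ≥0) : WithTop ℝ≥0)) hy zero_le (Or.inr hyΓ)) (constPath k)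
  rw [← EReal.coe_le_coe_iff, EReal.coe_neg]
  refine h.trans (le_of_eq ?_)
  rw [pathCost, upTo_coe]
  simp [run, terminal, constPath]

/-- A trajectory that moves away from `x` within a short time has a high cost. -/
theorem IsLocalValue.far (hV : IsLocalValue L lam g K Γ P b x s₀ w A l) (hL : IsRunningCost L H)
    (hlam : 0 ≤ lam) (M : ℝ) {r : ℝ} (hr : 0 < r) :
    ∃ h₀ > 0, ∀ θ : ℝ≥0, (θ : ℝ) < h₀ → ∀ (b : WithTop ℝ≥0) (η : SwitchPath → ℝ → Space n)
      (τ : SwitchPath → WithTop ℝ≥0), IsControl K Γ b x η τ → ∀ (ω : SwitchPath) (s : ℝ≥0), s ≤ θ →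
      r ≤ ‖η ω s - x‖ → ∀ V : ℝ, -(A + l * ‖η ω θ - x‖) ≤ V →
      (M : EReal) ≤ ((run L lam η ω (Ioc 0 θ) : ℝ≥0∞) : EReal) +
        ((Real.exp (-(lam * θ)) * V : ℝ) : EReal) := by
  obtain ⟨hA, hl⟩ := hV.nonneg
  -- A quarter of `R` dominates the slope `l` of the lower bound, and over a displacement `r` it
  -- also pays for `|M| + A + 1`.
  set R : ℝ := 4 * (l + (|M| + A + 1) / r) with hRdef
  have hR : 0 ≤ R := by positivity
  obtain ⟨C, hC, hrun⟩ := hL.exists_run_ge hlam hR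
  -- Within this time the loss `C * θ` is below 1 and the discount factor is at least `1 / 2`.
  refine ⟨min (1 / (C + 1)) (Real.log 2 / (lam + 1)), lt_min (by positivity)
    (div_pos (Real.log_pos one_lt_two) (by positivity)), ?_⟩
  intro θ hθ b η τ hη ω s hs hsr V hV'
  have hθ1 := hθ.trans_le (min_le_left _ _)
  have hθ2 := hθ.trans_le (min_le_right _ _)
  rw [lt_div_iff₀ (by positivity)] at hθ1 hθ2
  have hθ0 : (0 : ℝ) ≤ θ := θ.coe_nonneg
  have hexp : ∀ t : ℝ≥0, t ≤ θ → 1 / 2 ≤ Real.exp (-(lam * t)) ∧ Real.exp (-(lam * t)) ≤ 1 := by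
    intro t ht
    have ht' : (t : ℝ) ≤ θ := by exact_mod_cast ht
    have ht0 : (0 : ℝ) ≤ t := t.coe_nonneg
    constructor
    · have : (1 / 2 : ℝ) = Real.exp (-Real.log 2) := by
        rw [Real.exp_neg, Real.exp_log two_pos, one_div]
      rw [this]
      refine Real.exp_le_exp.2 ?_
      nlinarith
    · refine Real.exp_le_one_iff.2 ?_
      nlinarith
  have hone : ∀ t : ℝ≥0, t ≤ θ →
      ENNReal.ofReal (R / 2 * ‖η ω t - x‖ - C * θ) ≤ run L lam η ω (Ioc 0 θ) := by
    intro t ht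
    have ht' : (t : ℝ) ≤ θ := by exact_mod_cast ht
    have ht0 : (0 : ℝ) ≤ t := t.coe_nonneg
    refine le_trans (ENNReal.ofReal_le_ofReal ?_) ((hrun η ω t ht0
      (hη.absolutelyContinuous ω t ht0)).trans (run_mono (Ioc_subset_Ioc_right ht')))
    rw [hη.start]
    obtain ⟨h1, h2⟩ := hexp t ht
    have h3 : R * ‖η ω t - x‖ * (1 / 2) ≤ R * ‖η ω t - x‖ * Real.exp (-(lam * t)) :=
      mul_le_mul_of_nonneg_left h1 (by positivity)
    have h4 : C * t * Real.exp (-(lam * t)) ≤ C * t * 1 :=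
      mul_le_mul_of_nonneg_left h2 (by positivity)
    have h5 : C * t ≤ C * θ := mul_le_mul_of_nonneg_left ht' hC
    nlinarith
  -- The estimate is used at whichever of the two times has the larger displacement; half of the
  -- maximum dominates a quarter of the sum.
  have key : ENNReal.ofReal (R / 4 * (‖η ω s - x‖ + ‖η ω θ - x‖) - C * θ) ≤
      run L lam η ω (Ioc 0 θ) := by
    rcases le_total ‖η ω s - x‖ ‖η ω θ - x‖ with h | h
    · refine (ENNReal.ofReal_le_ofReal ?_).trans (hone θ le_rfl)
      nlinarith
    · refine (ENNReal.ofReal_le_ofReal ?_).trans (hone s hs)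
      nlinarith
  refine le_trans ?_ (add_le_add_left (coe_le_coe_of_ofReal_le key) _)
  rw [← EReal.coe_add, EReal.coe_le_coe_iff]
  obtain ⟨h1, h2⟩ := hexp θ le_rfl
  set E := Real.exp (-(lam * θ))
  have hD : 0 ≤ ‖η ω θ - x‖ := norm_nonneg _
  have hEV : -(A + l * ‖η ω θ - x‖) ≤ E * V := by
    rcases le_total 0 V with hV0 | hV0
    · have : 0 ≤ E * V := by positivity
      have : 0 ≤ A + l * ‖η ω θ - x‖ := by positivity
      linarith
    · nlinarith
  have hRr : R / 4 * r = l * r + (|M| + A + 1) := by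
    rw [hRdef]; field_simp
  have hRl : l ≤ R / 4 := by
    have : 0 ≤ (|M| + A + 1) / r := by positivity
    rw [hRdef]; linarith
  have h3 : R / 4 * r ≤ R / 4 * ‖η ω s - x‖ := mul_le_mul_of_nonneg_left hsr (by positivity)
  have h4 : l * ‖η ω θ - x‖ ≤ R / 4 * ‖η ω θ - x‖ := mul_le_mul_of_nonneg_right hRl hD
  have h5 : 0 ≤ l * r := by positivity
  have h6 := le_abs_self M
  nlinarith

/-- What a trajectory costs given the history up to time `h`: it has either stopped at an exit
point or continues at least at the price of the value function. -/
theorem IsLocalValue.exists_stage (hV : IsLocalValue L lam g K Γ P b x s₀ w A l)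
    (hL : IsRunningCost L H) (hg : ∀ k, Measurable (g k)) (hP : ∀ k, IsSwitchingLaw q k (P k))
    (hη : IsControl K Γ b x η τ) {h : ℝ≥0} (hh : h ≤ s₀) (ω₀ : SwitchPath) :
    ∃ (θ : ℝ≥0) (V : ℝ), θ ≤ h ∧ -(A + l * ‖η ω₀ θ - x‖) ≤ V ∧
      ((run L lam η ω₀ (Ioc 0 θ) : ℝ≥0∞) : EReal) + ((Real.exp (-(lam * θ)) * V : ℝ) : EReal) ≤
        extIntegral (P (ω₀.1 h)) (fun ω₁ => pathCost L lam g η τ (concat h ω₀ ω₁)) ∧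
      ((θ = h ∧ (h : WithTop ℝ≥0) < τ ω₀ ∧ V = w (ω₀.1 h) (η ω₀ h) h) ∨
        (τ ω₀ = θ ∧ η ω₀ θ ∈ Γ ∧ V = g (ω₀.1 θ) (η ω₀ θ))) := by
  have := fun k => (hP k).isProbabilityMeasure
  rcases lt_or_ge (h : WithTop ℝ≥0) (τ ω₀) with hτ | hτ
  · refine ⟨h, w (ω₀.1 h) (η ω₀ h) h, le_rfl, hV.le_w hP _ (hη.mem _ _ h.coe_nonneg) hh, ?_,
      Or.inl ⟨rfl, hτ, rfl⟩⟩
    have hc := hη.conditioned hτ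
    have hcm := hc.measurable_pathCost (lam := lam) hL hg
    have hlow := hV.lower _ h _ _ hh hc
    have hn := hV.nonneg
    have e : extIntegral (P (ω₀.1 h)) (fun ω₁ => pathCost L lam g η τ (concat h ω₀ ω₁)) =
        extIntegral (P (ω₀.1 h)) (fun ω₁ => ((run L lam η ω₀ (Ioc 0 h) : ℝ≥0∞) : EReal) +
          (Real.exp (-(lam * h)) : ℝ) * pathCost L lam g (fun ω₁ s => η (concat h ω₀ ω₁) (h + s))
            (fun ω₁ => τ (concat h ω₀ ω₁) - h) ω₁) :=
      extIntegral_congr ((hP (ω₀.1 h)).start.mono fun ω₁ h01 => hη.pathCost_concat hτ h01)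
    have hn' : 0 ≤ A + l * ‖η ω₀ h - x‖ := by
      have := hn.1; have := hn.2; positivity
    rw [e, extIntegral_affine hcm hn' hlow (Real.exp_pos _).le]
    refine add_le_add_right ?_ _
    rw [EReal.coe_mul]
    refine mul_le_mul_of_nonneg_left ?_ (EReal.coe_nonneg.2 (Real.exp_pos _).le)
    rw [← hV.value _ _ (hη.mem _ _ h.coe_nonneg) _ hh]
    exact iInf_le_of_le _ (iInf_le_of_le _ (iInf_le _ hc))
  · obtain ⟨θ, hθ⟩ := WithTop.ne_top_iff_exists.1 (ne_top_of_le_ne_top WithTop.coe_ne_top hτ)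
    have hθh : θ ≤ h := by rw [← hθ] at hτ; exact WithTop.coe_le_coe.1 hτ
    have hΓ : η ω₀ θ ∈ Γ := by
      -- Since `θ ≤ h ≤ s₀ < b`, stopping at `θ` is not stopping at the horizon, so it takes place
      -- in `Γ`.
      rcases hη.exit ω₀ θ hθ.symm with h1 | h1
      · exact absurd h1 (ne_of_lt (lt_of_le_of_lt (WithTop.coe_le_coe.2 (hθh.trans hh)) hV.lt))
      · exact h1
    refine ⟨θ, g (ω₀.1 θ) (η ω₀ θ), hθh, hV.le_g _ (hη.mem _ _ θ.coe_nonneg) hΓ, ?_,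
      Or.inr ⟨hθ.symm, hΓ, rfl⟩⟩
    have e : ∀ ω₁, pathCost L lam g η τ (concat h ω₀ ω₁) = pathCost L lam g η τ ω₀ := fun ω₁ =>
      hη.pathCost_eq_of_agree (fun r hr => (concat_of_le _ _ hr).symm) hτ
    have e2 : pathCost L lam g η τ ω₀ = ((run L lam η ω₀ (Ioc 0 θ) : ℝ≥0∞) : EReal) +
        ((Real.exp (-(lam * θ)) * g (ω₀.1 θ) (η ω₀ θ) : ℝ) : EReal) := by
      rw [pathCost, ← hθ, upTo_coe]; rfl
    simp_rw [e]
    rw [← e2]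
    have hb : -((A : ℝ) : EReal) ≤ pathCost L lam g η τ ω₀ := by
      have := hV.lower x 0 η τ zero_le (by simpa using hη) ω₀
      simpa using this
    induction hF : pathCost L lam g η τ ω₀ with
    | bot => simp
    | top => rw [extIntegral]; simp
    | coe r => rw [extIntegral_const]

end Local

end

/-! ### First-order asymptotics in `h` and the supersolution inequality. -/

section
variable {n : ℕ}

/-! ### Short-time asymptotics -/

theorem exists_discount_le {lam M c : ℝ} (hMc : M < c) :
    ∃ h₀ > 0, ∀ θ : ℝ, 0 ≤ θ → θ < h₀ → ∀ V, c ≤ V → M ≤ Real.exp (-(lam * θ)) * V := by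
  have hc : ContinuousAt (fun θ : ℝ => Real.exp (-(lam * θ)) * c) 0 := by fun_prop
  have h1 : ∀ᶠ θ in 𝓝 (0 : ℝ), M < Real.exp (-(lam * θ)) * c :=
    hc.eventually_const_lt (by simpa using hMc)
  obtain ⟨h₀, hh₀, H⟩ := Metric.eventually_nhds_iff.1 h1
  refine ⟨h₀, hh₀, fun θ h0 h1 V hV => ?_⟩
  have := H (y := θ) (by rw [Real.dist_eq, sub_zero, abs_of_nonneg h0]; exact h1)
  exact this.le.trans (mul_le_mul_of_nonneg_left hV (Real.exp_pos _).le)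

/-- The right side is `W + h * (B - lam * W + q * (S - W)) + o(h)`. Here `π h` is the probability of
leaving the initial state and `d h` that of also returning; `h ^ 2` is the tolerance of a nearly
optimal control. The subsolution proof uses it with the signs of `W`, `B` and `S` reversed. -/
theorem eventually_gain {lam W B q S A C : ℝ} {π d : ℝ → ℝ}
    (hπ : Tendsto (fun h => π h / h) (𝓝[>] 0) (𝓝 q)) (hd : ∀ h > 0, |d h| ≤ C * h ^ 2)
    (hpos : 0 < B - lam * W + q * (S - W)) :
    ∀ᶠ h in 𝓝[>] (0 : ℝ), W + h ^ 2 < Real.exp (-(lam * h)) * (W + h * B) +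
      π h * (S - Real.exp (-(lam * h)) * (W + h * B)) - d h * (A + S) := by
  have hid : Tendsto (fun h : ℝ => h) (𝓝[>] 0) (𝓝 0) := tendsto_nhdsWithin_of_tendsto_nhds tendsto_id
  have hN : HasDerivAt (fun h : ℝ => Real.exp (-(lam * h)) * (W + h * B)) (B - lam * W) 0 := by
    have h1 : HasDerivAt (fun h : ℝ => Real.exp (-(lam * h))) (-lam) 0 := by
      simpa using ((hasDerivAt_id (0 : ℝ)).const_mul lam).neg.exp
    have h2 : HasDerivAt (fun h : ℝ => W + h * B) B 0 := by
      simpa using ((hasDerivAt_id (0 : ℝ)).mul_const B).const_add W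
    exact (h1.mul h2).congr_deriv (by simp; ring)
  have hN1 : Tendsto (fun h : ℝ => (Real.exp (-(lam * h)) * (W + h * B) - W) / h) (𝓝[>] 0)
      (𝓝 (B - lam * W)) := by
    have := hN.tendsto_slope_zero_right
    refine this.congr fun h => ?_
    simp [div_eq_inv_mul]
  have hN2 : Tendsto (fun h : ℝ => Real.exp (-(lam * h)) * (W + h * B)) (𝓝[>] 0) (𝓝 W) := by
    have := hN.continuousAt.tendsto.mono_left (nhdsWithin_le_nhds (s := Ioi 0))
    simpa using this
  have hd1 : Tendsto (fun h => d h / h) (𝓝[>] 0) (𝓝 0) := by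
    have h0 : Tendsto (fun h : ℝ => C * h) (𝓝[>] 0) (𝓝 0) := by simpa using hid.const_mul C
    refine squeeze_zero_norm' ?_ h0
    filter_upwards [self_mem_nhdsWithin] with h hh
    have hh' : 0 < h := hh
    rw [Real.norm_eq_abs, abs_div, abs_of_pos hh', div_le_iff₀ hh']
    have := hd h hh
    nlinarith
  have key := ((hN1.add (hπ.mul (hN2.const_sub S))).sub (hd1.mul_const (A + S))).sub hid
  have hev := key.eventually_const_lt (u := 0) (by linarith)
  filter_upwards [hev, self_mem_nhdsWithin] with h hh h0
  have h0' : 0 < h := h0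
  have e : (Real.exp (-(lam * h)) * (W + h * B) - W) / h +
      π h / h * (S - Real.exp (-(lam * h)) * (W + h * B)) - d h / h * (A + S) - h =
      (Real.exp (-(lam * h)) * (W + h * B) +
      π h * (S - Real.exp (-(lam * h)) * (W + h * B)) - d h * (A + S) - (W + h ^ 2)) / h := by
    field_simp; ring
  rw [e] at hh
  have := (div_pos_iff_of_pos_right h0').1 hh
  linarith

/-- Leaving `i` by time `h` is implied by being in `j` at time `h`, and has probability at most `q i
* h`; both bounds have slope `q i`. -/
theorem IsSwitchingLaw.tendsto_jump {q : Fin 2 → ℝ} {i j : Fin 2} {μ : Measure SwitchPath}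
    (hμ : IsSwitchingLaw q i μ) (hq : ∀ k, 0 < q k) (hji : j ≠ i) :
    Tendsto (fun h : ℝ => μ.real (stay i h.toNNReal)ᶜ / h) (𝓝[>] 0) (𝓝 (q i)) := by
  have := hμ.isProbabilityMeasure
  have h1 : Tendsto (fun h : ℝ => leaveProb q i h / h) (𝓝[>] 0) (𝓝 (q i)) := by
    have hd := hasDerivAt_leaveProb hq hji 0
    have := hd.tendsto_slope_zero_right
    simp only [zero_add, leaveProb_zero, sub_zero, mul_one, mul_zero] at this
    exact this.congr fun h => by simp [div_eq_inv_mul]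
  refine tendsto_of_tendsto_of_tendsto_of_le_of_le' h1 tendsto_const_nhds ?_ ?_
  · filter_upwards [self_mem_nhdsWithin] with h hh
    have hh' : 0 < h := hh
    refine (div_le_div_iff_of_pos_right hh').2 ?_
    have e := hμ.real_leave hq 0 h.toNNReal hji (measurableSet_coord_eq_history le_rfl i)
      fun ω hω => hω
    have e1 : μ.real {ω | ω.1 0 = i} = 1 := by
      rw [measureReal_def, (prob_compl_eq_zero_iff (measurableSet_coord_eq 0 i)).1 hμ.start,
        ENNReal.toReal_one]
    rw [e1, one_mul, Real.coe_toNNReal _ hh'.le, zero_add] at e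
    rw [← e]
    exact measureReal_mono fun ω hω hs => hji (hω.2.symm.trans (hs _ le_rfl))
  · filter_upwards [self_mem_nhdsWithin] with h hh
    have hh' : 0 < h := hh
    rw [div_le_iff₀ hh']
    have := hμ.measure_stay_compl hq h.toNNReal
    rw [Real.coe_toNNReal _ hh'.le] at this
    exact ENNReal.toReal_le_of_le_ofReal (mul_nonneg (hq i).le hh'.le) this

/-! ### The supersolution inequality -/

section Super

variable {L : Fin 2 → Space n → Space n → ℝ≥0∞} {H : Fin 2 → Space n → Space n → ℝ} {lam : ℝ}
  {g : Fin 2 → Space n → ℝ} {K Γ : Set (Space n)} {P : Fin 2 → Measure SwitchPath}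
  {b : WithTop ℝ≥0} {x : Space n} {s₀ : ℝ≥0} {w : Fin 2 → Space n → ℝ≥0 → ℝ} {A l : ℝ}
  {η : SwitchPath → ℝ → Space n} {τ : SwitchPath → WithTop ℝ≥0} {q : Fin 2 → ℝ}

theorem coe_le_run_add {R : ℝ≥0∞} {M c : ℝ} (h : M ≤ c) :
    (M : EReal) ≤ (R : EReal) + (c : EReal) := by
  refine (EReal.coe_le_coe_iff.2 h).trans ?_
  calc (c : EReal) = 0 + c := (zero_add _).symm
    _ ≤ _ := add_le_add_left (EReal.coe_ennreal_nonneg R) _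

/-- A trajectory that stops after a short time costs nearly at least the exit cost at `x`. -/
theorem IsLocalValue.exit_ge (hV : IsLocalValue L lam g K Γ P b x s₀ w A l)
    (hL : IsRunningCost L H) (hlam : 0 ≤ lam) (k : Fin 2) {M : ℝ} (hM : x ∈ Γ → M < g k x) :
    ∃ h₀ > 0, ∀ θ : ℝ≥0, (θ : ℝ) < h₀ → ∀ (b : WithTop ℝ≥0) (η : SwitchPath → ℝ → Space n)
      (τ : SwitchPath → WithTop ℝ≥0), IsControl K Γ b x η τ → ∀ ω, η ω θ ∈ Γ →
      (M : EReal) ≤ ((run L lam η ω (Ioc 0 θ) : ℝ≥0∞) : EReal) +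
        ((Real.exp (-(lam * θ)) * g k (η ω θ) : ℝ) : EReal) := by
  -- If `x ∉ Γ`, closedness of `Γ` makes the condition near `x` void, and any `c > M` serves.
  have hnear : ∃ r > 0, ∃ c, M < c ∧ ∀ y ∈ Γ, ‖y - x‖ < r → c ≤ g k y := by
    by_cases hx : x ∈ Γ
    · obtain ⟨c, hc1, hc2⟩ := exists_between (hM hx)
      have h1 := (hV.exit_continuousWithinAt k hx).eventually_const_lt hc2
      obtain ⟨r, hr, h2⟩ := Metric.mem_nhdsWithin_iff.1 h1
      exact ⟨r, hr, c, hc1, fun y hy hyr => (h2 ⟨by rwa [Metric.mem_ball, dist_eq_norm], hy⟩ : c < g k y).le⟩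
    · obtain ⟨r, hr, h2⟩ := Metric.isOpen_iff.1 hV.isClosed.isOpen_compl x hx
      exact ⟨r, hr, M + 1, by linarith, fun y hy hyr =>
        absurd hy (h2 (by rwa [Metric.mem_ball, dist_eq_norm]))⟩
  obtain ⟨r, hr, c, hMc, hc⟩ := hnear
  obtain ⟨h1, hh1, H1⟩ := hV.far hL hlam M hr
  obtain ⟨h2, hh2, H2⟩ := exists_discount_le (lam := lam) hMc
  refine ⟨min h1 h2, lt_min hh1 hh2, fun θ hθ b η τ hη ω hΓ => ?_⟩
  rcases le_or_gt r ‖η ω θ - x‖ with h | h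
  · exact H1 θ (hθ.trans_le (min_le_left _ _)) b η τ hη ω θ le_rfl h _
      (hV.le_g k (hη.mem _ _ θ.coe_nonneg) hΓ)
  · exact coe_le_run_add (H2 θ θ.coe_nonneg (hθ.trans_le (min_le_right _ _)) _ (hc _ hΓ h))

/-- A trajectory that continues after a short time costs nearly at least the value at `x`. -/
theorem IsLocalValue.continue_ge (hV : IsLocalValue L lam g K Γ P b x s₀ w A l)
    (hL : IsRunningCost L H) (hlam : 0 ≤ lam) (hP : ∀ k, IsSwitchingLaw q k (P k)) (k : Fin 2)
    {M : ℝ} (hM : M < w k x 0) :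
    ∃ h₀ > 0, ∀ θ : ℝ≥0, (θ : ℝ) < h₀ → θ ≤ s₀ → ∀ (b : WithTop ℝ≥0)
      (η : SwitchPath → ℝ → Space n) (τ : SwitchPath → WithTop ℝ≥0), IsControl K Γ b x η τ → ∀ ω,
      (M : EReal) ≤ ((run L lam η ω (Ioc 0 θ) : ℝ≥0∞) : EReal) +
        ((Real.exp (-(lam * θ)) * w k (η ω θ) θ : ℝ) : EReal) := by
  obtain ⟨c, hMc, hc⟩ := exists_between hM
  have h1 := (hV.continuousWithinAt k).eventually_const_lt hc
  obtain ⟨r, hr, hball⟩ := Metric.mem_nhdsWithin_iff.1 h1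
  obtain ⟨h1, hh1, H1⟩ := hV.far hL hlam M hr
  obtain ⟨h2, hh2, H2⟩ := exists_discount_le (lam := lam) hMc
  refine ⟨min r (min h1 h2), lt_min hr (lt_min hh1 hh2), fun θ hθ hs b η τ hη ω => ?_⟩
  simp only [lt_min_iff] at hθ
  have hK := hη.mem ω _ θ.coe_nonneg
  rcases le_or_gt r ‖η ω θ - x‖ with h | h
  · exact H1 θ hθ.2.1 b η τ hη ω θ le_rfl h _ (hV.le_w hP k hK hs)
  · refine coe_le_run_add (H2 θ θ.coe_nonneg hθ.2.2 _ (le_of_lt ?_))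
    have hm : ((η ω θ, θ) : Space n × ℝ≥0) ∈ Metric.ball (x, 0) r ∩ K ×ˢ Iic s₀ := by
      refine ⟨?_, hK, hs⟩
      rw [Metric.mem_ball, Prod.dist_eq, max_lt_iff, dist_eq_norm]
      exact ⟨h, by simpa [NNReal.dist_eq] using hθ.1⟩
    exact hball hm

/-- A trajectory that stays near `x` and does not switch satisfies the dynamic inequality. -/
theorem IsRunningCost.stay_ge (hL : IsRunningCost L H) (hlam : 0 ≤ lam) (i : Fin 2) {p : Space n} {a : ℝ}
    (hlow : ∀ σ > 0, ∃ r > 0, ∀ y ∈ K, ∀ s : ℝ≥0, s ≤ s₀ → ‖y - x‖ < r → (s : ℝ) < r →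
      w i x 0 + inner ℝ p (y - x) + a * s - σ * (‖y - x‖ + s) ≤ w i y s) {δ : ℝ} (hδ : 0 < δ) :
    ∃ r > 0, ∀ h : ℝ≥0, (h : ℝ) < r → h ≤ s₀ → ∀ (b : WithTop ℝ≥0)
      (η : SwitchPath → ℝ → Space n) (τ : SwitchPath → WithTop ℝ≥0), IsControl K Γ b x η τ →
      ∀ ω ∈ stay i h, (∀ s : ℝ≥0, s ≤ h → ‖η ω s - x‖ < r) →
      ((Real.exp (-(lam * h)) * (w i x 0 + h * (a - H i x p - 2 * δ)) : ℝ) : EReal) ≤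
        ((run L lam η ω (Ioc 0 h) : ℝ≥0∞) : EReal) +
        ((Real.exp (-(lam * h)) * w i (η ω h) h : ℝ) : EReal) := by
  have hH : ∀ᶠ z in 𝓝 (x, p), H i z.1 z.2 < H i x p + δ :=
    (hL.continuous i).continuousAt.eventually_lt_const (by simpa using hδ)
  obtain ⟨ρ, hρ, hH⟩ := Metric.eventually_nhds_iff.1 hH
  -- This `σ` is at once the error allowed in the contact inequality and the size of a tilt of `p`;
  -- `ρ / 2` keeps the tilted covector where `H` is within `δ` of `H i x p`.
  obtain ⟨r, hr, hlow⟩ := hlow (min δ (ρ / 2)) (lt_min hδ (by positivity))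
  set σ := min δ (ρ / 2) with hσ
  have hσ0 : 0 < σ := lt_min hδ (by positivity)
  refine ⟨min r ρ, lt_min hr hρ, fun h hh hs b η τ hη ω hω hnear => ?_⟩
  obtain ⟨e, he1, he2⟩ := exists_unit_direction (η ω h - η ω 0)
  -- Tilting `p` by `-σ • e` yields an additional `σ * ‖Δ‖`, which cancels the error proportional to
  -- the displacement in the contact inequality, however fast the curve moves.
  have h1 := hL.run_ge hlam ω h.coe_nonneg (hη.absolutelyContinuous ω h h.coe_nonneg) (p - σ • e)
    (m := H i x p + δ) fun s hs => by
      have hsh : s.toNNReal ≤ h := Real.toNNReal_le_iff_le_coe.2 hs.2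
      rw [hω _ hsh]
      refine (hH (y := (η ω s, p - σ • e)) ?_).le
      have h2 := hnear s.toNNReal hsh
      rw [Real.coe_toNNReal _ hs.1.le] at h2
      rw [Prod.dist_eq, max_lt_iff, dist_eq_norm, dist_eq_norm]
      refine ⟨h2.trans_le (min_le_right _ _), ?_⟩
      simp only [sub_sub_cancel_left, norm_neg, norm_smul, Real.norm_of_nonneg hσ0.le]
      have : σ ≤ ρ / 2 := min_le_right _ _
      nlinarith
  have h2 := hlow (η ω h) (hη.mem _ _ h.coe_nonneg) h hs
    ((hnear h le_rfl).trans_le (min_le_left _ _)) (hh.trans_le (min_le_left _ _))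
  refine le_trans ?_ (add_le_add_left (coe_le_coe_of_ofReal_le h1) _)
  rw [← EReal.coe_add, EReal.coe_le_coe_iff, ← mul_add]
  refine mul_le_mul_of_nonneg_left ?_ (Real.exp_pos _).le
  rw [inner_sub_left, real_inner_smul_left, he2, hη.start]
  have h3 : σ ≤ δ := min_le_left _ _
  have h4 : σ * h ≤ δ * h := mul_le_mul_of_nonneg_right h3 h.coe_nonneg
  linarith

theorem integral_of_stages {μ : Measure SwitchPath} [IsProbabilityMeasure μ] {U D : Set SwitchPath}
    (hU : MeasurableSet U) (hD : MeasurableSet D) (m₀ m₁ m₂ : ℝ) :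
    Integrable (fun ω => m₀ + U.indicator (fun _ => m₁) ω + D.indicator (fun _ => m₂) ω) μ ∧
      ∫ ω, m₀ + U.indicator (fun _ => m₁) ω + D.indicator (fun _ => m₂) ω ∂μ =
        m₀ + μ.real U * m₁ + μ.real D * m₂ := by
  have h1 : Integrable (U.indicator fun _ => m₁) μ := (integrable_const m₁).indicator hU
  have h2 : Integrable (D.indicator fun _ => m₂) μ := (integrable_const m₂).indicator hD
  have h3 : Integrable (fun ω => m₀ + U.indicator (fun _ => m₁) ω) μ := (integrable_const m₀).add h1
  refine ⟨h3.add h2, ?_⟩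
  rw [integral_add h3 h2, integral_add (integrable_const m₀) h1, integral_indicator_const _ hU,
    integral_indicator_const _ hD]
  simp

/-- The trajectories that are nearly optimal for a short time `h` stay near `x` and do not stop. -/
theorem IsLocalValue.near_of_stay (hV : IsLocalValue L lam g K Γ P b x s₀ w A l)
    (hL : IsRunningCost L H) (hlam : 0 ≤ lam) (hg : ∀ k, Measurable (g k))
    (hP : ∀ k, IsSwitchingLaw q k (P k)) (hq : ∀ k, 0 < q k) {i : Fin 2}
    (hexit : x ∈ Γ → w i x 0 < g i x) {r : ℝ} (hr : 0 < r) :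
    ∃ h₀ > 0, ∀ h : ℝ≥0, (h : ℝ) < h₀ → h ≤ s₀ → ∀ (η : SwitchPath → ℝ → Space n)
      (τ : SwitchPath → WithTop ℝ≥0), IsControl K Γ b x η τ →
      extIntegral (P i) (pathCost L lam g η τ) ≤ ((w i x 0 + (h : ℝ) ^ 2 : ℝ) : EReal) →
      ∀ ω ∈ stay i h, (h : WithTop ℝ≥0) < τ ω ∧ ∀ s : ℝ≥0, s ≤ h → ‖η ω s - x‖ < r := by
  have := (hP i).isProbabilityMeasure
  obtain ⟨M, hWM, hM⟩ : ∃ M, w i x 0 < M ∧ (x ∈ Γ → M < g i x) := by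
    by_cases hx : x ∈ Γ
    · obtain ⟨M, h1, h2⟩ := exists_between (hexit hx)
      exact ⟨M, h1, fun _ => h2⟩
    · exact ⟨w i x 0 + 1, by linarith, fun h => absurd h hx⟩
  obtain ⟨h1, hh1, H1⟩ := hV.far hL hlam M hr
  obtain ⟨h2, hh2, H2⟩ := hV.exit_ge hL hlam i hM
  have hn := hV.nonneg
  have hsmall : ∀ᶠ h in 𝓝 (0 : ℝ), w i x 0 + h ^ 2 < M - q i * h * |M + A| := by
    have c1 : ContinuousAt (fun h : ℝ => w i x 0 + h ^ 2) 0 := by fun_prop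
    have c2 : ContinuousAt (fun h : ℝ => M - q i * h * |M + A|) 0 := by fun_prop
    exact c1.tendsto.eventually_lt c2.tendsto (by simpa using hWM)
  obtain ⟨h3, hh3, H3⟩ := Metric.eventually_nhds_iff.1 hsmall
  refine ⟨min h1 (min h2 h3), lt_min hh1 (lt_min hh2 hh3), fun h hh hs η τ hη hcost ω hω => ?_⟩
  simp only [lt_min_iff] at hh
  by_contra hcon
  -- All paths in `stay i h` agree up to `h`, so one bad path makes all of them bad. The cost is
  -- then at least `M > w i x 0` with probability `1 - O(h)`, against near optimality.
  have hbad : ∀ ω' ∈ stay i h, (M : EReal) ≤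
      extIntegral (P (ω'.1 h)) (fun ω₁ => pathCost L lam g η τ (concat h ω' ω₁)) := by
    intro ω' hω'
    have hag : ∀ r ≤ h, ω.1 r = ω'.1 r := fun r hr => (hω r hr).trans (hω' r hr).symm
    obtain ⟨θ, V, hθ, hVlow, hle, hcase⟩ := hV.exists_stage hL hg hP hη hs ω'
    refine le_trans ?_ hle
    have hθ' : (θ : ℝ) ≤ h := by exact_mod_cast hθ
    rcases hcase with ⟨rfl, hτ, hVeq⟩ | ⟨hτ, hΓ, hVeq⟩
    · have hτω : (θ : WithTop ℝ≥0) < τ ω :=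
        not_le.1 fun hc => not_le.2 hτ ((hη.time_le_iff hag le_rfl).1 hc)
      have : ∃ s : ℝ≥0, s ≤ θ ∧ r ≤ ‖η ω s - x‖ := by
        by_contra hno
        push Not at hno
        exact hcon ⟨hτω, hno⟩
      obtain ⟨s, hsθ, hsr⟩ := this
      rw [hη.eq_of_agree hag s.coe_nonneg (by exact_mod_cast hsθ)] at hsr
      exact H1 θ hh.1 b η τ hη ω' s hsθ hsr V hVlow
    · rw [hVeq, hω' θ hθ]
      exact H2 θ (hθ'.trans_lt hh.2.1) b η τ hη ω' hΓ
  obtain ⟨hmi, hint⟩ := integral_of_stages (μ := P i) (U := (stay i h)ᶜ) (D := ∅)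
    (history_le h _ (measurableSet_stay i h)).compl MeasurableSet.empty M (-A - M) 0
  have hlow : ∀ ω', -(A : EReal) ≤ pathCost L lam g η τ ω' := fun ω' => by
    have := hV.lower x 0 η τ zero_le (by simpa using hη) ω'
    simpa using this
  have key := le_extIntegral_of_concat hP (hP i) hq h (hη.measurable_pathCost hL hg) hn.1 hlow hmi
    (Eventually.of_forall fun ω' => by
      by_cases hω' : ω' ∈ stay i h
      · simpa [hω'] using hbad ω' hω'
      · have := (hP (ω'.1 h)).isProbabilityMeasure
        refine coe_le_extIntegral (Eventually.of_forall fun ω₁ => ?_)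
        simpa [hω'] using hlow _)
  rw [hint] at key
  have h4 := EReal.coe_le_coe_iff.1 (key.trans hcost)
  have h5 := H3 (y := (h : ℝ)) (by
    rw [Real.dist_eq, sub_zero, abs_of_nonneg h.coe_nonneg]; exact hh.2.2)
  have h6 : (P i).real (stay i h)ᶜ ≤ q i * h :=
    ENNReal.toReal_le_of_le_ofReal (mul_nonneg (hq i).le h.coe_nonneg)
      ((hP i).measure_stay_compl hq h)
  have h7 : (P i).real (stay i h)ᶜ * (M + A) ≤ q i * h * |M + A| :=
    (mul_le_mul_of_nonneg_left (le_abs_self _) measureReal_nonneg).trans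
      (mul_le_mul_of_nonneg_right h6 (abs_nonneg _))
  simp at h4
  linarith

/-- If both alternatives failed, an `h²`-optimal control would have cost at least `N` without a
switch, at least `Wj - δ` after one switch, and at least `-A` after a return to `i`. By
`eventually_gain` the expectation then exceeds `W + h²` for small `h`. -/
theorem IsLocalValue.super (hV : IsLocalValue L lam g K Γ P b x s₀ w A l)
    (hL : IsRunningCost L H) (hlam : 0 ≤ lam) (hg : ∀ k, Measurable (g k))
    (hP : ∀ k, IsSwitchingLaw q k (P k)) (hq : ∀ k, 0 < q k) {i j : Fin 2} (hji : j ≠ i)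
    {p : Space n} {a : ℝ}
    (hlow : ∀ σ > 0, ∃ r > 0, ∀ y ∈ K, ∀ s : ℝ≥0, s ≤ s₀ → ‖y - x‖ < r → (s : ℝ) < r →
      w i x 0 + inner ℝ p (y - x) + a * s - σ * (‖y - x‖ + s) ≤ w i y s) :
    0 ≤ -a + H i x p + lam * w i x 0 + q i * (w i x 0 - w j x 0) ∨ (x ∈ Γ ∧ g i x ≤ w i x 0) := by
  have hprob := fun k => (hP k).isProbabilityMeasure
  by_contra hcon
  rw [not_or] at hcon
  obtain ⟨hneg, hexit⟩ := hcon
  push Not at hneg hexit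
  set W := w i x 0 with hW
  set Wj := w j x 0 with hWj
  set G := -(-a + H i x p + lam * W + q i * (W - Wj)) with hG
  have hqi := hq i
  -- The losses are `2 * δ` while staying and `q i * δ` through the switch, together half of the gap
  -- `G`.
  set δ := G / (2 * (2 + q i)) with hδdef
  have hδ : 0 < δ := by have : 0 < G := by linarith
                        positivity
  have hδG : δ * (2 * (2 + q i)) = G := by rw [hδdef]; field_simp
  obtain ⟨r, hr, Hstay⟩ := hL.stay_ge hlam i hlow hδ
  obtain ⟨h1, hh1, Hnear⟩ := hV.near_of_stay hL hlam hg hP hq hexit hr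
  obtain ⟨h2, hh2, Hexit⟩ := hV.exit_ge hL hlam j (M := Wj - δ) fun hx => by
    have := hV.le_exit j hx; linarith
  obtain ⟨h3, hh3, Hcont⟩ := hV.continue_ge hL hlam hP j (M := Wj - δ) (by linarith)
  have hn := hV.nonneg
  -- A measurable hull replaces `comeBack`, whose measurability is not established; the bound on its
  -- measure is unaffected.
  set D : ℝ → Set SwitchPath := fun h =>
    toMeasurable (P i) (comeBack i h.toNNReal) ∩ (stay i h.toNNReal)ᶜ with hD
  have hDm : ∀ h, MeasurableSet (D h) := fun h =>
    (measurableSet_toMeasurable _ _).inter (history_le _ _ (measurableSet_stay i _)).compl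
  have hDb : ∀ h > 0, |(P i).real (D h)| ≤ q i * q j * h ^ 2 := by
    intro h hh
    rw [abs_of_nonneg measureReal_nonneg]
    have hj := hq j
    refine ENNReal.toReal_le_of_le_ofReal (by positivity) ?_
    refine (measure_mono inter_subset_left).trans ?_
    rw [measure_toMeasurable]
    have := (hP i).measure_comeBack hP hq hji h.toNNReal
    rwa [Real.coe_toNNReal _ hh.le] at this
  have hgain := eventually_gain (lam := lam) (W := W) (B := a - H i x p - 2 * δ) (S := Wj - δ)
    (A := A) ((hP i).tendsto_jump hq hji) hDb (by nlinarith)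
  have hs₀ : (0 : ℝ) < s₀ := hV.pos
  have hsmall : ∀ᶠ h in 𝓝[>] (0 : ℝ), h < min r (min h1 (min h2 (min h3 s₀))) :=
    nhdsWithin_le_nhds (Iio_mem_nhds (lt_min hr (lt_min hh1 (lt_min hh2 (lt_min hh3 hs₀)))))
  obtain ⟨h, hgain, hsmall, hpos⟩ := (hgain.and (hsmall.and self_mem_nhdsWithin)).exists
  replace hpos : 0 < h := hpos
  lift h to ℝ≥0 using hpos.le
  simp only [lt_min_iff, Real.toNNReal_coe] at hsmall hgain
  obtain ⟨hr', hh1', hh2', hh3', hs₀'⟩ := hsmall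
  have hs : h ≤ s₀ := le_of_lt (by exact_mod_cast hs₀')
  have hval : valueFun L lam g K Γ (P i) b x = (W : EReal) := by
    have := hV.value i x hV.mem 0 zero_le
    simpa using this
  obtain ⟨η, τ, hη, hcost⟩ : ∃ η τ, IsControl K Γ b x η τ ∧
      extIntegral (P i) (pathCost L lam g η τ) ≤ ((W + (h : ℝ) ^ 2 : ℝ) : EReal) := by
    have hlt : valueFun L lam g K Γ (P i) b x < ((W + (h : ℝ) ^ 2 : ℝ) : EReal) := by
      rw [hval, EReal.coe_lt_coe_iff]
      have : 0 < (h : ℝ) ^ 2 := by positivity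
      linarith
    simp only [valueFun, iInf_lt_iff] at hlt
    obtain ⟨η, τ, hη, hlt⟩ := hlt
    exact ⟨η, τ, hη, hlt.le⟩
  have hnear := Hnear h hh1' hs η τ hη hcost
  have hlowη : ∀ ω', -(A : EReal) ≤ pathCost L lam g η τ ω' := fun ω' => by
    have := hV.lower x 0 η τ zero_le (by simpa using hη) ω'
    simpa using this
  set N := Real.exp (-(lam * h)) * (W + h * (a - H i x p - 2 * δ)) with hN
  -- The indicators encode the three lower bounds: `N` on `stay i h`, `Wj - δ` after leaving, and
  -- `-A` on `D h`.
  obtain ⟨hmi, hint⟩ := integral_of_stages (μ := P i) (U := (stay i h)ᶜ) (D := D h)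
    (history_le h _ (measurableSet_stay i h)).compl (hDm h) N (Wj - δ - N) (-A - (Wj - δ))
  have key := le_extIntegral_of_concat hP (hP i) hq h (hη.measurable_pathCost hL hg) hn.1 hlowη hmi
    (Eventually.of_forall fun ω => by
      by_cases hω : ω ∈ stay i h
      · have hωD : ω ∉ D h := fun hd => by simpa [hω] using hd.2
        obtain ⟨θ, V, hθ, hVlow, hle, hcase⟩ := hV.exists_stage hL hg hP hη hs ω
        simp only [hω, hωD, mem_compl_iff, not_true_eq_false, not_false_eq_true,
          indicator_of_notMem, add_zero]
        refine le_trans ?_ hle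
        rcases hcase with ⟨rfl, hτ, hVeq⟩ | ⟨hτ, hΓ, hVeq⟩
        · rw [hVeq, hω θ le_rfl]
          exact Hstay θ hr' hs b η τ hη ω hω (hnear ω hω).2
        · have := (hnear ω hω).1
          rw [hτ] at this
          exact absurd (WithTop.coe_le_coe.2 hθ) (not_le.2 this)
      · by_cases hωD : ω ∈ D h
        · have := (hP (ω.1 h)).isProbabilityMeasure
          refine coe_le_extIntegral (Eventually.of_forall fun ω₁ => ?_)
          refine le_trans (le_of_eq ?_) (hlowη _)
          simp only [hω, hωD, mem_compl_iff, not_false_eq_true, indicator_of_mem]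
          rw [← EReal.coe_neg]
          congr 1; ring
        · have hcb : ω ∉ comeBack i h := fun hc =>
            hωD ⟨by simpa using subset_toMeasurable (P i) _ hc, by simpa using hω⟩
          have hfirst : ∃ r ≤ h, ω.1 r ≠ i := by simpa [stay] using hω
          obtain ⟨r₁, hr₁, hr₁i⟩ := hfirst
          simp only [hω, hωD, mem_compl_iff, not_false_eq_true, indicator_of_mem,
            indicator_of_notMem, add_zero, add_sub_cancel]
          obtain ⟨θ, V, hθ, hVlow, hle, hcase⟩ := hV.exists_stage hL hg hP hη hs ω
          refine le_trans ?_ hle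
          have hθ' : (θ : ℝ) ≤ h := by exact_mod_cast hθ
          rcases hcase with ⟨rfl, hτ, hVeq⟩ | ⟨hτ, hΓ, hVeq⟩
          · have hj : ω.1 θ = j := (coord_ne_iff hji ω θ).1 fun hi =>
              hcb ⟨r₁, θ, hr₁, le_rfl, hr₁i, hi⟩
            rw [hVeq, hj]
            exact Hcont θ hh3' hs b η τ hη ω
          -- Stopping before the first switch is excluded: the path would agree with `constPath i`
          -- up to `θ`, and on paths that stay in `i` the control does not stop by time `h`.
          · have hj : ω.1 θ = j := by
              refine (coord_ne_iff hji ω θ).1 fun hi => ?_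
              have hag : ∀ t ≤ θ, ω.1 t = (constPath i).1 t := by
                intro t ht
                by_contra hne
                exact hcb ⟨t, θ, ht, hθ, hne, hi⟩
              have h1 := hη.time_eq_of_agree hag hτ.le
              have h2 := (hnear (constPath i) fun _ _ => rfl).1
              rw [h1, hτ] at h2
              exact absurd (WithTop.coe_le_coe.2 hθ) (not_le.2 h2)
            rw [hVeq, hj]
            exact Hexit θ (hθ'.trans_lt hh2') b η τ hη ω hΓ)
  rw [hint] at key
  have h4 := EReal.coe_le_coe_iff.1 (key.trans hcost)
  linarith

end Super

end

/-! ### Appending controls, excursions, and the subsolution inequality. -/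

section
variable {n : ℕ}

/-! ### Switching to another control -/

open Classical in
/-- Follow `η`, and after time `S` follow `η'` on the event `E`. -/
def switchCurve (E : Set SwitchPath) (S : ℝ≥0) (η η' : SwitchPath → ℝ → Space n)
    (ω : SwitchPath) (s : ℝ) : Space n :=
  if ω ∈ E ∧ (S : ℝ) < s then η' (shift S ω) (s - S) else η ω s

open Classical in
/-- The stopping time that belongs to `switchCurve`. -/
def switchTime (E : Set SwitchPath) (S : ℝ≥0) (τ τ' : SwitchPath → WithTop ℝ≥0)
    (ω : SwitchPath) : WithTop ℝ≥0 :=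
  if ω ∈ E then S + τ' (shift S ω) else τ ω

section Switch

variable {K Γ : Set (Space n)} {b : WithTop ℝ≥0} {x y : Space n} {E : Set SwitchPath} {S : ℝ≥0}
  {η η' : SwitchPath → ℝ → Space n} {τ τ' : SwitchPath → WithTop ℝ≥0} {ω : SwitchPath}

theorem switchCurve_of_le {s : ℝ} (hs : s ≤ S) : switchCurve E S η η' ω s = η ω s :=
  if_neg fun h => absurd h.2 (not_lt.2 hs)

theorem switchCurve_of_notMem (hω : ω ∉ E) : switchCurve E S η η' ω = η ω :=
  funext fun _ => if_neg fun h => hω h.1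

theorem switchCurve_add (hω : ω ∈ E) (h : η' (shift S ω) 0 = η ω S) {s : ℝ} (hs : 0 ≤ s) :
    switchCurve E S η η' ω (S + s) = η' (shift S ω) s := by
  rcases hs.eq_or_lt with rfl | hs
  · rw [switchCurve_of_le (by simp), h, add_zero]
  · rw [switchCurve, if_pos ⟨hω, by linarith⟩, add_sub_cancel_left]

theorem switchTime_of_mem (hω : ω ∈ E) : switchTime E S τ τ' ω = S + τ' (shift S ω) := if_pos hω

theorem switchTime_of_notMem (hω : ω ∉ E) : switchTime E S τ τ' ω = τ ω := if_neg hω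

/-- The event is decided at time `S`, and on it the curve sits at the fixed point `y`. One control
for the restarted problem can therefore be appended for all paths of the event. -/
theorem IsControl.switch (hη : IsControl K Γ b x η τ) (hη' : IsControl K Γ (b - S) y η' τ')
    (hS : (S : WithTop ℝ≥0) ≤ b) (hE : MeasurableSet[history S] E) (hEy : ∀ ω ∈ E, η ω S = y)
    (hEτ : ∀ ω ∈ E, (S : WithTop ℝ≥0) ≤ τ ω) :
    IsControl K Γ b x (switchCurve E S η η') (switchTime E S τ τ') := by
  have h0 : ∀ ω ∈ E, η' (shift S ω) 0 = η ω S := fun ω hω => (hη'.start _).trans (hEy ω hω).symm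
  refine ⟨fun ω => ?_, fun ω t ht => ?_, fun ω s hs => ?_, fun s => ?_, fun r => ?_, fun ω => ?_,
    fun ω r hr => ?_⟩
  · rw [switchCurve_of_le S.coe_nonneg, hη.start]
  · by_cases hω : ω ∈ E
    · have := AbsolutelyContinuousOnInterval.glue S.coe_nonneg ht
        (hη.absolutelyContinuous ω S S.coe_nonneg) (hη'.absolutelyContinuous (shift S ω) t ht)
        (h0 ω hω)
      convert this using 2 with s
      by_cases hs : s ≤ S
      · rw [switchCurve_of_le hs, if_pos hs]
      · rw [switchCurve, if_pos ⟨hω, not_le.1 hs⟩, if_neg hs]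
    · rw [switchCurve_of_notMem hω]
      exact hη.absolutelyContinuous ω t ht
  · unfold switchCurve
    split_ifs with h
    · exact hη'.mem _ _ (by linarith [h.2])
    · exact hη.mem _ _ hs
  · rcases le_or_gt s S with hs | hs
    · have : (fun ω => switchCurve E S η η' ω s) = fun ω => η ω s :=
        funext fun ω => switchCurve_of_le (by exact_mod_cast hs)
      rw [this]
      exact hη.nonanticipating s
    · have h1 : Measurable[history s] fun ω => η' (shift S ω) (s - S) := by
        have := (hη'.nonanticipating (s - S)).comp (measurable_shift_history S (s - S))
        rw [add_tsub_cancel_of_le hs.le] at this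
        simpa [Function.comp_def, NNReal.coe_sub hs.le] using this
      classical
      have h2 : Measurable[history s] (E.piecewise (fun ω => η' (shift S ω) (s - S))
          fun ω => η ω s) :=
        Measurable.piecewise (history.mono hs.le _ hE) h1 (hη.nonanticipating s)
      convert h2 using 2 with ω
      have hs' : (S : ℝ) < s := by exact_mod_cast hs
      simp only [switchCurve, hs', and_true, Set.piecewise]
  · have hset : {ω | switchTime E S τ τ' ω ≤ r} =
        (E ∩ {ω | (S : WithTop ℝ≥0) + τ' (shift S ω) ≤ r}) ∪ (Eᶜ ∩ {ω | τ ω ≤ r}) := by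
      ext ω
      by_cases hω : ω ∈ E <;> simp [switchTime, hω]
    change MeasurableSet[history r] {ω | switchTime E S τ τ' ω ≤ r}
    rcases le_or_gt S r with hr | hr
    · rw [hset]
      have hE' := history.mono hr _ hE
      refine MeasurableSet.union (hE'.inter ?_) (hE'.compl.inter (hη.stoppingTime r))
      have h1 := measurable_shift_history S (r - S) (hη'.stoppingTime (r - S))
      rw [add_tsub_cancel_of_le hr] at h1
      convert h1 using 1
      ext ω
      simp only [mem_ofPred_eq, mem_preimage]
      conv_lhs => rw [← add_tsub_cancel_of_le hr, WithTop.coe_add]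
      exact WithTop.add_le_add_iff_left WithTop.coe_ne_top
    · have : {ω | switchTime E S τ τ' ω ≤ r} = {ω | τ ω ≤ r} := by
        ext ω
        by_cases hω : ω ∈ E
        · simp only [mem_ofPred_eq, switchTime_of_mem hω]
          have hlt : (r : WithTop ℝ≥0) < S := WithTop.coe_lt_coe.2 hr
          exact ⟨fun h => absurd (le_self_add.trans h) (not_le.2 hlt),
            fun h => absurd ((hEτ ω hω).trans h) (not_le.2 hlt)⟩
        · simp only [mem_ofPred_eq, switchTime_of_notMem hω]
      rw [this]
      exact hη.stoppingTime r
  · by_cases hω : ω ∈ E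
    · rw [switchTime_of_mem hω]
      calc (S : WithTop ℝ≥0) + τ' (shift S ω) ≤ S + (b - S) :=
            add_le_add_right (hη'.le_horizon _) _
        _ = b := add_tsub_cancel_of_le hS
    · rw [switchTime_of_notMem hω]
      exact hη.le_horizon ω
  · by_cases hω : ω ∈ E
    · rw [switchTime_of_mem hω] at hr
      have hSr : S ≤ r := by
        rw [← WithTop.coe_le_coe, ← hr]; exact le_self_add
      have hr' : τ' (shift S ω) = ((r - S : ℝ≥0) : WithTop ℝ≥0) := by
        rw [WithTop.coe_sub, ← hr]
        cases hT : τ' (shift S ω) with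
        | top =>
          rw [hT, add_top] at hr
          exact absurd hr WithTop.top_ne_coe
        | coe t => rw [← WithTop.coe_add, ← WithTop.coe_sub, add_tsub_cancel_left]
      rcases hη'.exit _ _ hr' with h | h
      · left
        rw [← add_tsub_cancel_of_le hSr, WithTop.coe_add, h, add_tsub_cancel_of_le hS]
      · right
        have e := switchCurve_add (η := η) (η' := η') hω (h0 ω hω) (r - S).coe_nonneg
        rw [← NNReal.coe_add, add_tsub_cancel_of_le hSr] at e
        rwa [e]
    · rw [switchTime_of_notMem hω] at hr
      rw [switchCurve_of_notMem hω]
      exact hη.exit ω r hr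

end Switch

/-- By the Markov property the shifted path on `E` has law `ν`. Since `e ≤ 1`, the shift by `A`
makes `F + A` at most a nonnegative constant plus `e` times `G + A`. The nonnegativity in the
conclusion allows such bounds to be added inside `ENNReal.ofReal`. -/
theorem lintegral_le_of_shift {q : Fin 2 → ℝ} {i k : Fin 2} {μ ν : Measure SwitchPath}
    (hμ : IsSwitchingLaw q i μ) (hν : IsSwitchingLaw q k ν) (hq : ∀ k, 0 < q k) {S : ℝ≥0}
    {E : Set SwitchPath} (hE : MeasurableSet[history S] E) (hEk : ∀ ω ∈ E, ω.1 S = k)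
    {F G : SwitchPath → EReal} (hG : Measurable G) {A M e J : ℝ} (hA : 0 ≤ A) (hM : 0 ≤ M)
    (he0 : 0 ≤ e) (he1 : e ≤ 1) (hGA : ∀ ω, -(A : EReal) ≤ G ω) (hJ : extIntegral ν G ≤ J)
    (hF : ∀ ω ∈ E, F ω ≤ (M : EReal) + e * G (shift S ω)) :
    0 ≤ M + e * J + A ∧
      ∫⁻ ω in E, (F ω + A).toENNReal ∂μ ≤ ENNReal.ofReal (μ.real E * (M + e * J + A)) := by
  have := hμ.isProbabilityMeasure
  have := hν.isProbabilityMeasure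
  have hGm : Measurable fun ω => (G ω + A).toENNReal :=
    EReal.continuous_toENNReal.measurable.comp (hG.add measurable_const)
  have hJ' : ∫⁻ ω, (G ω + A).toENNReal ∂ν ≤ ENNReal.ofReal (J + A) := by
    rw [extIntegral_eq_sub_const hG.aemeasurable hA (Eventually.of_forall hGA),
      EReal.sub_le_iff_le_add (.inl (EReal.coe_ne_bot _)) (.inl (EReal.coe_ne_top _)),
      ← EReal.coe_add] at hJ
    rw [← EReal.coe_ennreal_le_coe_ennreal_iff, EReal.coe_ennreal_ofReal]
    exact hJ.trans (EReal.coe_le_coe_iff.2 (le_max_left _ _))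
  have hc : 0 ≤ A - e * A := by nlinarith
  have hJA : 0 ≤ J + A := by
    have := (coe_le_extIntegral (m := ν) (g := G) (r := -A) (Eventually.of_forall fun ω => by
      rw [EReal.coe_neg]; exact hGA ω)).trans hJ
    have := EReal.coe_le_coe_iff.1 this
    linarith
  refine ⟨by nlinarith, ?_⟩
  calc ∫⁻ ω in E, (F ω + A).toENNReal ∂μ
      ≤ ∫⁻ ω in E, (ENNReal.ofReal (M + (A - e * A)) +
          ENNReal.ofReal e * (G (shift S ω) + A).toENNReal) ∂μ := by
        refine setLIntegral_mono' (history_le S _ hE) fun ω hω => ?_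
        rw [ENNReal.ofReal_add hM hc, add_right_comm, ← ereal_mul_add_coe he0 _ _ _ (hGA _),
          EReal.coe_ennreal_ofReal, max_eq_left hM]
        have hcE : ENNReal.ofReal (A - e * A) = ((A - e * A : ℝ) : EReal).toENNReal := by
          rw [EReal.toENNReal_of_ne_top (EReal.coe_ne_top _), EReal.toReal_coe]
        rw [hcE]
        refine le_trans (EReal.toENNReal_le_toENNReal ?_) EReal.toENNReal_add_le
        rw [add_assoc, ← EReal.coe_add, add_sub_cancel]
        exact add_le_add_left (hF ω hω) _
    _ = μ E * (ENNReal.ofReal (M + (A - e * A)) +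
          ENNReal.ofReal e * ∫⁻ ω, (G ω + A).toENNReal ∂ν) := by
        rw [hμ.setLIntegral_shift hν hq S hE hEk (F := fun ω => ENNReal.ofReal (M + (A - e * A)) +
          ENNReal.ofReal e * (G ω + A).toENNReal) (by fun_prop)]
        rw [lintegral_add_left measurable_const, lintegral_const, measure_univ, mul_one,
          lintegral_const_mul _ hGm]
    _ ≤ μ E * (ENNReal.ofReal (M + (A - e * A)) + ENNReal.ofReal e * ENNReal.ofReal (J + A)) := by
        gcongr
    _ = _ := by
        rw [← ENNReal.ofReal_mul he0, ← ENNReal.ofReal_add (by positivity) (by positivity),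
          ENNReal.ofReal_mul measureReal_nonneg, ofReal_measureReal]
        congr 2; ring

section SwitchCost

variable {L : Fin 2 → Space n → Space n → ℝ≥0∞} {lam : ℝ} {g : Fin 2 → Space n → ℝ}
  {E : Set SwitchPath} {S : ℝ≥0} {η η' : SwitchPath → ℝ → Space n}
  {τ τ' : SwitchPath → WithTop ℝ≥0} {ω : SwitchPath}

theorem pathCost_switch_of_mem (hω : ω ∈ E) (h0 : η' (shift S ω) 0 = η ω S) :
    pathCost L lam g (switchCurve E S η η') (switchTime E S τ τ') ω =
      ((run L lam η ω (Ioc 0 S) : ℝ≥0∞) : EReal) +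
        (Real.exp (-(lam * S)) : ℝ) * pathCost L lam g η' τ' (shift S ω) := by
  rw [pathCost_split (η := switchCurve E S η η') (τ := switchTime E S τ τ') (η' := η') (τ' := τ')
    (ω' := shift S ω) (h := S) ?_ ?_ (fun _ => rfl) fun s hs => (switchCurve_add hω h0 hs).symm]
  · rw [run_congr (fun _ _ => rfl) fun s _ hs => switchCurve_of_le hs]
  · rw [switchTime_of_mem hω]
    exact le_self_add
  · rw [switchTime_of_mem hω]
    cases τ' (shift S ω) with
    | top => rw [add_top, WithTop.top_sub_coe]
    | coe t => rw [← WithTop.coe_add, ← WithTop.coe_sub, add_tsub_cancel_left]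

theorem pathCost_switch_of_notMem (hω : ω ∉ E) :
    pathCost L lam g (switchCurve E S η η') (switchTime E S τ τ') ω = pathCost L lam g η τ ω := by
  have e : terminal lam g (switchCurve E S η η') ω (τ ω) = terminal lam g η ω (τ ω) := by
    cases τ ω with
    | top => rfl
    | coe r => simp only [terminal, switchCurve_of_notMem hω]
  simp only [pathCost, run, runDensity, switchTime_of_notMem hω, switchCurve_of_notMem hω, e]

end SwitchCost

/-! ### A short excursion that ends when the chain switches -/

/-- The duration of the initial stay in state `i`, truncated at `h`. -/
def stayTime (i : Fin 2) (h : ℝ≥0) (ω : SwitchPath) : ℝ≥0 := sSup {r | r ≤ h ∧ ω ∈ stay i r}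

theorem bddAbove_stay (i : Fin 2) (h : ℝ≥0) (ω : SwitchPath) :
    BddAbove {r | r ≤ h ∧ ω ∈ stay i r} := ⟨h, fun _ hr => hr.1⟩

theorem stayTime_le (i : Fin 2) (h : ℝ≥0) (ω : SwitchPath) : stayTime i h ω ≤ h :=
  csSup_le' fun _ hr => hr.1

theorem stayTime_eq {i : Fin 2} {h : ℝ≥0} {ω : SwitchPath} (hω : ω ∈ stay i h) :
    stayTime i h ω = h :=
  le_antisymm (stayTime_le i h ω) (le_csSup (bddAbove_stay i h ω) ⟨le_rfl, hω⟩)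

/-- By right continuity, being in `i` up to and including `c` forces a slightly longer stay. The
strict inequality thus describes an event known at time `c`. -/
theorem lt_stayTime_iff {i : Fin 2} {h c : ℝ≥0} {ω : SwitchPath} :
    c < stayTime i h ω ↔ c < h ∧ ω ∈ stay i c := by
  constructor
  · intro hc
    obtain ⟨r, hr, hcr⟩ := exists_lt_of_lt_csSup' hc
    exact ⟨hcr.trans_le hr.1, fun t ht => hr.2 t (ht.trans hcr.le)⟩
  · rintro ⟨hch, hω⟩
    obtain ⟨δ, hδ, H⟩ := ω.exists_eq_right c
    obtain ⟨u, hcu, hu⟩ := exists_between (lt_min hch (lt_add_of_pos_right c hδ))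
    refine hcu.trans_le (le_csSup (bddAbove_stay i h ω) ⟨(hu.trans_le (min_le_left _ _)).le,
      fun t ht => ?_⟩)
    rcases le_or_gt t c with htc | htc
    · exact hω t htc
    · rw [H t htc.le (ht.trans_lt (hu.trans_le (min_le_right _ _)))]
      exact hω c le_rfl

/-- The size of the excursion at time `s`, with speed `1` before the switch and speed `δ` on the
way back. -/
def excursionSize (i : Fin 2) (h : ℝ≥0) (δ : ℝ) (ω : SwitchPath) (s : ℝ) : ℝ :=
  max 0 ((1 + δ) * min s (stayTime i h ω) - δ * s)

/-- The excursion from `x` with velocity `-v`. -/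
def excursion (i : Fin 2) (h : ℝ≥0) (δ : ℝ) (x v : Space n) (ω : SwitchPath) (s : ℝ) : Space n :=
  x - excursionSize i h δ ω s • v

section Excursion

variable {i : Fin 2} {h : ℝ≥0} {δ : ℝ} {x v : Space n} {ω : SwitchPath}

theorem excursionSize_of_le {s : ℝ} (h0 : 0 ≤ s) (hs : s ≤ stayTime i h ω) :
    excursionSize i h δ ω s = s := by
  rw [excursionSize, min_eq_left hs, max_eq_right] <;> linarith

theorem excursionSize_nonneg (s : ℝ) : 0 ≤ excursionSize i h δ ω s := le_max_left _ _

theorem excursionSize_le (hδ : 0 < δ) (s : ℝ) : excursionSize i h δ ω s ≤ h := by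
  have h1 : ((stayTime i h ω : ℝ≥0) : ℝ) ≤ h := by exact_mod_cast stayTime_le i h ω
  refine max_le h.coe_nonneg ?_
  have h2 := min_le_left s (stayTime i h ω)
  have h3 := min_le_right s (stayTime i h ω)
  nlinarith

theorem excursionSize_end (hδ : 0 < δ) {s : ℝ} (hs : (1 + δ) * h ≤ δ * s) :
    excursionSize i h δ ω s = 0 := by
  have h1 : ((stayTime i h ω : ℝ≥0) : ℝ) ≤ h := by exact_mod_cast stayTime_le i h ω
  have h3 := min_le_right s (stayTime i h ω)
  refine max_eq_left ?_
  nlinarith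

theorem lipschitzWith_excursion (hδ : 0 < δ) :
    LipschitzWith ((1 + 2 * δ.toNNReal) * ‖v‖₊) (excursion i h δ x v ω) := by
  refine LipschitzWith.of_dist_le_mul fun s t => ?_
  have hm : |min s (stayTime i h ω : ℝ) - min t (stayTime i h ω)| ≤ |s - t| := by
    simpa [Real.dist_eq] using (LipschitzWith.id.min_const (stayTime i h ω : ℝ)).dist_le_mul s t
  have hψ : |excursionSize i h δ ω s - excursionSize i h δ ω t| ≤ (1 + 2 * δ) * |s - t| := by
    rw [excursionSize, excursionSize, max_comm, max_comm (0 : ℝ)]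
    refine (abs_max_sub_max_le_abs _ _ _).trans ?_
    obtain ⟨h1, h2⟩ := abs_le.1 hm
    have h3 := neg_abs_le (s - t)
    have h4 := le_abs_self (s - t)
    rw [abs_le]
    constructor <;> nlinarith
  rw [excursion, excursion, dist_eq_norm, sub_sub_sub_cancel_left, ← sub_smul, norm_smul,
    Real.norm_eq_abs, abs_sub_comm]
  push_cast
  rw [Real.coe_toNNReal _ hδ.le, Real.dist_eq]
  have := mul_le_mul_of_nonneg_right hψ (norm_nonneg v)
  linarith

theorem isControl_excursion {K Γ : Set (Space n)} {b : WithTop ℝ≥0} (hδ : 0 < δ)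
    (hK : ∀ t : ℝ, 0 ≤ t → t ≤ h → x - t • v ∈ K) :
    IsControl K Γ b x (excursion i h δ x v) (fun _ => b) where
  start ω := by
    rw [excursion, excursionSize_of_le le_rfl (stayTime i h ω).coe_nonneg, zero_smul, sub_zero]
  absolutelyContinuous ω t _ :=
    (lipschitzWith_excursion hδ).lipschitzOnWith.absolutelyContinuousOnInterval
  mem ω s _ := hK _ (excursionSize_nonneg s) (excursionSize_le hδ s)
  nonanticipating s := by
    -- The position at time `s` depends on the path only through `min s (stayTime i h ω)`, and its
    -- superlevel sets at `c < s` are already decided at time `c`.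
    have hm : Measurable[history s] fun ω => min (s : ℝ) (stayTime i h ω) := by
      refine measurable_of_Ioi (mδ := history s) fun c => ?_
      rcases lt_or_ge c 0 with hc | hc
      · convert @MeasurableSet.univ _ (history s)
        refine eq_univ_of_forall fun ω => ?_
        exact hc.trans_le (le_min s.coe_nonneg (stayTime i h ω).coe_nonneg)
      · lift c to ℝ≥0 using hc
        have hset : (fun ω => min (s : ℝ) (stayTime i h ω)) ⁻¹' Ioi (c : ℝ) =
            {ω | c < s ∧ c < h ∧ ω ∈ stay i c} := by
          ext ω
          simp only [mem_preimage, mem_Ioi, lt_min_iff, mem_ofPred_eq, NNReal.coe_lt_coe,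
            lt_stayTime_iff]
        rw [hset]
        by_cases hcs : c < s ∧ c < h
        · simp only [hcs, true_and]
          exact history.mono hcs.1.le _ (measurableSet_stay i c)
        · convert @MeasurableSet.empty _ (history s)
          refine eq_empty_of_forall_notMem fun ω => ?_
          exact fun H => hcs ⟨H.1, H.2.1⟩
    have h1 : Measurable fun m : ℝ => x - max 0 ((1 + δ) * m - δ * s) • v := by fun_prop
    exact h1.comp hm
  stoppingTime r := by simp
  le_horizon _ := le_rfl
  exit _ r hr := Or.inl hr.symm

theorem ofReal_exp_mul_le {lam s : ℝ} (hlam : 0 ≤ lam) (h0 : 0 ≤ s) (X : ℝ≥0∞) :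
    ENNReal.ofReal (Real.exp (-(lam * s))) * X ≤ X := by
  have : ENNReal.ofReal (Real.exp (-(lam * s))) ≤ 1 := by
    rw [← ENNReal.ofReal_one]
    exact ENNReal.ofReal_le_ofReal (Real.exp_le_one_iff.2 (by nlinarith))
  calc _ ≤ 1 * X := mul_le_mul_left this X
    _ = X := one_mul X

theorem runDensity_excursion_of_lt {L : Fin 2 → Space n → Space n → ℝ≥0∞} {lam : ℝ}
    (hlam : 0 ≤ lam) {s : ℝ} (h0 : 0 < s) (hs : s < stayTime i h ω) :
    runDensity L lam (excursion i h δ x v) ω s ≤ L i (x - s • v) v := by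
  refine (ofReal_exp_mul_le hlam h0.le _).trans (le_of_eq ?_)
  have hω : ω.1 s.toNNReal = i := by
    refine (lt_stayTime_iff.1 (?_ : s.toNNReal < stayTime i h ω)).2 _ le_rfl
    rwa [Real.toNNReal_lt_iff_lt_coe h0.le]
  have hd : deriv (excursion i h δ x v ω) s = -v := by
    have h1 : HasDerivAt (fun r : ℝ => x - r • v) (-v) s := by
      simpa using ((hasDerivAt_id s).smul_const v).const_sub x
    refine (h1.congr_of_eventuallyEq ?_).deriv
    filter_upwards [Ioo_mem_nhds h0 hs] with r hr
    rw [excursion, excursionSize_of_le hr.1.le hr.2.le]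
  rw [hω, hd, neg_neg, excursion, excursionSize_of_le h0.le hs.le]

/-- After the switch the curve is Lipschitz with constant `δ * ‖v‖`, which bounds the derivative
also at the kink where the excursion ends. -/
theorem runDensity_excursion_of_gt {L : Fin 2 → Space n → Space n → ℝ≥0∞} {lam : ℝ}
    (hlam : 0 ≤ lam) (hδ : 0 < δ) {s : ℝ} (h0 : 0 < s) (hs : stayTime i h ω < s) {C : ℝ≥0∞}
    (hC : ∀ k y u, ‖u‖ ≤ δ * ‖v‖ → L k y u ≤ C) :
    runDensity L lam (excursion i h δ x v) ω s ≤ C := by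
  refine (ofReal_exp_mul_le hlam h0.le _).trans (hC _ _ _ ?_)
  have hlip : LipschitzOnWith (δ.toNNReal * ‖v‖₊) (excursion i h δ x v ω)
      (Ioi (stayTime i h ω : ℝ)) := by
    refine LipschitzOnWith.of_dist_le_mul fun r hr t ht => ?_
    have hψ : |excursionSize i h δ ω r - excursionSize i h δ ω t| ≤ δ * |r - t| := by
      rw [excursionSize, excursionSize, max_comm, max_comm (0 : ℝ),
        min_eq_right (le_of_lt hr), min_eq_right (le_of_lt ht)]
      refine (abs_max_sub_max_le_abs _ _ _).trans (le_of_eq ?_)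
      rw [sub_sub_sub_cancel_left, ← mul_sub, abs_mul, abs_of_pos hδ, abs_sub_comm]
    rw [excursion, excursion, dist_eq_norm, sub_sub_sub_cancel_left, ← sub_smul, norm_smul,
      Real.norm_eq_abs, abs_sub_comm]
    push_cast
    rw [Real.coe_toNNReal _ hδ.le, Real.dist_eq]
    have := mul_le_mul_of_nonneg_right hψ (norm_nonneg v)
    linarith
  have := norm_deriv_le_of_lipschitzOn (Ioi_mem_nhds hs) hlip
  rw [norm_neg]
  simpa [Real.coe_toNNReal _ hδ.le] using this

theorem run_excursion_le {L : Fin 2 → Space n → Space n → ℝ≥0∞} {lam : ℝ} (hlam : 0 ≤ lam)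
    (hδ : 0 < δ) {C ℓ : ℝ≥0} (hC : ∀ k y u, ‖u‖ ≤ δ * ‖v‖ → L k y u ≤ C)
    (hℓ : ∀ s : ℝ, 0 ≤ s → s ≤ h → L i (x - s • v) v ≤ ℓ) (S : ℝ≥0) :
    run L lam (excursion i h δ x v) ω (Ioc 0 S) ≤ ((ℓ + C) * S : ℝ≥0) := by
  have hσ : ((stayTime i h ω : ℝ≥0) : ℝ) ≤ h := by exact_mod_cast stayTime_le i h ω
  calc run L lam (excursion i h δ x v) ω (Ioc 0 S)
      ≤ ∫⁻ _ in Ioc (0 : ℝ) S, ((ℓ + C : ℝ≥0) : ℝ≥0∞) := by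
        refine setLIntegral_mono_ae' measurableSet_Ioc ?_
        have : ∀ᵐ s : ℝ, s ≠ stayTime i h ω := by simp [ae_iff, measure_singleton]
        filter_upwards [this] with s hs hsI
        rw [ENNReal.coe_add]
        rcases lt_or_gt_of_ne hs with hs | hs
        · exact (runDensity_excursion_of_lt hlam hsI.1 hs).trans
            ((hℓ s hsI.1.le (hs.le.trans hσ)).trans le_self_add)
        · exact (runDensity_excursion_of_gt hlam hδ hsI.1 hs hC).trans le_add_self
    _ = _ := by
        rw [setLIntegral_const, Real.volume_Ioc, sub_zero, ENNReal.ofReal_coe_nnreal,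
          ENNReal.coe_mul]

theorem run_excursion_le_of_stay {L : Fin 2 → Space n → Space n → ℝ≥0∞} {lam : ℝ}
    (hlam : 0 ≤ lam) {ℓ : ℝ≥0} (hℓ : ∀ s : ℝ, 0 ≤ s → s ≤ h → L i (x - s • v) v ≤ ℓ)
    (hω : ω ∈ stay i h) :
    run L lam (excursion i h δ x v) ω (Ioc 0 h) ≤ (ℓ * h : ℝ≥0) := by
  calc run L lam (excursion i h δ x v) ω (Ioc 0 h) ≤ ∫⁻ _ in Ioc (0 : ℝ) h, (ℓ : ℝ≥0∞) := by
        refine setLIntegral_mono_ae' measurableSet_Ioc ?_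
        have : ∀ᵐ s : ℝ, s ≠ h := by simp [ae_iff, measure_singleton]
        filter_upwards [this] with s hs hsI
        refine (runDensity_excursion_of_lt hlam hsI.1 ?_).trans (hℓ s hsI.1.le hsI.2)
        rw [stayTime_eq hω]
        exact lt_of_le_of_ne hsI.2 hs
    _ = _ := by
        rw [setLIntegral_const, Real.volume_Ioc, sub_zero, ENNReal.ofReal_coe_nnreal,
          ENNReal.coe_mul]

end Excursion

/-! ### The subsolution inequality -/

section Sub

variable {L : Fin 2 → Space n → Space n → ℝ≥0∞} {H : Fin 2 → Space n → Space n → ℝ} {lam : ℝ}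
  {g : Fin 2 → Space n → ℝ} {K Γ : Set (Space n)} {P : Fin 2 → Measure SwitchPath}
  {b : WithTop ℝ≥0} {x : Space n} {s₀ : ℝ≥0} {w : Fin 2 → Space n → ℝ≥0 → ℝ} {A l : ℝ}
  {q : Fin 2 → ℝ}

theorem IsLocalValue.exists_control (hV : IsLocalValue L lam g K Γ P b x s₀ w A l) (k : Fin 2)
    {y : Space n} (hy : y ∈ K) {s : ℝ≥0} (hs : s ≤ s₀) {e : ℝ} (he : 0 < e) :
    ∃ η τ, IsControl K Γ (b - s) y η τ ∧
      extIntegral (P k) (pathCost L lam g η τ) ≤ ((w k y s + e : ℝ) : EReal) := by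
  have hlt : valueFun L lam g K Γ (P k) (b - s) y < ((w k y s + e : ℝ) : EReal) := by
    rw [hV.value k y hy s hs, EReal.coe_lt_coe_iff]
    linarith
  simp only [valueFun, iInf_lt_iff] at hlt
  obtain ⟨η, τ, hη, hlt⟩ := hlt
  exact ⟨η, τ, hη, hlt.le⟩

/-- Dynamic programming along an excursion: until time `h` without a switch, and otherwise until
the excursion is back at `x` at time `S`. -/
theorem IsLocalValue.le_of_excursion (hV : IsLocalValue L lam g K Γ P b x s₀ w A l)
    (hL : IsRunningCost L H) (hlam : 0 ≤ lam) (hg : ∀ k, Measurable (g k))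
    (hP : ∀ k, IsSwitchingLaw q k (P k)) (hq : ∀ k, 0 < q k) {i j : Fin 2} (hji : j ≠ i)
    {v : Space n} {δ : ℝ} (hδ : 0 < δ) {C ℓ h S : ℝ≥0}
    (hC : ∀ k y u, ‖u‖ ≤ δ * ‖v‖ → L k y u ≤ C)
    (hℓ : ∀ s : ℝ, 0 ≤ s → s ≤ h → L i (x - s • v) v ≤ ℓ)
    (hK : ∀ t : ℝ, 0 ≤ t → t ≤ h → x - t • v ∈ K) (hS : S ≤ s₀) (hhS : h ≤ S)
    (hend : (1 + δ) * h ≤ δ * S) (hhv : ‖(h : ℝ) • v‖ ≤ 1) {e : ℝ} (he : 0 < e) :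
    w i x 0 ≤ (P i).real (stay i h) *
        (ℓ * h + Real.exp (-(lam * h)) * (w i (x - (h : ℝ) • v) h + e)) +
      ((P i).real ((stay i h)ᶜ ∩ {ω | ω.1 S = i}) *
        ((ℓ + C) * S + Real.exp (-(lam * S)) * (w i x S + e)) +
      (P i).real ((stay i h)ᶜ ∩ {ω | ω.1 S = j}) *
        ((ℓ + C) * S + Real.exp (-(lam * S)) * (w j x S + e))) := by
  have hprob := fun k => (hP k).isProbabilityMeasure
  obtain ⟨hA, hl⟩ := hV.nonneg
  have hSb : (S : WithTop ℝ≥0) ≤ b := (WithTop.coe_le_coe.2 hS).trans hV.lt.le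
  have hhb : (h : WithTop ℝ≥0) ≤ b := (WithTop.coe_le_coe.2 hhS).trans hSb
  have hy₀ : x - (h : ℝ) • v ∈ K := hK h h.coe_nonneg le_rfl
  obtain ⟨η₀, τ₀, hη₀, hJ₀⟩ := hV.exists_control i hy₀ (hhS.trans hS) he
  obtain ⟨ηi, τi, hηi, hJi⟩ := hV.exists_control i hV.mem hS he
  obtain ⟨ηj, τj, hηj, hJj⟩ := hV.exists_control j hV.mem hS he
  set E₀ := stay i h with hE₀
  -- Together with `E₀` these events cover all paths. On each, the time of restart, the state and
  -- the position are known: `h`, `i` and `x - h • v` on `E₀`, and `S`, `k` and `x` on `E k`.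
  set E : Fin 2 → Set SwitchPath := fun k => E₀ᶜ ∩ {ω | ω.1 S = k} with hE
  have mE₀ : MeasurableSet[history h] E₀ := measurableSet_stay i h
  have mE : ∀ k, MeasurableSet[history S] (E k) := fun k =>
    ((history.mono hhS _ mE₀).compl).inter (measurableSet_coord_eq_history le_rfl k)
  have hnot₀ : ∀ k, ∀ ω ∈ E k, ω ∉ E₀ := fun k ω hω => hω.1
  have hnotE : ∀ ω ∈ E₀, ∀ k, ω ∉ E k := fun ω hω k h => h.1 hω
  have hnotij : ∀ ω ∈ E j, ω ∉ E i := fun ω hω h => hji (hω.2.symm.trans h.2)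
  have hnotji : ∀ ω ∈ E i, ω ∉ E j := fun ω hω h => hji (h.2.symm.trans hω.2)
  set ζ := excursion i h δ x v with hζ
  have hc0 : IsControl K Γ b x ζ (fun _ => b) := isControl_excursion hδ hK
  have hζh : ∀ ω ∈ E₀, ζ ω h = x - (h : ℝ) • v := fun ω hω => by
    rw [hζ, excursion, excursionSize_of_le h.coe_nonneg (by rw [stayTime_eq hω])]
  have hζS : ∀ ω, ζ ω S = x := fun ω => by
    rw [hζ, excursion, excursionSize_end hδ hend, zero_smul, sub_zero]
  have hc1 := hc0.switch hη₀ hhb mE₀ hζh fun _ _ => hhb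
  have e1 : ∀ k, ∀ ω ∈ E k, switchCurve E₀ h ζ η₀ ω = ζ ω := fun k ω hω =>
    switchCurve_of_notMem (hnot₀ k ω hω)
  have hc2 := hc1.switch hηi hSb (mE i) (fun ω hω => by rw [e1 i ω hω, hζS]) fun ω hω => by
    rw [switchTime_of_notMem (hnot₀ i ω hω)]; exact hSb
  have hc3 := hc2.switch hηj hSb (mE j)
    (fun ω hω => by rw [switchCurve_of_notMem (hnotij ω hω), e1 j ω hω, hζS]) fun ω hω => by
      rw [switchTime_of_notMem (hnotij ω hω), switchTime_of_notMem (hnot₀ j ω hω)]; exact hSb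
  set η := switchCurve (E j) S (switchCurve (E i) S (switchCurve E₀ h ζ η₀) ηi) ηj with hη
  set τ := switchTime (E j) S (switchTime (E i) S (switchTime E₀ h (fun _ => b) τ₀) τi) τj with hτ
  set F := pathCost L lam g η τ with hF
  have hF₀ : ∀ ω ∈ E₀, F ω ≤ ((ℓ * h : ℝ) : EReal) +
      (Real.exp (-(lam * h)) : ℝ) * pathCost L lam g η₀ τ₀ (shift h ω) := fun ω hω => by
    rw [hF, hη, hτ, pathCost_switch_of_notMem (hnotE ω hω j),
      pathCost_switch_of_notMem (hnotE ω hω i),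
      pathCost_switch_of_mem hω ((hη₀.start _).trans (hζh ω hω).symm)]
    refine add_le_add_left ?_ _
    have := EReal.coe_ennreal_le_coe_ennreal_iff.2 (run_excursion_le_of_stay (δ := δ) hlam hℓ hω)
    refine this.trans (le_of_eq ?_)
    rw [EReal.coe_nnreal_eq_coe_real, NNReal.coe_mul]
  have hrun : ∀ k, ∀ ω ∈ E k, ((run L lam ζ ω (Ioc 0 S) : ℝ≥0∞) : EReal) ≤
      (((ℓ + C) * S : ℝ) : EReal) := fun k ω hω => by
    have := EReal.coe_ennreal_le_coe_ennreal_iff.2 (run_excursion_le (ω := ω) hlam hδ hC hℓ S)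
    refine this.trans (le_of_eq ?_)
    rw [EReal.coe_nnreal_eq_coe_real, NNReal.coe_mul, NNReal.coe_add]
  have hFi : ∀ ω ∈ E i, F ω ≤ (((ℓ + C) * S : ℝ) : EReal) +
      (Real.exp (-(lam * S)) : ℝ) * pathCost L lam g ηi τi (shift S ω) := fun ω hω => by
    rw [hF, hη, hτ, pathCost_switch_of_notMem (hnotji ω hω),
      pathCost_switch_of_mem hω (by rw [hηi.start, e1 i ω hω, hζS])]
    refine add_le_add_left ?_ _
    rw [run_congr (η' := ζ) (ω' := ω) (fun _ _ => rfl) fun s _ _ => by rw [e1 i ω hω]]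
    exact hrun i ω hω
  have hFj : ∀ ω ∈ E j, F ω ≤ (((ℓ + C) * S : ℝ) : EReal) +
      (Real.exp (-(lam * S)) : ℝ) * pathCost L lam g ηj τj (shift S ω) := fun ω hω => by
    rw [hF, hη, hτ, pathCost_switch_of_mem hω
      (by rw [hηj.start, switchCurve_of_notMem (hnotij ω hω), e1 j ω hω, hζS])]
    refine add_le_add_left ?_ _
    rw [run_congr (η' := ζ) (ω' := ω) (fun _ _ => rfl) fun s _ _ => by
      rw [switchCurve_of_notMem (hnotij ω hω), e1 j ω hω]]
    exact hrun j ω hω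
  -- All restarts take place within distance 1 of `x`, so this constant bounds every cost involved
  -- from below.
  set A' := A + l with hA'
  have hA'0 : 0 ≤ A' := by positivity
  have hlowx : ∀ (s : ℝ≥0) η τ, s ≤ s₀ → IsControl K Γ (b - s) x η τ → ∀ ω,
      -(A' : EReal) ≤ pathCost L lam g η τ ω := fun s η τ hs hη ω => by
    refine le_trans ?_ (hV.lower x s η τ hs hη ω)
    rw [← EReal.coe_neg, ← EReal.coe_neg, EReal.coe_le_coe_iff, sub_self, norm_zero]
    linarith
  have hlow₀ : ∀ ω, -(A' : EReal) ≤ pathCost L lam g η₀ τ₀ ω := fun ω => by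
    refine le_trans ?_ (hV.lower _ h η₀ τ₀ (hhS.trans hS) hη₀ ω)
    rw [← EReal.coe_neg, ← EReal.coe_neg, EReal.coe_le_coe_iff, sub_sub_cancel_left, norm_neg]
    nlinarith
  have hexp : ∀ t : ℝ≥0, Real.exp (-(lam * t)) ≤ 1 := fun t =>
    Real.exp_le_one_iff.2 (by have := t.coe_nonneg; nlinarith)
  obtain ⟨n₀, b₀⟩ := lintegral_le_of_shift (hP i) (hP i) hq mE₀ (fun ω hω => hω h le_rfl)
    (hη₀.measurable_pathCost (lam := lam) hL hg) hA'0 (by positivity) (Real.exp_pos _).le (hexp h)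
    hlow₀ hJ₀ hF₀
  obtain ⟨ni, bi⟩ := lintegral_le_of_shift (hP i) (hP i) hq (mE i) (fun ω hω => hω.2)
    (hηi.measurable_pathCost (lam := lam) hL hg) hA'0 (by positivity) (Real.exp_pos _).le (hexp S)
    (hlowx S ηi τi hS hηi) hJi hFi
  obtain ⟨nj, bj⟩ := lintegral_le_of_shift (hP i) (hP j) hq (mE j) (fun ω hω => hω.2)
    (hηj.measurable_pathCost (lam := lam) hL hg) hA'0 (by positivity) (Real.exp_pos _).le (hexp S)
    (hlowx S ηj τj hS hηj) hJj hFj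
  have hcov : (univ : Set SwitchPath) ⊆ E₀ ∪ (E i ∪ E j) := fun ω _ => by
    by_cases hω : ω ∈ E₀
    · exact Or.inl hω
    · by_cases hi : ω.1 S = i
      · exact Or.inr (Or.inl ⟨hω, hi⟩)
      · exact Or.inr (Or.inr ⟨hω, (coord_ne_iff hji ω S).1 hi⟩)
  have hint : ∫⁻ ω, (F ω + A').toENNReal ∂(P i) ≤ ENNReal.ofReal
      ((P i).real E₀ * (ℓ * h + Real.exp (-(lam * h)) * (w i (x - (h : ℝ) • v) h + e) + A') +
      ((P i).real (E i) * ((ℓ + C) * S + Real.exp (-(lam * S)) * (w i x S + e) + A') +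
      (P i).real (E j) * ((ℓ + C) * S + Real.exp (-(lam * S)) * (w j x S + e) + A'))) := by
    rw [ENNReal.ofReal_add (by positivity) (by positivity),
      ENNReal.ofReal_add (by positivity) (by positivity)]
    calc ∫⁻ ω, (F ω + A').toENNReal ∂(P i) = ∫⁻ ω in univ, (F ω + A').toENNReal ∂(P i) := by
          rw [setLIntegral_univ]
      _ ≤ ∫⁻ ω in E₀ ∪ (E i ∪ E j), (F ω + A').toENNReal ∂(P i) := lintegral_mono_set hcov
      _ ≤ _ := (lintegral_union_le _ _ _).trans
          (add_le_add b₀ ((lintegral_union_le _ _ _).trans (add_le_add bi bj)))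
  have hFlow : ∀ ω, -(A' : EReal) ≤ F ω := hlowx 0 η τ zero_le (by simpa using hc3)
  have hval : ((w i x 0 : ℝ) : EReal) ≤ extIntegral (P i) F := by
    rw [← hV.value i x hV.mem 0 zero_le]
    exact iInf_le_of_le η (iInf_le_of_le τ (iInf_le _ (by simpa using hc3)))
  rw [extIntegral_eq_sub_const (hc3.measurable_pathCost hL hg).aemeasurable hA'0
    (Eventually.of_forall hFlow)] at hval
  have h1 := hval.trans (EReal.sub_le_sub (EReal.coe_ennreal_le_coe_ennreal_iff.2 hint) le_rfl)
  rw [EReal.coe_ennreal_ofReal, max_eq_left (by positivity), ← EReal.coe_sub,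
    EReal.coe_le_coe_iff] at h1
  -- The three bounds carry `A'` with total weight at most 1, so subtracting `A'` at the end leaves
  -- the claim.
  have hsum : (P i).real E₀ + ((P i).real (E i) + (P i).real (E j)) ≤ 1 := by
    have d1 : Disjoint (E i) (E j) := disjoint_left.2 fun ω hi => hnotji ω hi
    have d2 : Disjoint E₀ (E i ∪ E j) := disjoint_left.2 fun ω h0 => by
      rintro (h | h)
      · exact hnotE ω h0 i h
      · exact hnotE ω h0 j h
    have m : ∀ k, MeasurableSet (E k) := fun k => history_le S _ (mE k)
    rw [← measureReal_union d1 (m j), ← measureReal_union d2 ((m i).union (m j))]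
    exact measureReal_le_one
  nlinarith

-- If the inequality failed, an excursion with a velocity nearly attaining the supremum in `H = L*`
-- would cost less than `W` for small `h`. The discount and the switch enter through
-- `eventually_gain` with reversed signs.
set_option maxHeartbeats 400000 in
theorem IsLocalValue.sub (hV : IsLocalValue L lam g K Γ P b x s₀ w A l)
    (hL : IsRunningCost L H) (hlam : 0 ≤ lam) (hg : ∀ k, Measurable (g k))
    (hP : ∀ k, IsSwitchingLaw q k (P k)) (hq : ∀ k, 0 < q k) {i j : Fin 2} (hji : j ≠ i)
    (hK : K ∈ 𝓝 x) {p : Space n} {a : ℝ}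
    (hup : ∀ σ > 0, ∃ r > 0, ∀ y ∈ K, ∀ s : ℝ≥0, s ≤ s₀ → ‖y - x‖ < r → (s : ℝ) < r →
      w i y s ≤ w i x 0 + inner ℝ p (y - x) + a * s + σ * (‖y - x‖ + s)) :
    -a + H i x p + lam * w i x 0 + q i * (w i x 0 - w j x 0) ≤ 0 := by
  by_contra hcon
  push Not at hcon
  set W := w i x 0 with hW
  set Wj := w j x 0 with hWj
  set G := -a + H i x p + lam * W + q i * (W - Wj) with hG
  have hqi := hq i
  -- The errors are `4 * δ` while staying (`2 * δ` in the contact inequality with the tolerance, `δ`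
  -- in the choice of `v`, `δ` for the discount) and `q i * δ` through the switch, together half of
  -- `G`.
  set δ := G / (2 * (4 + q i)) with hδdef
  have hδ : 0 < δ := by positivity
  have hδG : δ * (2 * (4 + q i)) = G := by rw [hδdef]; field_simp
  obtain ⟨v, hv0, hvL⟩ := hL.fenchel i x p δ hδ
  set ℓ := (inner ℝ p v - H i x p + δ).toNNReal with hℓdef
  have hℓ : (ℓ : ℝ) = inner ℝ p v - H i x p + δ := Real.coe_toNNReal _ hv0
  obtain ⟨ρ, hρ, hnear⟩ := Metric.eventually_nhds_iff.1 (hvL.and hK)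
  obtain ⟨δs, hδs, C, hC⟩ := hL.slow
  -- The return speed `d * ‖v‖` is at most `δs`, where the running cost is bounded.
  set d := δs / (‖v‖ + 1) with hd
  have hd0 : 0 < d := by positivity
  have hdv : d * ‖v‖ ≤ δs := by
    rw [hd, div_mul_eq_mul_div, div_le_iff₀ (by positivity)]
    nlinarith
  -- With `S = κ * h` one has `(1 + d) * h = d * S`, so the excursion is back at `x` at time `S`
  -- whenever the switch occurred.
  set κ : ℝ≥0 := ((1 + d) / d).toNNReal with hκ
  have hκd : (κ : ℝ) = (1 + d) / d := Real.coe_toNNReal _ (by positivity)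
  have hκ1 : (1 : ℝ) ≤ κ := by
    rw [hκd, le_div_iff₀ hd0]; linarith
  obtain ⟨r, hr, hup⟩ := hup (δ / (‖v‖ + 1)) (by positivity)
  set D : ℝ → Set SwitchPath := fun h =>
    (stay i h.toNNReal)ᶜ ∩ {ω | ω.1 (κ * h.toNNReal) = i} with hD
  have hj := hq j
  have hDb : ∀ h > 0, |(P i).real (D h)| ≤ (q i * q j * (κ : ℝ) ^ 2) * h ^ 2 := by
    intro h hh
    rw [abs_of_nonneg measureReal_nonneg]
    refine ENNReal.toReal_le_of_le_ofReal (by positivity) ?_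
    have h1 : D h ⊆ comeBack i (κ * h.toNNReal) := by
      rintro ω ⟨h1, h2⟩
      have : ∃ r ≤ h.toNNReal, ω.1 r ≠ i := by simpa [stay] using h1
      obtain ⟨r, hr, hri⟩ := this
      exact ⟨r, _, hr.trans (le_mul_of_one_le_left zero_le (by exact_mod_cast hκ1)), le_rfl, hri, h2⟩
    refine (measure_mono h1).trans (((hP i).measure_comeBack hP hq hji _).trans (le_of_eq ?_))
    rw [NNReal.coe_mul, Real.coe_toNNReal _ hh.le]
    congr 1; ring
  have hgain := eventually_gain (lam := lam) (W := -W) (B := -(a - inner ℝ p v + 2 * δ + (ℓ + δ)))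
    (S := -(Wj + δ)) (A := W + 1) ((hP i).tendsto_jump hq hji) hDb (by rw [hℓ]; nlinarith)
  have hs₀ : (0 : ℝ) < s₀ := hV.pos
  have hid : Tendsto (fun h : ℝ => h) (𝓝[>] 0) (𝓝 0) := tendsto_nhdsWithin_of_tendsto_nhds tendsto_id
  -- After a switch, the bound on the total cost, detour included, tends to the value at `x`; the
  -- detour therefore does not count at first order.
  have hlim : ∀ k, Tendsto (fun h : ℝ => (ℓ + C) * (κ * h) +
      Real.exp (-(lam * (κ * h))) * (w k x (κ * h.toNNReal) + h ^ 2)) (𝓝[>] 0) (𝓝 (w k x 0)) := by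
    intro k
    have t1 : Tendsto (fun h : ℝ => ((x, κ * h.toNNReal) : Space n × ℝ≥0)) (𝓝[>] 0)
        (𝓝[K ×ˢ Iic s₀] (x, 0)) := by
      refine tendsto_nhdsWithin_iff.2 ⟨?_, ?_⟩
      · have hc : Continuous fun h : ℝ => ((x, κ * h.toNNReal) : Space n × ℝ≥0) := by fun_prop
        have := (hc.tendsto 0).mono_left (nhdsWithin_le_nhds (s := Ioi 0))
        simpa using this
      · have hc : Tendsto (fun h : ℝ => κ * h.toNNReal) (𝓝[>] 0) (𝓝 0) := by
          have hc : Continuous fun h : ℝ => κ * h.toNNReal := by fun_prop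
          have := (hc.tendsto 0).mono_left (nhdsWithin_le_nhds (s := Ioi 0))
          simpa using this
        filter_upwards [hc.eventually_le_const hV.pos] with h hh
        exact ⟨hV.mem, hh⟩
    have t2 := (hV.continuousWithinAt k).tendsto.comp t1
    have t3 : Tendsto (fun h : ℝ => Real.exp (-(lam * (κ * h)))) (𝓝[>] 0) (𝓝 1) := by
      have hc : Continuous fun h : ℝ => Real.exp (-(lam * (κ * h))) := by fun_prop
      simpa using (hc.tendsto 0).mono_left (nhdsWithin_le_nhds (s := Ioi 0))
    have := ((hid.const_mul (κ : ℝ)).const_mul ((ℓ : ℝ) + C)).add (t3.mul (t2.add (hid.pow 2)))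
    simpa using this
  have hi1 := (hlim i).eventually_lt_const (u := W + 1) (by linarith)
  have hj1 := (hlim j).eventually_lt_const (u := Wj + δ) (by linarith)
  obtain ⟨h₁, hh₁, Hdisc⟩ := exists_discount_le (lam := lam) (M := ℓ) (c := ℓ + δ) (by linarith)
  have hsmall : ∀ᶠ h in 𝓝[>] (0 : ℝ), h < min r (min h₁ (min δ (min (s₀ / κ) (min (r / (‖v‖ + 1))
      (min (ρ / (‖v‖ + 1)) (1 / (‖v‖ + 1))))))) :=
    nhdsWithin_le_nhds (Iio_mem_nhds (by simp only [lt_min_iff]; refine ⟨hr, hh₁, hδ, ?_, ?_, ?_, ?_⟩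
                                         <;> positivity))
  obtain ⟨h, hgain, hi1, hj1, hsmall, hpos⟩ :=
    (hgain.and (hi1.and (hj1.and (hsmall.and self_mem_nhdsWithin)))).exists
  replace hpos : 0 < h := hpos
  lift h to ℝ≥0 using hpos.le
  simp only [lt_min_iff, Real.toNNReal_coe] at hsmall hgain hi1 hj1
  obtain ⟨hr', hh₁', hδ', hs', hrv, hρv, h1v⟩ := hsmall
  rw [lt_div_iff₀ (by positivity)] at hs' hrv hρv h1v
  have hv1 := norm_nonneg v
  have hsv : ∀ t : ℝ, 0 ≤ t → t ≤ h → ‖t • v‖ ≤ h * ‖v‖ := fun t h0 ht => by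
    rw [norm_smul, Real.norm_of_nonneg h0]
    exact mul_le_mul_of_nonneg_right ht hv1
  have hball : ∀ t : ℝ, 0 ≤ t → t ≤ h →
      L i (x - t • v) v ≤ ENNReal.ofReal (inner ℝ p v - H i x p + δ) ∧ x - t • v ∈ K :=
    fun t h0 ht => hnear (by
      rw [dist_eq_norm, sub_sub_cancel_left, norm_neg]
      have := hsv t h0 ht
      linarith)
  have hhs : h ≤ s₀ := by
    rw [← NNReal.coe_le_coe]
    have := le_mul_of_one_le_right hpos.le hκ1
    linarith
  have hmain := hV.le_of_excursion hL hlam hg hP hq hji (v := v) (δ := d) hd0 (C := C) (ℓ := ℓ)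
    (h := h) (S := κ * h) (fun k y u hu => hC k y u (hu.trans hdv)) (fun t h0 ht => (hball t h0 ht).1)
    (fun t h0 ht => (hball t h0 ht).2) (by
      rw [← NNReal.coe_le_coe, NNReal.coe_mul]; linarith)
    (le_mul_of_one_le_left zero_le (by exact_mod_cast hκ1))
    (by rw [NNReal.coe_mul, hκd]; field_simp; rfl)
    (by have := hsv h hpos.le le_rfl; linarith) (e := (h : ℝ) ^ 2) (by positivity)
  have hw := hup (x - (h : ℝ) • v) (hball h hpos.le le_rfl).2 h hhs (by
    rw [sub_sub_cancel_left, norm_neg]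
    have := hsv h hpos.le le_rfl
    linarith) hr'
  rw [sub_sub_cancel_left, norm_neg, inner_neg_right, real_inner_smul_right] at hw
  have hσ : δ / (‖v‖ + 1) * (‖(h : ℝ) • v‖ + h) ≤ δ * h := by
    rw [div_mul_eq_mul_div, div_le_iff₀ (by positivity), mul_assoc]
    refine mul_le_mul_of_nonneg_left ?_ hδ.le
    have := hsv h hpos.le le_rfl
    linarith
  set ex := Real.exp (-(lam * h)) with hex
  have hex0 : 0 < ex := Real.exp_pos _
  -- The running cost was bounded without discount; at the price of `δ` it is put under the common
  -- factor `ex`.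
  have hdisc : (ℓ : ℝ) ≤ ex * (ℓ + δ) := Hdisc h hpos.le hh₁' _ le_rfl
  have hN : ℓ * h + ex * (w i (x - (h : ℝ) • v) h + (h : ℝ) ^ 2) ≤
      ex * (W + h * (a - inner ℝ p v + 2 * δ + (ℓ + δ))) := by
    have h0 := mul_le_mul_of_nonneg_right hδ'.le hpos.le
    have h1 : w i (x - (h : ℝ) • v) h + (h : ℝ) ^ 2 ≤ W + h * (a - inner ℝ p v + 2 * δ) := by
      linarith
    have h2 := mul_le_mul_of_nonneg_left h1 hex0.le
    have h3 := mul_le_mul_of_nonneg_right hdisc hpos.le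
    linarith
  set N := ex * (W + h * (a - inner ℝ p v + 2 * δ + (ℓ + δ))) with hNdef
  have hprob := (hP i).isProbabilityMeasure
  set E₀ := (P i).real (stay i h) with hE₀
  set Ei := (P i).real ((stay i h)ᶜ ∩ {ω | ω.1 (κ * h) = i}) with hEi
  set Ej := (P i).real ((stay i h)ᶜ ∩ {ω | ω.1 (κ * h) = j}) with hEj
  set U := (P i).real (stay i h)ᶜ with hU
  have hE₀U : E₀ = 1 - U := by
    have := probReal_compl_eq_one_sub (μ := P i) (history_le h _ (measurableSet_stay i h))
    rw [hE₀, hU, this]; ring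
  have hUij : U = Ei + Ej := by
    have := measureReal_inter_add_sdiff (μ := P i) (s := (stay i h)ᶜ)
      (measurableSet_coord_eq (κ * h) i)
    rw [hU, ← this, hEi, hEj]
    congr 2
    ext ω
    simp only [Set.mem_sdiff, mem_inter_iff, mem_ofPred_eq]
    rw [← coord_ne_iff hji]
  rw [NNReal.coe_mul] at hmain
  have m0 : 0 ≤ E₀ := measureReal_nonneg
  have mi : 0 ≤ Ei := measureReal_nonneg
  have mj : 0 ≤ Ej := measureReal_nonneg
  have b0 := mul_le_mul_of_nonneg_left hN m0
  have b1 := mul_le_mul_of_nonneg_left hi1.le mi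
  have b2 := mul_le_mul_of_nonneg_left hj1.le mj
  have hEj' : Ej = U - Ei := by linarith
  have hfin : W ≤ (1 - U) * N + (Ei * (W + 1) + (U - Ei) * (Wj + δ)) := by
    rw [← hE₀U, ← hEj']; linarith
  have hhpos : 0 < (h : ℝ) ^ 2 := by positivity
  have e1 : ex * (-W + h * -(a - inner ℝ p v + 2 * δ + (ℓ + δ))) = -N := by rw [hNdef]; ring
  rw [e1] at hgain
  have e2 : (P i).real (D h) = Ei := by simp only [hD, Real.toNNReal_coe, hEi]
  rw [e2] at hgain
  linarith

end Sub

end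

/-! ### Duality between Hamiltonian and Lagrangian. -/

section
variable {n : ℕ}

/-! ### Lagrangians of periodic coercive Hamiltonians -/

theorem le_lagrangian (H : Space n → Space n → ℝ) (ξ v p : Space n) :
    ((inner ℝ p v - H ξ p : ℝ) : EReal) ≤ lagrangian H ξ v :=
  le_iSup (fun p : Space n => ((inner ℝ p v - H ξ p : ℝ) : EReal)) p

theorem lagrangian_le {H : Space n → Space n → ℝ} {ξ v : Space n} {c : ℝ}
    (h : ∀ p, inner ℝ p v - H ξ p ≤ c) : lagrangian H ξ v ≤ c :=
  iSup_le fun p => EReal.coe_le_coe_iff.2 (h p)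

section Hamiltonian

variable {H : Space n → Space n → ℝ}

/-- Periodicity moves `ξ` into the unit cube, and a continuous function is bounded on the compact
product with a ball. -/
theorem IsConvexHamiltonian.exists_bound (hH : IsConvexHamiltonian H) (R : ℝ) :
    ∃ C, 0 ≤ C ∧ ∀ ξ p : Space n, ‖p‖ ≤ R → |H ξ p| ≤ C := by
  have hcube : IsCompact ((fun z : Fin n → ℝ => (WithLp.toLp 2 z : Space n)) '' Icc 0 1) :=
    isCompact_Icc.image (PiLp.continuous_toLp 2 _)
  obtain ⟨C, hC⟩ := (hcube.prod (isCompact_closedBall (0 : Space n) R)).exists_bound_of_continuousOn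
    hH.continuous.continuousOn
  refine ⟨max C 0, le_max_right _ _, fun ξ p hp => (le_max_left C 0).trans' ?_⟩
  set ξ' : Space n := WithLp.toLp 2 fun k => Int.fract (ξ k) with hξ'
  have e : ξ = ξ' + WithLp.toLp 2 (fun k => ((⌊ξ k⌋ : ℤ) : ℝ)) := by
    ext k
    simp [hξ', Int.fract_add_floor]
  rw [e, hH.periodic]
  refine hC (ξ', p) ⟨⟨fun k => Int.fract (ξ k), ⟨fun k => Int.fract_nonneg _,
    fun k => (Int.fract_lt_one _).le⟩, rfl⟩, by simpa using hp⟩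

/-- Coercivity and convexity give linear growth. -/
theorem IsConvexHamiltonian.exists_linear_growth (hH : IsConvexHamiltonian H) :
    ∃ δ > 0, ∃ C, 0 ≤ C ∧ ∀ ξ p : Space n, δ * ‖p‖ - C ≤ H ξ p := by
  obtain ⟨C₀, hC₀, h₀⟩ := hH.exists_bound 0
  obtain ⟨r₀, hr₀⟩ := hH.coercive (C₀ + 1)
  set r := max r₀ 1 with hr
  have hr1 : 0 < r := lt_of_lt_of_le one_pos (le_max_right _ _)
  obtain ⟨C₁, hC₁, h₁⟩ := hH.exists_bound r
  refine ⟨1 / r, by positivity, C₀ + C₁ + 1, by positivity, fun ξ p => ?_⟩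
  rcases le_total ‖p‖ r with hp | hp
  · have := (abs_le.1 (h₁ ξ p hp)).1
    have h2 : 1 / r * ‖p‖ ≤ 1 := by rw [one_div_mul_eq_div, div_le_one hr1]; exact hp
    linarith
  · have hp0 : 0 < ‖p‖ := hr1.trans_le hp
    set t := r / ‖p‖ with ht
    have ht0 : 0 < t := by positivity
    have ht1 : t ≤ 1 := (div_le_one hp0).2 hp
    -- On the segment from 0 to `p`, coercivity makes `H` exceed its value at 0 by at least 1 at
    -- distance `r`; convexity propagates this slope outwards.
    have hc := (hH.convex ξ).2 (mem_univ 0) (mem_univ p) (sub_nonneg.2 ht1) ht0.le (by ring)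
    simp only [smul_zero, zero_add, smul_eq_mul] at hc
    have h2 := hr₀ ξ (t • p) (by
      rw [norm_smul, Real.norm_of_nonneg ht0.le, ht, div_mul_cancel₀ _ hp0.ne']
      exact le_max_left _ _)
    obtain ⟨h3, h4⟩ := abs_le.1 (h₀ ξ 0 (by simp))
    have h5 : 1 ≤ t * (H ξ p - H ξ 0) := by nlinarith
    have h6 : 1 / r * ‖p‖ = 1 / t := by rw [ht]; field_simp
    have h7 : 1 / t ≤ H ξ p - H ξ 0 := by rw [div_le_iff₀ ht0]; linarith
    linarith

theorem IsConvexHamiltonian.exists_lagrangian_le (hH : IsConvexHamiltonian H) :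
    ∃ δ > 0, ∃ C : ℝ, 0 ≤ C ∧ ∀ ξ v : Space n, ‖v‖ ≤ δ → lagrangian H ξ v ≤ C := by
  obtain ⟨δ, hδ, C, hC, h⟩ := hH.exists_linear_growth
  refine ⟨δ, hδ, C, hC, fun ξ v hv => lagrangian_le fun p => ?_⟩
  have h1 := real_inner_le_norm p v
  have h2 := mul_le_mul_of_nonneg_left hv (norm_nonneg p)
  have h3 := h ξ p
  linarith

/-- A continuous affine minorant passing within `δ` of the graph at `p` serves as an approximate
subgradient. -/
theorem IsConvexHamiltonian.exists_affine_le (hH : IsConvexHamiltonian H) (ξ p : Space n) {δ : ℝ}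
    (hδ : 0 < δ) : ∃ v : Space n, ∀ p', H ξ p - δ + (inner ℝ p' v - inner ℝ p v) ≤ H ξ p' := by
  have hcont : Continuous (H ξ) := hH.continuous.comp (by fun_prop : Continuous fun p => (ξ, p))
  obtain ⟨l, c, hl, hc⟩ := ConvexOn.exists_affine_le_of_lt (𝕜 := ℝ) (mem_univ p)
    (sub_lt_self (H ξ p) hδ) isClosed_univ (hcont.lowerSemicontinuous.lowerSemicontinuousOn _)
    (hH.convex ξ)
  refine ⟨(InnerProductSpace.toDual ℝ (Space n)).symm l, fun p' => ?_⟩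
  have h1 := hl ⟨p', mem_univ _⟩
  have h2 : ∀ u, inner ℝ u ((InnerProductSpace.toDual ℝ (Space n)).symm l) = l u := fun u => by
    rw [real_inner_comm, InnerProductSpace.toDual_symm_apply]
  simp only [h2]
  simp at h1 hc
  linarith

/-- The supremum in `H = L*` is nearly attained, with a velocity that is uniformly good for nearby
positions. -/
theorem IsConvexHamiltonian.exists_velocity (hH : IsConvexHamiltonian H) (ξ p : Space n) {δ : ℝ}
    (hδ : 0 < δ) : ∃ v : Space n, ∀ᶠ ξ' in 𝓝 ξ,
      lagrangian H ξ' v ≤ ((inner ℝ p v - H ξ p + δ : ℝ) : EReal) := by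
  obtain ⟨δ₀, hδ₀, C, hC, hgrow⟩ := hH.exists_linear_growth
  set e := δ / 3 with he
  have he0 : 0 < e := by positivity
  obtain ⟨u, hu⟩ := hH.exists_affine_le ξ p he0
  set t := min 1 (e / (|H ξ p| + C + 1)) with ht
  have ht0 : 0 < t := lt_min one_pos (by positivity)
  have ht1 : t ≤ 1 := min_le_left _ _
  have htC : t * (|H ξ p| + C) ≤ e := by
    have h1 : t ≤ e / (|H ξ p| + C + 1) := min_le_right _ _
    rw [le_div_iff₀ (by positivity)] at h1
    linarith
  -- At distance `R` from `p` the decay term `t * δ₀ * ‖p'‖` is worth at least `5 * e`.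
  set R := ‖p‖ + 5 * e / (t * δ₀) with hR
  have hR0 : 0 < R := by positivity
  have hR1 : t * δ₀ * (R - ‖p‖) = 5 * e := by rw [hR, add_sub_cancel_left]; field_simp
  -- Shrinking the approximate subgradient leaves a fraction `t` of the linear growth of `H`, so `p'
  -- · v - H ξ p'` decays in `p'`. The supremum is then controlled on a ball, where `H ξ'` is
  -- uniformly close to `H ξ`.
  set v := (1 - t) • u with hv
  set T := inner ℝ p v - H ξ p with hT
  have hξ : ∀ p', inner ℝ p' v - H ξ p' ≤ T + 2 * e - t * δ₀ * ‖p'‖ := by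
    intro p'
    have h1 := mul_le_mul_of_nonneg_left (hu p') (sub_nonneg.2 ht1)
    have h2 := mul_le_mul_of_nonneg_left (hgrow ξ p') ht0.le
    have h3 := mul_le_mul_of_nonneg_left (le_abs_self (H ξ p)) ht0.le
    have h4 : t * e ≥ 0 := by positivity
    rw [hT, hv, real_inner_smul_right, real_inner_smul_right]
    nlinarith
  refine ⟨v, ?_⟩
  have hnear : ∀ᶠ ξ' in 𝓝 ξ, ∀ p' ∈ Metric.closedBall p R, |H ξ' p' - H ξ p'| < e := by
    refine (isCompact_closedBall p R).eventually_forall_of_forall_eventually fun p' _ => ?_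
    have hc : Continuous fun z : Space n × Space n => |H z.1 z.2 - H ξ z.2| :=
      (hH.continuous.sub (hH.continuous.comp
        (by fun_prop : Continuous fun z : Space n × Space n => (ξ, z.2)))).abs
    exact hc.continuousAt.eventually_lt_const (by simpa using he0)
  filter_upwards [hnear] with ξ' hξ'
  refine lagrangian_le fun p' => ?_
  rw [hT.symm]
  have hball : ∀ p' ∈ Metric.closedBall p R,
      inner ℝ p' v - H ξ' p' ≤ T + 3 * e - t * δ₀ * ‖p'‖ := fun p' hp' => by
    have h1 := (abs_lt.1 (hξ' p' hp')).1
    have h2 := hξ p'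
    linarith
  rcases le_or_gt ‖p' - p‖ R with hp | hp
  · have h1 := hball p' (by rwa [mem_closedBall_iff_norm])
    have h2 : 0 ≤ t * δ₀ * ‖p'‖ := by positivity
    linarith
  -- Outside the ball: `p' ↦ p' · v - H ξ' p'` is concave, at least `T - e` at `p` and at most `T -
  -- 2 * e` at the point `z` of the sphere on the way to `p'`, hence at most `T - e` at `p'`.
  · set s := R / ‖p' - p‖ with hs
    have hd : 0 < ‖p' - p‖ := hR0.trans hp
    have hs0 : 0 < s := by positivity
    have hs1 : s ≤ 1 := (div_le_one hd).2 hp.le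
    have hsR : ‖s • (p' - p)‖ = R := by
      rw [norm_smul, Real.norm_of_nonneg hs0.le, hs, div_mul_cancel₀ _ hd.ne']
    set z := (1 - s) • p + s • p' with hz
    have hzp : z - p = s • (p' - p) := by rw [hz]; module
    have h1 := hball z (by rw [mem_closedBall_iff_norm, hzp, hsR])
    have h2 : R - ‖p‖ ≤ ‖z‖ := by
      have := norm_sub_le z p
      rw [hzp, hsR] at this
      linarith
    have h3 : 5 * e ≤ t * δ₀ * ‖z‖ := by
      rw [← hR1]; exact mul_le_mul_of_nonneg_left h2 (by positivity)
    have h4 := (hH.convex ξ').2 (mem_univ p) (mem_univ p') (sub_nonneg.2 hs1) hs0.le (by ring)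
    rw [smul_eq_mul, smul_eq_mul] at h4
    have h5 : inner ℝ z v = (1 - s) * inner ℝ p v + s * inner ℝ p' v := by
      rw [hz, inner_add_left, real_inner_smul_left, real_inner_smul_left]
    have h6 := (abs_lt.1 (hξ' p (by simp [hR0.le]))).2
    have h7 : (1 - s) * (T - e) ≤ (1 - s) * (inner ℝ p v - H ξ' p) :=
      mul_le_mul_of_nonneg_left (by linarith) (sub_nonneg.2 hs1)
    have h8 : s * (inner ℝ p' v - H ξ' p') ≤ s * (T - e) := by
      rw [← hz] at h4
      linarith
    have h9 := le_of_mul_le_mul_left h8 hs0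
    linarith

theorem IsConvexHamiltonian.lowerSemicontinuous_lagrangian (hH : IsConvexHamiltonian H) :
    LowerSemicontinuous fun z : Space n × Space n => lagrangian H z.1 z.2 := by
  refine lowerSemicontinuous_iSup fun p => Continuous.lowerSemicontinuous ?_
  refine continuous_coe_real_ereal.comp (Continuous.sub (by fun_prop) ?_)
  exact hH.continuous.comp (by fun_prop : Continuous fun z : Space n × Space n => (z.1, p))

end Hamiltonian

theorem ereal_toENNReal_coe (c : ℝ) : (c : EReal).toENNReal = ENNReal.ofReal c := by
  rw [EReal.toENNReal_of_ne_top (EReal.coe_ne_top _), EReal.toReal_coe]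

theorem toENNReal_le_ofReal {X : EReal} {c : ℝ} (h : X ≤ c) : X.toENNReal ≤ ENNReal.ofReal c := by
  rw [← ereal_toENNReal_coe]
  exact EReal.toENNReal_le_toENNReal h

theorem ofReal_le_toENNReal {X : EReal} {c : ℝ} (h : (c : EReal) ≤ X) :
    ENNReal.ofReal c ≤ X.toENNReal := by
  rw [← ereal_toENNReal_coe]
  exact EReal.toENNReal_le_toENNReal h

/-- The Lagrangians, scaled and shifted by a constant. -/
def shiftedCost (H : Fin 2 → Space n → Space n → ℝ) (ε C₀ : ℝ) (k : Fin 2) (y v : Space n) :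
    ℝ≥0∞ :=
  (lagrangian (H k) (ε⁻¹ • y) v + C₀).toENNReal

/-- Testing with `p = 0` gives `L ≥ -H(ξ, 0)`, which is bounded by periodicity. -/
theorem exists_neg_le_lagrangian {H : Fin 2 → Space n → Space n → ℝ}
    (hH : ∀ i, IsConvexHamiltonian (H i)) :
    ∃ C₀ : ℝ, 0 ≤ C₀ ∧ ∀ k ξ v, -(C₀ : EReal) ≤ lagrangian (H k) ξ v := by
  choose C hC h using fun k => (hH k).exists_bound 0
  refine ⟨C 0 + C 1, add_nonneg (hC 0) (hC 1), fun k ξ v => ?_⟩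
  refine le_trans ?_ (le_lagrangian (H k) ξ v 0)
  rw [← EReal.coe_neg, EReal.coe_le_coe_iff, inner_zero_left]
  have h1 := (abs_le.1 (h k ξ 0 (by simp))).2
  have : C k ≤ C 0 + C 1 := by
    have := hC 0; have := hC 1
    fin_cases k <;> simp <;> linarith
  linarith

theorem isRunningCost_shiftedCost {H : Fin 2 → Space n → Space n → ℝ}
    (hH : ∀ i, IsConvexHamiltonian (H i)) (ε : ℝ) {C₀ : ℝ}
    (hC₀ : ∀ k ξ v, -(C₀ : EReal) ≤ lagrangian (H k) ξ v) :
    IsRunningCost (shiftedCost H ε C₀) (fun k y p => H k (ε⁻¹ • y) p - C₀) where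
  measurable k := by
    have h1 : Measurable fun z : Space n × Space n => lagrangian (H k) (ε⁻¹ • z.1) z.2 :=
      (hH k).lowerSemicontinuous_lagrangian.measurable.comp
        (by fun_prop : Measurable fun z : Space n × Space n => (ε⁻¹ • z.1, z.2))
    exact EReal.continuous_toENNReal.measurable.comp (h1.add measurable_const)
  ge k y v p := by
    refine ofReal_le_toENNReal ?_
    rw [← sub_add, EReal.coe_add]
    exact add_le_add_left (le_lagrangian _ _ _ _) _
  slow := by
    choose δ hδ C hC h using fun k => (hH k).exists_lagrangian_le
    refine ⟨min (δ 0) (δ 1), lt_min (hδ 0) (hδ 1), (max (C 0) (C 1) + C₀).toNNReal,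
      fun k y v hv => ?_⟩
    have h1 : ‖v‖ ≤ δ k := by
      fin_cases k
      · exact hv.trans (min_le_left _ _)
      · exact hv.trans (min_le_right _ _)
    have h2 : C k ≤ max (C 0) (C 1) := by
      fin_cases k
      · exact le_max_left _ _
      · exact le_max_right _ _
    have h3 := (h k (ε⁻¹ • y) v h1).trans (EReal.coe_le_coe_iff.2 h2)
    refine toENNReal_le_ofReal ?_
    rw [EReal.coe_add]
    exact add_le_add_left h3 _
  fenchel k y p δ hδ := by
    obtain ⟨v, hv⟩ := (hH k).exists_velocity (ε⁻¹ • y) p hδ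
    have hcont : Tendsto (fun z : Space n => ε⁻¹ • z) (𝓝 y) (𝓝 (ε⁻¹ • y)) :=
      (by fun_prop : Continuous fun z : Space n => ε⁻¹ • z).tendsto y
    refine ⟨v, ?_, (hcont.eventually hv).mono fun z hz => ?_⟩
    · have h1 := (hC₀ k (ε⁻¹ • y) v).trans hv.self_of_nhds
      rw [← EReal.coe_neg, EReal.coe_le_coe_iff] at h1
      linarith
    · refine toENNReal_le_ofReal ?_
      have e : inner ℝ p v - (H k (ε⁻¹ • y) p - C₀) + δ =
          inner ℝ p v - H k (ε⁻¹ • y) p + δ + C₀ := by ring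
      rw [e, EReal.coe_add]
      exact add_le_add_left hz _
  continuous k := by
    have h1 : Continuous fun z : Space n × Space n => H k (ε⁻¹ • z.1) z.2 :=
      (hH k).continuous.comp (by fun_prop : Continuous fun z : Space n × Space n => (ε⁻¹ • z.1, z.2))
    exact h1.sub continuous_const
  bounded R := by
    choose C hC h using fun k => (hH k).exists_bound R
    refine ⟨C 0 + C 1 + |C₀|, fun k y p hp => ?_⟩
    have h1 := (abs_le.1 (h k (ε⁻¹ • y) p hp)).2
    have : C k ≤ C 0 + C 1 := by
      have := hC 0; have := hC 1
      fin_cases k <;> simp <;> linarith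
    have := neg_abs_le C₀
    linarith

end

/-! ### Undoing the shift of the running cost; the Cauchy problem. -/

section
variable {n : ℕ}

/-! ### Comparison of the costs -/

theorem measurableSet_upTo (T : WithTop ℝ≥0) : MeasurableSet (upTo T) := by
  cases T with
  | top => rw [upTo_top]; exact measurableSet_Ioi
  | coe r => rw [upTo_coe]; exact measurableSet_Ioc

section Conversion

variable {H : Fin 2 → Space n → Space n → ℝ} {ε C₀ lam : ℝ} {K Γ : Set (Space n)}
  {b : WithTop ℝ≥0} {x : Space n} {η : SwitchPath → ℝ → Space n} {τ : SwitchPath → WithTop ℝ≥0}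

theorem IsControl.extIntegral_runningCost (hη : IsControl K Γ b x η τ)
    (hH : ∀ i, IsConvexHamiltonian (H i)) (h0 : 0 ≤ C₀)
    (hC₀ : ∀ k ξ v, -(C₀ : EReal) ≤ lagrangian (H k) ξ v) (ω : SwitchPath) {T : WithTop ℝ≥0}
    (hint : IntegrableOn (fun s => Real.exp (-(lam * s)) * C₀) (upTo T)) :
    extIntegral (volume.restrict (upTo T))
        (fun s => ((Real.exp (-(lam * s)) : ℝ) : EReal) * runningCost H ε η ω s) =
      ((run (shiftedCost H ε C₀) lam η ω (upTo T) : ℝ≥0∞) : EReal) -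
        ((∫ s in upTo T, Real.exp (-(lam * s)) * C₀ : ℝ) : EReal) := by
  have hpos : ∀ᵐ s ∂(volume.restrict (upTo T)), 0 < s :=
    ae_restrict_of_forall_mem (measurableSet_upTo T) fun s hs => hs.1
  have hm : Measurable fun s : ℝ => ((Real.exp (-(lam * s)) : ℝ) : EReal) *
      lagrangian (H (ω.1 s.toNNReal)) (ε⁻¹ • η ω (max s 0)) (-deriv (η ω) s) := by
    refine Measurable.mul (measurable_coe_real_ereal.comp (by fun_prop)) ?_
    have h2 : Measurable fun s : ℝ => ω.1 s.toNNReal :=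
      measurable_coord_uncurry.comp (measurable_const.prodMk measurable_real_toNNReal)
    have h3 : Measurable fun s : ℝ => η ω (max s 0) :=
      hη.measurable_uncurry.comp measurable_prodMk_left
    exact measurable_of_state (F := fun k => lagrangian (H k))
      (fun k => (hH k).lowerSemicontinuous_lagrangian.measurable) h2 (h3.const_smul ε⁻¹)
      (measurable_deriv (η ω)).neg
  have hm' : AEMeasurable (fun s => ((Real.exp (-(lam * s)) : ℝ) : EReal) * runningCost H ε η ω s)
      (volume.restrict (upTo T)) :=
    ⟨_, hm, hpos.mono fun s hs => by simp only [runningCost, max_eq_left hs.le]⟩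
  rw [extIntegral_eq_sub hm' hint (fun s => by positivity) (Eventually.of_forall fun s => ?_)]
  · congr 2
    refine lintegral_congr fun s => ?_
    have := ereal_mul_add_coe (Real.exp_pos (-(lam * s))).le 0 _ C₀
      (hC₀ (ω.1 s.toNNReal) (ε⁻¹ • η ω s) (-deriv (η ω) s))
    simpa [runningCost, runDensity, shiftedCost] using this
  · have := neg_mul_le_affine (Real.exp_pos (-(lam * s))).le 0
      (hC₀ (ω.1 s.toNNReal) (ε⁻¹ • η ω s) (-deriv (η ω) s))
    simpa [runningCost] using this

theorem ereal_sub_add_eq {R : EReal} {a f f' c : ℝ} (h : f' - c = f - a) :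
    R - (a : EReal) + (f : EReal) = R + (f' : EReal) - (c : EReal) := by
  rw [sub_eq_add_neg, sub_eq_add_neg, add_assoc, add_assoc, ← EReal.coe_neg, ← EReal.coe_neg,
    ← EReal.coe_add, ← EReal.coe_add]
  congr 2
  linarith

theorem extIntegral_sub_const {α : Type*} [MeasurableSpace α] {m : Measure α}
    [IsProbabilityMeasure m] {G : α → EReal} (hG : Measurable G) {a : ℝ}
    (h : ∀ z, -(a : EReal) ≤ G z) (c : ℝ) :
    extIntegral m (fun z => G z - (c : EReal)) = extIntegral m G - (c : EReal) := by
  have hc := neg_abs_le c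
  have hc' := le_abs_self c
  have ha := neg_abs_le a
  have ha' := le_abs_self a
  have hm : Measurable fun z => G z - (c : EReal) := by
    simp only [sub_eq_add_neg]
    exact hG.add measurable_const
  have e : ∀ z, G z - (c : EReal) + ((|a| + |c| : ℝ) : EReal) =
      G z + ((|a| + |c| - c : ℝ) : EReal) := fun z => by
    rw [sub_eq_add_neg, add_assoc, ← EReal.coe_neg, ← EReal.coe_add]
    congr 2; ring
  have hlow : ∀ z, -((|a| + |c| - c : ℝ) : EReal) ≤ G z := fun z => by
    refine le_trans ?_ (h z)
    rw [← EReal.coe_neg, ← EReal.coe_neg, EReal.coe_le_coe_iff]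
    linarith
  have hlow' : ∀ z, -((|a| + |c| : ℝ) : EReal) ≤ G z - c := fun z => by
    have := EReal.sub_le_sub (hlow z) (le_refl (c : EReal))
    refine le_trans (le_of_eq ?_) this
    rw [← EReal.coe_neg, ← EReal.coe_neg, ← EReal.coe_sub]
    congr 1; ring
  rw [extIntegral_eq_sub_const hm.aemeasurable (by positivity) (Eventually.of_forall hlow'),
    extIntegral_eq_sub_const (k := |a| + |c| - c) hG.aemeasurable (by linarith [abs_nonneg a])
      (Eventually.of_forall hlow)]
  simp_rw [e]
  have hX : ∀ (X : EReal) (p : ℝ), X - (p : EReal) = X - ((p - c : ℝ) : EReal) - (c : EReal) :=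
    fun X p => by
      rw [sub_eq_add_neg, sub_eq_add_neg X, sub_eq_add_neg (X + _), add_assoc, ← EReal.coe_neg,
        ← EReal.coe_neg, ← EReal.coe_neg, ← EReal.coe_add]
      congr 2; ring
  exact hX _ _

end Conversion

/-! ### The finite-horizon problem -/

section Cauchy

variable {H : Fin 2 → Space n → Space n → ℝ} {ε C₀ : ℝ} {f : Fin 2 → Space n → ℝ}
  {x : Space n} {t : ℝ≥0} {η : SwitchPath → ℝ → Space n} {τ : SwitchPath → WithTop ℝ≥0}
  {μ : Measure SwitchPath}

/-- With an empty exit set the horizon is the only admissible stopping time. -/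
theorem IsControl.time_eq (hη : IsControl univ ∅ t x η τ) (ω : SwitchPath) : τ ω = t := by
  obtain ⟨r, hr⟩ := WithTop.ne_top_iff_exists.1
    (ne_top_of_le_ne_top WithTop.coe_ne_top (hη.le_horizon ω))
  rcases hη.exit ω r hr.symm with h | h
  · rw [← hr, h]
  · exact absurd h (notMem_empty _)

theorem IsControl.isTrajectory (hη : IsControl univ ∅ t x η τ) : IsTrajectory x t η where
  start := hη.start
  absolutelyContinuous ω := hη.absolutelyContinuous ω t t.coe_nonneg
  nonanticipating s _ := hη.nonanticipating s

/-- The trajectory is frozen outside `[0, t]`, since a control must be defined and non-anticipating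
at all times. -/
theorem IsTrajectory.isControl (hη : IsTrajectory x t η) :
    IsControl univ ∅ t x (fun ω s => η ω (max 0 (min s t))) (fun _ => t) where
  start ω := by simp [hη.start]
  absolutelyContinuous ω s _ :=
    AbsolutelyContinuousOnInterval.comp_monotone (hη.absolutelyContinuous ω)
      (fun u v h => max_le_max le_rfl (min_le_min h le_rfl))
      ((LipschitzWith.id.min_const _).const_max 0) fun r _ => by
        rw [uIcc_of_le t.coe_nonneg]
        exact ⟨le_max_left _ _, max_le t.coe_nonneg (min_le_right _ _)⟩
  mem _ _ _ := mem_univ _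
  nonanticipating s := by
    have h := hη.nonanticipating (min s t) (by exact_mod_cast min_le_right s t)
    have e : max 0 (min (s : ℝ) t) = ((min s t : ℝ≥0) : ℝ) := by
      rw [NNReal.coe_min, max_eq_right (le_min s.coe_nonneg t.coe_nonneg)]
    rw [e]
    exact h.mono (history.mono (min_le_left _ _)) le_rfl
  stoppingTime r := by simp
  le_horizon _ := le_rfl
  exit _ r hr := Or.inl hr.symm

/-- The cost of the finite-horizon problem. -/
def horizonCost (H : Fin 2 → Space n → Space n → ℝ) (f : Fin 2 → Space n → ℝ) (ε t : ℝ)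
    (η : SwitchPath → ℝ → Space n) (ω : SwitchPath) : EReal :=
  extIntegral (volume.restrict (Ioc 0 t)) (runningCost H ε η ω)
    + ((f (ω.1 t.toNNReal) (η ω t) : ℝ) : EReal)

theorem IsControl.horizonCost_eq (hη : IsControl univ ∅ t x η τ)
    (hH : ∀ i, IsConvexHamiltonian (H i)) (h0 : 0 ≤ C₀)
    (hC₀ : ∀ k ξ v, -(C₀ : EReal) ≤ lagrangian (H k) ξ v) (ω : SwitchPath) :
    horizonCost H f ε t η ω = pathCost (shiftedCost H ε C₀) 0 f η τ ω - ((C₀ * t : ℝ) : EReal) := by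
  have h1 := hη.extIntegral_runningCost (ε := ε) (lam := 0) hH h0 hC₀ ω (T := t) (by
    rw [upTo_coe]
    simp)
  rw [upTo_coe] at h1
  simp only [zero_mul, neg_zero, Real.exp_zero, EReal.coe_one, one_mul] at h1
  rw [horizonCost, h1, pathCost, hη.time_eq ω, upTo_coe, Real.toNNReal_coe]
  refine ereal_sub_add_eq ?_
  simp [terminal]
  ring

theorem horizonCost_congr {η η' : SwitchPath → ℝ → Space n} {ω : SwitchPath}
    (h : ∀ s : ℝ, 0 ≤ s → s ≤ t → η ω s = η' ω s) :
    horizonCost H f ε t η ω = horizonCost H f ε t η' ω := by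
  rw [horizonCost, horizonCost, h t t.coe_nonneg le_rfl]
  congr 1
  refine extIntegral_congr ?_
  have : ∀ᵐ s : ℝ, s ≠ t := by simp [ae_iff, measure_singleton]
  refine (ae_restrict_iff' measurableSet_Ioc).2 (this.mono fun s hs hsI => ?_)
  have hd : deriv (η ω) s = deriv (η' ω) s := by
    refine Filter.EventuallyEq.deriv_eq ?_
    filter_upwards [Ioo_mem_nhds hsI.1 (lt_of_le_of_ne hsI.2 hs)] with r hr
    exact h r hr.1.le hr.2.le
  rw [runningCost, runningCost, hd, h s hsI.1.le hsI.2]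

theorem valueFun_eq_value [IsProbabilityMeasure μ] (hH : ∀ i, IsConvexHamiltonian (H i))
    (h0 : 0 ≤ C₀) (hC₀ : ∀ k ξ v, -(C₀ : EReal) ≤ lagrangian (H k) ξ v)
    (hf : ∀ k, Measurable (f k)) {a : ℝ}
    (hlow : ∀ η τ, IsControl univ ∅ t x η τ → ∀ ω,
      -(a : EReal) ≤ pathCost (shiftedCost H ε C₀) 0 f η τ ω) :
    valueFun (shiftedCost H ε C₀) 0 f univ ∅ μ t x = value H f ε μ x t + ((C₀ * t : ℝ) : EReal) := by
  have hL := isRunningCost_shiftedCost hH ε hC₀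
  have key : ∀ η τ, IsControl univ ∅ t x η τ → extIntegral μ (horizonCost H f ε t η) =
      extIntegral μ (pathCost (shiftedCost H ε C₀) 0 f η τ) - ((C₀ * t : ℝ) : EReal) := by
    intro η τ hη
    rw [← extIntegral_sub_const (hη.measurable_pathCost hL hf) (hlow η τ hη)]
    exact extIntegral_congr (Eventually.of_forall fun ω => hη.horizonCost_eq hH h0 hC₀ ω)
  refine le_antisymm ?_ ?_
  · rw [← EReal.sub_le_iff_le_add (.inl (EReal.coe_ne_bot _)) (.inl (EReal.coe_ne_top _))]
    refine le_iInf fun η => le_iInf fun hη => ?_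
    have hc := hη.isControl
    have e : extIntegral μ (horizonCost H f ε t η) =
        extIntegral μ (horizonCost H f ε t fun ω s => η ω (max 0 (min s t))) :=
      extIntegral_congr (Eventually.of_forall fun ω => horizonCost_congr fun s h0 h1 => by
        rw [min_eq_left h1, max_eq_right h0])
    change _ ≤ extIntegral μ (horizonCost H f ε t η)
    rw [e, key _ _ hc]
    exact EReal.sub_le_sub (iInf_le_of_le _ (iInf_le_of_le _ (iInf_le _ hc))) le_rfl
  · refine le_iInf fun η => le_iInf fun τ => le_iInf fun hη => ?_
    have h1 : value H f ε μ x t ≤ extIntegral μ (horizonCost H f ε t η) :=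
      iInf_le_of_le η (iInf_le _ hη.isTrajectory)
    rw [key _ _ hη] at h1
    exact (EReal.le_sub_iff_add_le (.inl (EReal.coe_ne_bot _)) (.inl (EReal.coe_ne_top _))).1 h1

/-- The terminal cost drops by at most `l` per unit of distance, and the running cost grows at that
rate up to a loss linear in time (`IsRunningCost.exists_run_ge` with `R = l`). -/
theorem exists_pathCost_ge (hH : ∀ i, IsConvexHamiltonian (H i))
    (hC₀ : ∀ k ξ v, -(C₀ : EReal) ≤ lagrangian (H k) ξ v) {l : ℝ≥0}
    (hl : ∀ k, LipschitzWith l (f k)) (T : ℝ≥0) (x : Space n) :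
    ∃ A, 0 ≤ A ∧ ∀ t ≤ T, ∀ (y : Space n) η τ, IsControl univ ∅ t y η τ → ∀ ω,
      -((A + l * ‖y - x‖ : ℝ) : EReal) ≤ pathCost (shiftedCost H ε C₀) 0 f η τ ω := by
  have hL := isRunningCost_shiftedCost hH ε hC₀
  obtain ⟨C, hC, hrun⟩ := hL.exists_run_ge le_rfl l.coe_nonneg
  refine ⟨C * T + (|f 0 x| + |f 1 x|), by positivity, fun t ht y η τ hη ω => ?_⟩
  have h1 := hrun η ω t t.coe_nonneg (hη.absolutelyContinuous ω t t.coe_nonneg)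
  rw [pathCost, hη.time_eq ω, upTo_coe]
  refine le_trans ?_ (add_le_add_left (coe_le_coe_of_ofReal_le h1) _)
  rw [← EReal.coe_add, ← EReal.coe_neg, EReal.coe_le_coe_iff]
  simp only [terminal, zero_mul, neg_zero, Real.exp_zero, one_mul, hη.start]
  set k := ω.1 t
  have h2 := (hl k).dist_le_mul y (η ω t)
  have h3 := (hl k).dist_le_mul x y
  rw [Real.dist_eq, dist_comm, dist_eq_norm] at h2 h3
  have h4 := (abs_le.1 h2).2
  have h5 := (abs_le.1 h3).2
  have h6 : |f k x| ≤ |f 0 x| + |f 1 x| := by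
    have ha := abs_nonneg (f 0 x); have hb := abs_nonneg (f 1 x)
    generalize k = k
    fin_cases k <;> simp
  have h7 := neg_abs_le (f k x)
  have h8 : C * t ≤ C * T := mul_le_mul_of_nonneg_left (by exact_mod_cast ht) hC
  linarith

theorem IsRunningCost.exists_run_const_le {L : Fin 2 → Space n → Space n → ℝ≥0∞}
    {H : Fin 2 → Space n → Space n → ℝ} (hL : IsRunningCost L H) :
    ∃ C : ℝ≥0, ∀ (lam : ℝ) (y : Space n) (ω : SwitchPath) (A : Set ℝ), MeasurableSet A →
      run L lam (fun _ _ => y) ω A ≤ C * ∫⁻ s in A, ENNReal.ofReal (Real.exp (-(lam * s))) := by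
  obtain ⟨δ, hδ, C, hC⟩ := hL.slow
  refine ⟨C, fun lam y ω A hA => ?_⟩
  rw [← lintegral_const_mul' _ _ ENNReal.coe_ne_top]
  refine setLIntegral_mono' hA fun s _ => ?_
  rw [runDensity, mul_comm]
  refine mul_le_mul_left (hC _ _ _ ?_) _
  simpa using hδ.le

theorem valueFun_eq_coe (hH : ∀ i, IsConvexHamiltonian (H i)) (h0 : 0 ≤ C₀)
    (hC₀ : ∀ k ξ v, -(C₀ : EReal) ≤ lagrangian (H k) ξ v) {l : ℝ≥0}
    (hl : ∀ k, LipschitzWith l (f k)) [IsProbabilityMeasure μ] (x : Space n) (t : ℝ≥0) :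
    (value H f ε μ x t ≠ ⊤ ∧ value H f ε μ x t ≠ ⊥) ∧
      valueFun (shiftedCost H ε C₀) 0 f univ ∅ μ t x =
        (((value H f ε μ x t).toReal + C₀ * t : ℝ) : EReal) := by
  have hL := isRunningCost_shiftedCost hH ε hC₀
  obtain ⟨A, hA, hlow⟩ := exists_pathCost_ge (ε := ε) hH hC₀ hl t x
  have hlow' : ∀ η τ, IsControl univ ∅ t x η τ → ∀ ω,
      -(A : EReal) ≤ pathCost (shiftedCost H ε C₀) 0 f η τ ω := fun η τ hη ω => by
    simpa using hlow t le_rfl x η τ hη ω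
  have e := valueFun_eq_value (μ := μ) hH h0 hC₀ (fun k => (hl k).continuous.measurable) hlow'
  have hge : ((-A : ℝ) : EReal) ≤ valueFun (shiftedCost H ε C₀) 0 f univ ∅ μ t x :=
    le_iInf fun η => le_iInf fun τ => le_iInf fun hη =>
      coe_le_extIntegral (Eventually.of_forall fun ω => by
        rw [EReal.coe_neg]; exact hlow' η τ hη ω)
  obtain ⟨C, hC⟩ := hL.exists_run_const_le
  have hle : valueFun (shiftedCost H ε C₀) 0 f univ ∅ μ t x ≤
      ((C * t + (|f 0 x| + |f 1 x|) : ℝ) : EReal) := by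
    refine iInf_le_of_le _ (iInf_le_of_le _ (iInf_le_of_le
      (isControl_const (c := (t : WithTop ℝ≥0)) (mem_univ x) le_rfl (Or.inl rfl)) ?_))
    refine extIntegral_le_coe (Eventually.of_forall fun ω => ?_)
    rw [pathCost, upTo_coe, EReal.coe_add]
    refine add_le_add ?_ ?_
    · refine (EReal.coe_ennreal_le_coe_ennreal_iff.2 (hC 0 x ω _ measurableSet_Ioc)).trans
        (le_of_eq ?_)
      simp
      rfl
    · simp only [terminal, zero_mul, neg_zero, Real.exp_zero, one_mul, EReal.coe_le_coe_iff]
      have ha := abs_nonneg (f 0 x); have hb := abs_nonneg (f 1 x)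
      refine (le_abs_self _).trans ?_
      generalize ω.1 t = k
      fin_cases k <;> simp
  rw [e] at hge hle ⊢
  induction hV : value H f ε μ x t with
  | bot => rw [hV] at hge; simp at hge
  | top =>
    rw [hV, EReal.top_add_coe] at hle
    exact absurd hle (not_le.2 (EReal.coe_lt_top _))
  | coe r => exact ⟨⟨EReal.coe_ne_top _, EReal.coe_ne_bot _⟩, by rw [EReal.toReal_coe, EReal.coe_add]⟩

/-- Here `s` is the time already elapsed, so the remaining horizon is `t - s` and the time
derivative enters with a minus sign. -/
theorem exists_expansion {φ : Space n × ℝ → ℝ} {x : Space n} {t : ℝ}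
    (hφ : ContDiffAt ℝ 1 φ (x, t)) {σ : ℝ} (hσ : 0 < σ) :
    ∃ r > 0, ∀ (y : Space n) (s : ℝ), ‖y - x‖ < r → 0 ≤ s → s < r →
      |φ (y, t - s) - φ (x, t) - (inner ℝ (gradient (fun y => φ (y, t)) x) (y - x) -
        deriv (fun s => φ (x, s)) t * s)| ≤ σ * (‖y - x‖ + s) := by
  have hd := (hφ.differentiableAt (by simp)).hasFDerivAt
  set D := fderiv ℝ φ (x, t)
  have h1 : ∀ z, inner ℝ (gradient (fun y => φ (y, t)) x) z = D (z, 0) := fun z => by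
    have h : HasFDerivAt (fun y => φ (y, t)) (D.comp (ContinuousLinearMap.inl ℝ (Space n) ℝ)) x :=
      hd.comp x (hasFDerivAt_prodMk_left x t)
    rw [gradient, InnerProductSpace.toDual_symm_apply, h.fderiv]
    simp
  have h2 : ∀ s, deriv (fun s => φ (x, s)) t * s = D (0, s) := fun s => by
    have h : HasFDerivAt (fun s => φ (x, s)) (D.comp (ContinuousLinearMap.inr ℝ (Space n) ℝ)) t :=
      hd.comp t (hasFDerivAt_prodMk_right x t)
    rw [h.hasDerivAt.deriv]
    have e : ((0 : Space n), s) = s • ((0 : Space n), (1 : ℝ)) := by simp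
    rw [e, map_smul]
    simp [mul_comm]
  have h3 := hd.isLittleO.def hσ
  obtain ⟨r, hr, H⟩ := Metric.eventually_nhds_iff.1 h3
  refine ⟨r, hr, fun y s hy h0 hs => ?_⟩
  have h4 := H (y := (y, t - s)) (by
    rw [Prod.dist_eq, max_lt_iff, dist_eq_norm, Real.dist_eq]
    exact ⟨hy, by simpa [abs_of_nonneg h0] using hs⟩)
  have e : (y, t - s) - (x, t) = (y - x, 0) + -((0 : Space n), s) := by ext <;> simp
  have e2 : ‖(y, t - s) - (x, t)‖ ≤ ‖y - x‖ + s := by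
    rw [e]
    simp [Prod.norm_def, abs_of_nonneg h0, h0]
  rw [h1, h2]
  refine (le_of_eq ?_).trans (h4.trans (mul_le_mul_of_nonneg_left e2 hσ.le))
  rw [e, map_add, map_neg, Real.norm_eq_abs, sub_eq_add_neg (D _)]

variable {q : Fin 2 → ℝ} {P : Fin 2 → Measure SwitchPath} {T : ℝ}

theorem isLocalValue_cauchy (hH : ∀ i, IsConvexHamiltonian (H i)) (h0 : 0 ≤ C₀)
    (hC₀ : ∀ k ξ v, -(C₀ : EReal) ≤ lagrangian (H k) ξ v) {l : ℝ≥0}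
    (hl : ∀ k, LipschitzWith l (f k)) (hP : ∀ k, IsSwitchingLaw q k (P k))
    (hu : ∀ i, ContinuousOn (fun z : Space n × ℝ => (value H f ε (P i) z.1 z.2).toReal)
      (univ ×ˢ Icc 0 T)) (x : Space n) (ht0 : 0 < t) (htT : (t : ℝ) ≤ T) :
    -- Restricting to elapsed times up to `t / 2` keeps the remaining horizon positive.
    ∃ A, IsLocalValue (shiftedCost H ε C₀) 0 f univ ∅ P t x (t / 2)
      (fun k y s => (value H f ε (P k) y (t - s)).toReal + C₀ * (t - s)) A l := by
  have := fun k => (hP k).isProbabilityMeasure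
  obtain ⟨A, hA, hlow⟩ := exists_pathCost_ge (ε := ε) hH hC₀ hl t x
  have hhalf : t / 2 < t := NNReal.half_lt_self ht0.ne'
  refine ⟨A, half_pos ht0, WithTop.coe_lt_coe.2 hhalf, mem_univ x, isClosed_empty,
    fun k y _ s hs => ?_, ⟨hA, l.coe_nonneg⟩, fun y s η τ hs hη ω => ?_, fun k => ?_,
    fun k hx => absurd hx (notMem_empty x), fun k hx => absurd hx (notMem_empty x)⟩
  · have e := (valueFun_eq_coe (ε := ε) (μ := P k) hH h0 hC₀ hl y (t - s)).2
    rw [WithTop.coe_sub, NNReal.coe_sub (hs.trans hhalf.le)] at e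
    exact e
  · rw [← WithTop.coe_sub] at hη
    exact hlow _ tsub_le_self y η τ hη ω
  · have h1 : ContinuousWithinAt (fun z : Space n × ℝ≥0 => ((z.1, (t : ℝ) - z.2) : Space n × ℝ))
        (univ ×ˢ Iic (t / 2)) (x, 0) :=
      (by fun_prop : Continuous fun z : Space n × ℝ≥0 =>
        ((z.1, (t : ℝ) - z.2) : Space n × ℝ)).continuousWithinAt
    have h2 := hu k (x, (t : ℝ) - (0 : ℝ≥0)) ⟨mem_univ _, by simp, by simpa using htT⟩
    have h3 := ContinuousWithinAt.comp (x := ((x, 0) : Space n × ℝ≥0)) h2 h1 fun z hz => by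
      have hz1 : (z.2 : ℝ) ≤ t := by exact_mod_cast hz.2.trans hhalf.le
      exact ⟨mem_univ _, sub_nonneg.2 hz1, by have := z.2.coe_nonneg; simp only; linarith⟩
    exact h3.add (by fun_prop : Continuous fun z : Space n × ℝ≥0 =>
      C₀ * ((t : ℝ) - z.2)).continuousWithinAt

theorem value_zero (hP : ∀ k, IsSwitchingLaw q k (P k)) (i : Fin 2) (x : Space n) :
    value H f ε (P i) x 0 = (f i x : EReal) := by
  have := (hP i).isProbabilityMeasure
  have key : ∀ η, IsTrajectory x 0 η → extIntegral (P i) (horizonCost H f ε 0 η) = (f i x : EReal) := by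
    intro η hη
    rw [← extIntegral_const (m := P i) (f i x)]
    refine extIntegral_congr ((hP i).start.mono fun ω hω => ?_)
    simp [horizonCost, extIntegral, hη.start, hω]
  refine le_antisymm ?_ (le_iInf fun η => le_iInf fun hη => (key η hη).ge)
  have hη : IsTrajectory x 0 fun _ _ => x :=
    ⟨fun _ => rfl, fun _ => (LipschitzWith.const x).lipschitzOnWith.absolutelyContinuousOnInterval,
      fun _ _ => measurable_const⟩
  exact iInf_le_of_le _ (iInf_le_of_le hη (key _ hη).le)

theorem exists_lipschitz (hf : ∀ i, ContDiff ℝ 1 (f i))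
    (hf' : ∀ i, ∃ C : ℝ, ∀ x, ‖fderiv ℝ (f i) x‖ ≤ C) : ∃ l : ℝ≥0, ∀ k, LipschitzWith l (f k) := by
  choose C hC using hf'
  refine ⟨max (C 0).toNNReal (C 1).toNNReal, fun k =>
    lipschitzWith_of_nnnorm_fderiv_le ((hf k).differentiable (by simp)) fun x => ?_⟩
  have h1 : ‖fderiv ℝ (f k) x‖₊ ≤ (C k).toNNReal := by
    rw [← NNReal.coe_le_coe, coe_nnnorm]
    exact (hC k x).trans (Real.le_coe_toNNReal _)
  refine h1.trans ?_
  fin_cases k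
  · exact le_max_left _ _
  · exact le_max_right _ _

theorem isCauchySolution_value (hH : ∀ i, IsConvexHamiltonian (H i)) {c : Fin 2 → ℝ}
    (hq : ∀ k, 0 < c k / ε) (hP : ∀ k, IsSwitchingLaw (fun k => c k / ε) k (P k))
    {l : ℝ≥0} (hl : ∀ k, LipschitzWith l (f k))
    (hu : ∀ i, ContinuousOn (fun z : Space n × ℝ => (value H f ε (P i) z.1 z.2).toReal)
      (univ ×ˢ Icc 0 T)) :
    (∀ i x, ∀ t ∈ Icc 0 T, value H f ε (P i) x t ≠ ⊤ ∧ value H f ε (P i) x t ≠ ⊥) ∧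
      IsCauchySolution H c ε T f (fun i x t => (value H f ε (P i) x t).toReal) := by
  have := fun k => (hP k).isProbabilityMeasure
  obtain ⟨C₀, h0, hC₀⟩ := exists_neg_le_lagrangian hH
  have hL := isRunningCost_shiftedCost hH ε hC₀
  have hf : ∀ k, Measurable (f k) := fun k => (hl k).continuous.measurable
  refine ⟨fun i x t ht => ?_, hu, fun i x => ?_, ?_, ?_⟩
  · lift t to ℝ≥0 using ht.1
    exact (valueFun_eq_coe hH h0 hC₀ hl x t).1
  · rw [value_zero hP, EReal.toReal_coe]
  · intro i j hji φ x t ht hφ hmax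
    lift t to ℝ≥0 using ht.1.le
    obtain ⟨A, hV⟩ := isLocalValue_cauchy hH h0 hC₀ hl hP hu x (by exact_mod_cast ht.1) ht.2.le
    -- The summand `-C₀` in `a` is the time slope of the shift `C₀ * (t - s)`; it cancels the `-C₀`
    -- in the shifted Hamiltonian.
    have h := hV.sub hL le_rfl hf hP hq hji univ_mem
      (p := gradient (fun y => φ (y, t)) x) (a := -deriv (fun s => φ (x, s)) t - C₀) fun σ hσ => by
        obtain ⟨r₁, hr₁, h1⟩ := exists_expansion hφ hσ
        obtain ⟨r₂, hr₂, h2⟩ := Metric.eventually_nhds_iff.1 hmax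
        refine ⟨min r₁ r₂, lt_min hr₁ hr₂, fun y _ s _ hy hs => ?_⟩
        rw [lt_min_iff] at hy hs
        have h3 := (abs_le.1 (h1 y s hy.1 s.coe_nonneg hs.1)).2
        have h4 := h2 (y := (y, t - s)) (by
          rw [Prod.dist_eq, max_lt_iff, dist_eq_norm, Real.dist_eq]
          exact ⟨hy.2, by simpa using hs.2⟩)
        simp only [NNReal.coe_zero, sub_zero] at h4 ⊢
        linarith
    simp only [NNReal.coe_zero, sub_zero] at h
    linarith
  · intro i j hji φ x t ht hφ hmin
    lift t to ℝ≥0 using ht.1.le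
    obtain ⟨A, hV⟩ := isLocalValue_cauchy hH h0 hC₀ hl hP hu x (by exact_mod_cast ht.1) ht.2.le
    have h := hV.super hL le_rfl hf hP hq hji
      (p := gradient (fun y => φ (y, t)) x) (a := -deriv (fun s => φ (x, s)) t - C₀) fun σ hσ => by
        obtain ⟨r₁, hr₁, h1⟩ := exists_expansion hφ hσ
        obtain ⟨r₂, hr₂, h2⟩ := Metric.eventually_nhds_iff.1 hmin
        refine ⟨min r₁ r₂, lt_min hr₁ hr₂, fun y _ s _ hy hs => ?_⟩
        rw [lt_min_iff] at hy hs
        have h3 := (abs_le.1 (h1 y s hy.1 s.coe_nonneg hs.1)).1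
        have h4 := h2 (y := (y, t - s)) (by
          rw [Prod.dist_eq, max_lt_iff, dist_eq_norm, Real.dist_eq]
          exact ⟨hy.2, by simpa using hs.2⟩)
        simp only [NNReal.coe_zero, sub_zero] at h4 ⊢
        linarith
    rcases h with h | h
    · simp only [NNReal.coe_zero, sub_zero] at h
      linarith
    · exact absurd h.1 (notMem_empty x)

end Cauchy

end

/-! ### The Dirichlet problem. -/

section
variable {n : ℕ}

/-! ### The exit-time problem -/

section Dirichlet

variable {H : Fin 2 → Space n → Space n → ℝ} {ε C₀ : ℝ} {g : Fin 2 → Space n → ℝ}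
  {Ω : Set (Space n)} {x : Space n} {η : SwitchPath → ℝ → Space n}
  {τ : SwitchPath → WithTop ℝ≥0} {μ : Measure SwitchPath}

/-- The exit cost, cut off outside of `∂Ω` and shifted by a constant. -/
def shiftedExit (Ω : Set (Space n)) (g : Fin 2 → Space n → ℝ) (C₀ : ℝ) (k : Fin 2) (y : Space n) :
    ℝ :=
  (frontier Ω).indicator (g k) y + C₀

theorem shiftedExit_of_mem {k : Fin 2} {y : Space n} (hy : y ∈ frontier Ω) :
    shiftedExit Ω g C₀ k y = g k y + C₀ := by
  rw [shiftedExit, indicator_of_mem hy]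

theorem measurable_shiftedExit (hg : ∀ i, ContinuousOn (g i) (frontier Ω)) (k : Fin 2) :
    Measurable (shiftedExit Ω g C₀ k) := by
  have h : Measurable ((frontier Ω).indicator (g k)) := by
    classical
    rw [← Set.piecewise_eq_indicator]
    exact (hg k).measurable_piecewise continuousOn_const isClosed_frontier.measurableSet
  exact h.add_const C₀

theorem isControl_iff_isExitPair :
    IsControl (closure Ω) (frontier Ω) ⊤ x η τ ↔ IsExitPair Ω x η τ :=
  ⟨fun h => ⟨h.start, h.absolutelyContinuous, h.mem, h.nonanticipating, h.stoppingTime,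
      fun ω r hr => (h.exit ω r hr).resolve_left WithTop.coe_ne_top⟩,
    fun h => ⟨h.start, h.absolutelyContinuous, h.mem_closure, h.nonanticipating, h.stoppingTime,
      fun _ => le_top, fun ω r hr => Or.inr (h.exit_mem ω r hr)⟩⟩

/-- The cost of the exit-time problem. -/
def dischargeCost (H : Fin 2 → Space n → Space n → ℝ) (g : Fin 2 → Space n → ℝ) (ε : ℝ)
    (η : SwitchPath → ℝ → Space n) (τ : SwitchPath → WithTop ℝ≥0) (ω : SwitchPath) : EReal :=
  extIntegral (volume.restrict {s : ℝ | 0 < s ∧ ((s.toNNReal : ℝ≥0) : WithTop ℝ≥0) ≤ τ ω})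
      (fun s => ((Real.exp (-s) : ℝ) : EReal) * runningCost H ε η ω s)
    + ((exitCost g η τ ω : ℝ) : EReal)

theorem integrableOn_exp_neg_upTo (T : WithTop ℝ≥0) :
    IntegrableOn (fun s : ℝ => Real.exp (-(1 * s))) (upTo T) := by
  have h := integrableOn_exp_mul_Ioi (a := -1) (by norm_num) 0
  refine (h.mono_set fun s hs => hs.1).congr_fun (fun s _ => ?_) (measurableSet_upTo T)
  simp

theorem integral_exp_neg_upTo_top : ∫ s in upTo ⊤, Real.exp (-(1 * s)) = 1 := by
  rw [upTo_top]
  simpa using integral_exp_neg_Ioi_zero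

theorem integral_exp_neg_upTo_coe (r : ℝ≥0) :
    ∫ s in upTo r, Real.exp (-(1 * s)) = 1 - Real.exp (-r) := by
  rw [upTo_coe, ← intervalIntegral.integral_of_le r.coe_nonneg]
  simp

/-- The running shift contributes `C₀ * (1 - exp (-τ))` and the exit shift `C₀ * exp (-τ)`. The sum
is `C₀` whatever `τ` is, including `τ = ⊤`. -/
theorem IsControl.dischargeCost_eq (hη : IsControl (closure Ω) (frontier Ω) ⊤ x η τ)
    (hH : ∀ i, IsConvexHamiltonian (H i)) (h0 : 0 ≤ C₀)
    (hC₀ : ∀ k ξ v, -(C₀ : EReal) ≤ lagrangian (H k) ξ v) (ω : SwitchPath) :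
    dischargeCost H g ε η τ ω =
      pathCost (shiftedCost H ε C₀) 1 (shiftedExit Ω g C₀) η τ ω - (C₀ : EReal) := by
  have h1 := hη.extIntegral_runningCost (ε := ε) (lam := 1) hH h0 hC₀ ω (T := τ ω)
    ((integrableOn_exp_neg_upTo (τ ω)).mul_const C₀)
  rw [integral_mul_const] at h1
  have e : (fun s : ℝ => ((Real.exp (-s) : ℝ) : EReal) * runningCost H ε η ω s) =
      fun s => ((Real.exp (-(1 * s)) : ℝ) : EReal) * runningCost H ε η ω s := by
    simp only [one_mul]
  rw [dischargeCost, e]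
  change extIntegral (volume.restrict (upTo (τ ω))) _ + _ = _
  rw [h1, pathCost]
  refine ereal_sub_add_eq ?_
  cases hT : τ ω with
  | top =>
    rw [integral_exp_neg_upTo_top]
    simp [exitCost, hT, terminal]
  | coe r =>
    have hΓ := (isControl_iff_isExitPair.1 hη).exit_mem ω r hT
    rw [integral_exp_neg_upTo_coe]
    simp only [exitCost, hT, terminal, shiftedExit_of_mem hΓ, one_mul]
    ring

theorem exists_exitCost_ge (hΩ : Bornology.IsBounded Ω)
    (hg : ∀ i, ContinuousOn (g i) (frontier Ω)) (C₀ : ℝ) (L : Fin 2 → Space n → Space n → ℝ≥0∞) :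
    ∃ A : ℝ, 0 ≤ A ∧ ∀ y η τ, IsControl (closure Ω) (frontier Ω) ⊤ y η τ → ∀ ω,
      -(A : EReal) ≤ pathCost L 1 (shiftedExit Ω g C₀) η τ ω := by
  have hc : IsCompact (frontier Ω) :=
    Metric.isCompact_of_isClosed_isBounded isClosed_frontier
      (hΩ.closure.subset frontier_subset_closure)
  choose B hB using fun k => hc.exists_bound_of_continuousOn (hg k)
  refine ⟨|B 0| + |B 1| + |C₀|, by positivity, fun y η τ hη ω => ?_⟩
  have hk : ∀ k, B k ≤ |B 0| + |B 1| := fun k => by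
    have ha := abs_nonneg (B 0); have hb := abs_nonneg (B 1)
    refine (le_abs_self _).trans ?_
    fin_cases k <;> simp
  rw [pathCost, ← EReal.coe_neg]
  refine coe_le_run_add ?_
  cases hT : τ ω with
  | top => simp only [terminal]; rw [neg_nonpos]; positivity
  | coe r =>
    have hΓ := (isControl_iff_isExitPair.1 hη).exit_mem ω r hT
    simp only [terminal, shiftedExit_of_mem hΓ, one_mul]
    have h1 := (abs_le.1 (hB (ω.1 r) _ hΓ)).1
    have h2 := hk (ω.1 r)
    have h3 := neg_abs_le C₀
    have h4 : Real.exp (-(r : ℝ)) ≤ 1 := Real.exp_le_one_iff.2 (by simp)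
    have h5 := Real.exp_pos (-(r : ℝ))
    have h6 : 0 ≤ |B 0| + |B 1| + |C₀| := by positivity
    nlinarith

theorem valueFun_eq_exitValue [IsProbabilityMeasure μ] (hH : ∀ i, IsConvexHamiltonian (H i))
    (h0 : 0 ≤ C₀) (hC₀ : ∀ k ξ v, -(C₀ : EReal) ≤ lagrangian (H k) ξ v)
    (hΩ : Bornology.IsBounded Ω) (hg : ∀ i, ContinuousOn (g i) (frontier Ω)) (x : Space n) :
    valueFun (shiftedCost H ε C₀) 1 (shiftedExit Ω g C₀) (closure Ω) (frontier Ω) μ ⊤ x =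
      exitValue H Ω g ε μ x + (C₀ : EReal) := by
  have hL := isRunningCost_shiftedCost hH ε hC₀
  obtain ⟨A, hA, hlow⟩ := exists_exitCost_ge hΩ hg C₀ (shiftedCost H ε C₀)
  have key : ∀ η τ, IsControl (closure Ω) (frontier Ω) ⊤ x η τ →
      extIntegral μ (dischargeCost H g ε η τ) =
      extIntegral μ (pathCost (shiftedCost H ε C₀) 1 (shiftedExit Ω g C₀) η τ) - (C₀ : EReal) := by
    intro η τ hη
    rw [← extIntegral_sub_const (hη.measurable_pathCost hL (measurable_shiftedExit hg))
      (hlow x η τ hη)]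
    exact extIntegral_congr (Eventually.of_forall fun ω => hη.dischargeCost_eq hH h0 hC₀ ω)
  refine le_antisymm ?_ ?_
  · rw [← EReal.sub_le_iff_le_add (.inl (EReal.coe_ne_bot _)) (.inl (EReal.coe_ne_top _))]
    refine le_iInf fun η => le_iInf fun τ => le_iInf fun hη => ?_
    have hc := isControl_iff_isExitPair.2 hη
    change _ ≤ extIntegral μ (dischargeCost H g ε η τ)
    rw [key _ _ hc]
    exact EReal.sub_le_sub (iInf_le_of_le _ (iInf_le_of_le _ (iInf_le _ hc))) le_rfl
  · refine le_iInf fun η => le_iInf fun τ => le_iInf fun hη => ?_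
    have h1 : exitValue H Ω g ε μ x ≤ extIntegral μ (dischargeCost H g ε η τ) :=
      iInf_le_of_le η (iInf_le_of_le τ (iInf_le _ (isControl_iff_isExitPair.1 hη)))
    rw [key _ _ hη] at h1
    exact (EReal.le_sub_iff_add_le (.inl (EReal.coe_ne_bot _)) (.inl (EReal.coe_ne_top _))).1 h1

theorem valueFun_exit_eq_coe [IsProbabilityMeasure μ] (hH : ∀ i, IsConvexHamiltonian (H i))
    (h0 : 0 ≤ C₀) (hC₀ : ∀ k ξ v, -(C₀ : EReal) ≤ lagrangian (H k) ξ v)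
    (hΩ : Bornology.IsBounded Ω) (hg : ∀ i, ContinuousOn (g i) (frontier Ω))
    (hx : x ∈ closure Ω) :
    (exitValue H Ω g ε μ x ≠ ⊤ ∧ exitValue H Ω g ε μ x ≠ ⊥) ∧
      valueFun (shiftedCost H ε C₀) 1 (shiftedExit Ω g C₀) (closure Ω) (frontier Ω) μ ⊤ x =
        (((exitValue H Ω g ε μ x).toReal + C₀ : ℝ) : EReal) := by
  have hL := isRunningCost_shiftedCost hH ε hC₀
  obtain ⟨A, hA, hlow⟩ := exists_exitCost_ge hΩ hg C₀ (shiftedCost H ε C₀)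
  have e := valueFun_eq_exitValue (ε := ε) (μ := μ) hH h0 hC₀ hΩ hg x
  have hge : ((-A : ℝ) : EReal) ≤
      valueFun (shiftedCost H ε C₀) 1 (shiftedExit Ω g C₀) (closure Ω) (frontier Ω) μ ⊤ x :=
    le_iInf fun η => le_iInf fun τ => le_iInf fun hη =>
      coe_le_extIntegral (Eventually.of_forall fun ω => by
        rw [EReal.coe_neg]; exact hlow x η τ hη ω)
  obtain ⟨C, hC⟩ := hL.exists_run_const_le
  have hle : valueFun (shiftedCost H ε C₀) 1 (shiftedExit Ω g C₀) (closure Ω) (frontier Ω) μ ⊤ x ≤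
      ((C : ℝ) : EReal) := by
    refine iInf_le_of_le _ (iInf_le_of_le _ (iInf_le_of_le
      -- Standing still forever is admissible, and its discounted cost is bounded.
      (isControl_const (c := ⊤) hx le_rfl (Or.inl rfl)) ?_))
    refine extIntegral_le_coe (Eventually.of_forall fun ω => ?_)
    rw [pathCost]
    simp only [terminal, EReal.coe_zero, add_zero]
    have h1 := hC 1 x ω _ (measurableSet_upTo ⊤)
    rw [← ofReal_integral_eq_lintegral_ofReal (integrableOn_exp_neg_upTo ⊤)
      (Eventually.of_forall fun s => (Real.exp_pos _).le), integral_exp_neg_upTo_top,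
      ENNReal.ofReal_one, mul_one] at h1
    exact EReal.coe_ennreal_le_coe_ennreal_iff.2 h1
  rw [e] at hge hle ⊢
  induction hV : exitValue H Ω g ε μ x with
  | bot => rw [hV] at hge; simp at hge
  | top =>
    rw [hV, EReal.top_add_coe] at hle
    exact absurd hle (not_le.2 (EReal.coe_lt_top _))
  | coe r => exact ⟨⟨EReal.coe_ne_top _, EReal.coe_ne_bot _⟩, by rw [EReal.toReal_coe, EReal.coe_add]⟩

variable {q : Fin 2 → ℝ} {P : Fin 2 → Measure SwitchPath}

/-- The infinite horizon is unchanged by elapsed time, so the value does not depend on `s`. On the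
boundary, stopping at once bounds the value by the exit cost. -/
theorem isLocalValue_dirichlet (hH : ∀ i, IsConvexHamiltonian (H i)) (h0 : 0 ≤ C₀)
    (hC₀ : ∀ k ξ v, -(C₀ : EReal) ≤ lagrangian (H k) ξ v) (hP : ∀ k, IsSwitchingLaw q k (P k))
    (hΩ : Bornology.IsBounded Ω) (hg : ∀ i, ContinuousOn (g i) (frontier Ω))
    (hu : ∀ i, ContinuousOn (fun x => (exitValue H Ω g ε (P i) x).toReal) (closure Ω))
    (hx : x ∈ closure Ω) :
    ∃ A, IsLocalValue (shiftedCost H ε C₀) 1 (shiftedExit Ω g C₀) (closure Ω) (frontier Ω) P ⊤ x 1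
      (fun k y _ => (exitValue H Ω g ε (P k) y).toReal + C₀) A 0 := by
  have := fun k => (hP k).isProbabilityMeasure
  obtain ⟨A, hA, hlow⟩ := exists_exitCost_ge hΩ hg C₀ (shiftedCost H ε C₀)
  have hval := fun (k : Fin 2) (y : Space n) (hy : y ∈ closure Ω) =>
    (valueFun_exit_eq_coe (ε := ε) (μ := P k) hH h0 hC₀ hΩ hg hy).2
  refine ⟨A, one_pos, WithTop.coe_lt_top _, hx, isClosed_frontier,
    fun k y hy s _ => ?_, ⟨hA, le_rfl⟩, fun y s η τ _ hη ω => ?_, fun k => ?_,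
    fun k hxΓ => ?_, fun k hxΓ => ?_⟩
  · rw [WithTop.top_sub_coe]
    exact hval k y hy
  · rw [WithTop.top_sub_coe] at hη
    simpa using hlow y η τ hη ω
  · have h := ContinuousWithinAt.comp (x := ((x, 0) : Space n × ℝ≥0)) (hu k x hx)
      continuous_fst.continuousWithinAt (s := closure Ω ×ˢ Iic 1) fun z hz => hz.1
    exact h.add continuousWithinAt_const
  · exact ((hg k x hxΓ).add continuousWithinAt_const).congr
      (fun y hy => shiftedExit_of_mem hy) (shiftedExit_of_mem hxΓ)
  · have hc := isControl_const (b := ⊤) (c := ((0 : ℝ≥0) : WithTop ℝ≥0)) hx le_top (Or.inr hxΓ)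
    rw [← EReal.coe_le_coe_iff, ← hval k x hx]
    refine iInf_le_of_le _ (iInf_le_of_le _ (iInf_le_of_le hc ?_))
    refine extIntegral_le_coe ((hP k).start.mono fun ω hω => le_of_eq ?_)
    rw [pathCost, upTo_coe]
    simp [run, terminal, hω]

theorem exists_expansion_space {φ : Space n → ℝ} {x : Space n} (hφ : ContDiffAt ℝ 1 φ x) {σ : ℝ}
    (hσ : 0 < σ) : ∃ r > 0, ∀ y : Space n, ‖y - x‖ < r →
      |φ y - φ x - inner ℝ (gradient φ x) (y - x)| ≤ σ * ‖y - x‖ := by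
  have hd := (hφ.differentiableAt (by simp)).hasFDerivAt
  obtain ⟨r, hr, H⟩ := Metric.eventually_nhds_iff.1 (hd.isLittleO.def hσ)
  refine ⟨r, hr, fun y hy => ?_⟩
  have h := H (y := y) (by rwa [dist_eq_norm])
  rwa [gradient, InnerProductSpace.toDual_symm_apply]

theorem isDirichletSolution_exitValue (hH : ∀ i, IsConvexHamiltonian (H i)) {c : Fin 2 → ℝ}
    (hq : ∀ k, 0 < c k / ε) (hP : ∀ k, IsSwitchingLaw (fun k => c k / ε) k (P k))
    (hΩ : Bornology.IsBounded Ω) (hg : ∀ i, ContinuousOn (g i) (frontier Ω))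
    (hu : ∀ i, ContinuousOn (fun x => (exitValue H Ω g ε (P i) x).toReal) (closure Ω)) :
    (∀ i, ∀ x ∈ closure Ω, exitValue H Ω g ε (P i) x ≠ ⊤ ∧ exitValue H Ω g ε (P i) x ≠ ⊥) ∧
      IsDirichletSolution H c ε Ω g (fun i x => (exitValue H Ω g ε (P i) x).toReal) := by
  have := fun k => (hP k).isProbabilityMeasure
  obtain ⟨C₀, h0, hC₀⟩ := exists_neg_le_lagrangian hH
  have hL := isRunningCost_shiftedCost hH ε hC₀
  refine ⟨fun i x hx => (valueFun_exit_eq_coe hH h0 hC₀ hΩ hg hx).1, hu, ?_, ?_⟩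
  · intro i j hji φ x hx hφ hmax
    obtain ⟨A, hV⟩ := isLocalValue_dirichlet hH h0 hC₀ hP hΩ hg hu hx
    -- On the boundary the alternative `u ≤ g` always holds. The differential inequality is needed
    -- in the interior only, where excursions stay in `closure Ω`.
    by_cases hxΓ : x ∈ frontier Ω
    · have h := hV.le_exit i hxΓ
      rw [shiftedExit_of_mem hxΓ] at h
      exact Or.inr ⟨hxΓ, by linarith⟩
    · have hint : x ∈ interior Ω := by
        by_contra h
        exact hxΓ ⟨hx, h⟩
      have hK : closure Ω ∈ 𝓝 x :=
        mem_of_superset (mem_interior_iff_mem_nhds.1 hint) subset_closure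
      -- The shift of the value by `C₀`, with discount rate 1, cancels the `-C₀` in the shifted
      -- Hamiltonian; nothing depends on time, hence `a = 0`.
      have h := hV.sub hL zero_le_one (measurable_shiftedExit hg) hP hq hji hK
        (p := gradient φ x) (a := 0) fun σ hσ => by
          obtain ⟨r₁, hr₁, h1⟩ := exists_expansion_space hφ hσ
          obtain ⟨r₂, hr₂, h2⟩ := Metric.mem_nhdsWithin_iff.1 hmax
          refine ⟨min r₁ r₂, lt_min hr₁ hr₂, fun y hyK s _ hy _ => ?_⟩
          rw [lt_min_iff] at hy
          have h3 := (abs_le.1 (h1 y hy.1)).2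
          have h4 := h2 ⟨mem_ball_iff_norm.2 hy.2, hyK⟩
          rw [mem_ofPred_eq] at h4
          have h5 : 0 ≤ σ * s := by positivity
          linarith
      left
      linarith
  · intro i j hji φ x hx hφ hmin
    obtain ⟨A, hV⟩ := isLocalValue_dirichlet hH h0 hC₀ hP hΩ hg hu hx
    have h := hV.super hL zero_le_one (measurable_shiftedExit hg) hP hq hji
      (p := gradient φ x) (a := 0) fun σ hσ => by
        obtain ⟨r₁, hr₁, h1⟩ := exists_expansion_space hφ hσ
        obtain ⟨r₂, hr₂, h2⟩ := Metric.mem_nhdsWithin_iff.1 hmin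
        refine ⟨min r₁ r₂, lt_min hr₁ hr₂, fun y hyK s _ hy _ => ?_⟩
        rw [lt_min_iff] at hy
        have h3 := (abs_le.1 (h1 y hy.1)).1
        have h4 := h2 ⟨mem_ball_iff_norm.2 hy.2, hyK⟩
        rw [mem_ofPred_eq] at h4
        have h5 : 0 ≤ σ * s := by positivity
        linarith
    rcases h with h | ⟨hxΓ, h⟩
    · left
      linarith
    · rw [shiftedExit_of_mem hxΓ] at h
      exact Or.inr ⟨hxΓ, by linarith⟩

end Dirichlet

end

end SwitchingControl

end

theorem mainTheorem12 (n : ℕ)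
    (H : Fin 2 → SwitchingControl.Space n → SwitchingControl.Space n → ℝ)
    (hH : ∀ i, SwitchingControl.IsConvexHamiltonian (H i))
    (c : Fin 2 → ℝ) (hc : ∀ i, 0 < c i) (ε : ℝ) (hε : 0 < ε)
    (P : Fin 2 → Measure SwitchingControl.SwitchPath)
    (hP : ∀ i, SwitchingControl.IsSwitchingLaw (fun k => c k / ε) i (P i)) :
    -- the finite-horizon problem
    (∀ (T : ℝ) (_ : 0 < T) (f : Fin 2 → SwitchingControl.Space n → ℝ)
        (_ : ∀ i, ContDiff ℝ 1 (f i)) (_ : ∀ i, ∃ C : ℝ, ∀ x, ‖fderiv ℝ (f i) x‖ ≤ C)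
        (_ : ∀ i, ContinuousOn (fun z : SwitchingControl.Space n × ℝ =>
          (SwitchingControl.value H f ε (P i) z.1 z.2).toReal) (univ ×ˢ Icc 0 T)),
      (∀ i x, ∀ t ∈ Icc 0 T, SwitchingControl.value H f ε (P i) x t ≠ ⊤ ∧
        SwitchingControl.value H f ε (P i) x t ≠ ⊥) ∧
      SwitchingControl.IsCauchySolution H c ε T f
        (fun i x t => (SwitchingControl.value H f ε (P i) x t).toReal)) ∧
    -- the exit-time problem
    (∀ (Ω : Set (SwitchingControl.Space n)) (_ : IsOpen Ω) (_ : IsConnected Ω)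
        (_ : Bornology.IsBounded Ω) (g : Fin 2 → SwitchingControl.Space n → ℝ)
        (_ : ∀ i, ContinuousOn (g i) (frontier Ω))
        (_ : ∀ i, ContinuousOn (fun x => (SwitchingControl.exitValue H Ω g ε (P i) x).toReal)
          (closure Ω)),
      (∀ i, ∀ x ∈ closure Ω, SwitchingControl.exitValue H Ω g ε (P i) x ≠ ⊤ ∧
        SwitchingControl.exitValue H Ω g ε (P i) x ≠ ⊥) ∧
      SwitchingControl.IsDirichletSolution H c ε Ω g
        (fun i x => (SwitchingControl.exitValue H Ω g ε (P i) x).toReal)) := by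
  have hq : ∀ k, 0 < c k / ε := fun k => div_pos (hc k) hε
  refine ⟨fun T _ f hf hf' hu => ?_, fun Ω _ _ hΩ g hg hu => ?_⟩
  · obtain ⟨l, hl⟩ := SwitchingControl.exists_lipschitz hf hf'
    exact SwitchingControl.isCauchySolution_value hH hq hP hl hu
  · exact SwitchingControl.isDirichletSolution_exitValue hH hq hP hΩ hg hu
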